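/- Let $f:[0,\infty)\times\mathbb R\to\mathbb R$, $(r,t)\mapsto f(r,t)$, be a smooth function such that $$f(r,t)=\begin{cases}\sin r & 0\le r\le \tfrac{3\pi}{4},\\ \phi(r) & \tfrac{3\pi}{4}\le r\le\pi,\\ 2+r-\pi & \pi\le r\le 2\pi,\\ 2+r-\pi & r\ge 2\pi,\ t\le 0,\end{cases}\qquad f(r,t)>2+r-\pi\ \text{ if } r>2\pi,\ t>0,$$ for some $\phi:[\tfrac{3\pi}{4},\pi]\to(0,2]$. Such functions exist. In cylindrical coordinates $(t,r,\alpha)$ on $\mathbb R^3$ consider $$g_{E}=dt^2+dr^2+f(r,t)^2\,d\alpha^2,\qquad g_{H}=dt^2+e^{2t}\bigl(dr^2+f(r,t)^2\,d\alpha^2\bigr),$$ extended continuously to the axis $r=0$. A *plane* in a Riemannian manifold $M$ is a closed totally geodesic $2$-dimensional submanifold diffeomorphic to $\mathbb R^2$ whose induced metric has constant curvature $\le 0$; a *plane cover* is a family $\mathcal P$ of planes with union $M$. For $K\subset M$ let $\operatorname{conv}_\Sigma(K)$ be the (geodesic) convex hull of $K\cap\Sigma$ in the plane $\Sigma$, and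 put $$\widehat K=\{x\in M \mid x\in\operatorname{conv}_\Sigma(K)\text{ for all }\Sigma\in\mathcal P\text{ with }x\in\Sigma\}.$$ A unit speed geodesic $\gamma:\mathbb R\to M$ is *escaping* if it is a proper map. $M$ *has a support theorem* if to every compact $K\subset M$ one can assign a compact set $\widetilde K\subset M$ such that (a) if $F:M\to\mathbb R$ is continuous with compact support and $\int_{-\infty}^{\infty}F(\gamma(s))\,ds=0$ for all escaping geodesics $\gamma$ contained in $M\setminus K$, then $\operatorname{supp}F\subset\widetilde K$; (b) if $K_1\supset K_2\supset\cdots$ are compact with $\operatorname{diam}K_n\to0$, then $\operatorname{diam}\widetilde{K_n}\to0$. For every such $f$ and each $g\in\{g_E,g_H\}$: 1. $g$ is a smooth, complete Riemannian metric on $\mathbb R^3$, and $(\mathbb R^3,g)$ is not homogeneous. 2. $g$ has conjugate points: for all $t$ and $\alpha$ the points $(t,\frac\pi2,\alpha)$ and $(t,\frac\pi2,\alpha+\pi)$ are conjugate along some geodesic. 3. The sets $E_\alpha=\{(t,r,\alpha),(t,r,\alpha+\pi)\mid t\in\mathbb R,\ r\ge0\}$, $\alpha\in[0,\pi)$, form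 a plane cover $\mathcal P$ of $(\mathbb R^3,g)$; the induced metrics have constant curvature $0$ for $g=g_E$ and $-1$ for $g=g_H$. 4. For every nonempty compact $K\subset\mathbb R^3$, with $D=\max_{k\in K}d_g(0,k)$, the set $\widehat K$ formed with this $\mathcal P$ is contained in the closed $d_g$-ball $\overline{B_D(0)}$. For $g=g_E$ moreover $d_g(0,p)=\sqrt{t^2+r^2}$ for every point $p=(t,r,\alpha)$. 5. $(\mathbb R^3,g)$ has a support theorem. -/

import Mathlib

open Set Filter Topology MeasureTheory
open scoped Matrix ENNReal NNReal Manifold ContDiff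

noncomputable section

namespace PlaneCovers

/-! ### Riemannian geometry of `ℝⁿ` in its global chart

Points and tangent vectors are elements of `Fin n → ℝ`, which is only used for its topology and its
smooth structure; lengths and distances are always taken with respect to a metric tensor `g`. -/

/-- The coordinate space `ℝⁿ`. -/
abbrev Coord (n : ℕ) : Type := Fin n → ℝ

/-- A metric tensor, given by its components `g p i j = g_p(∂ᵢ, ∂ⱼ)`. -/
abbrev MetricTensor (n : ℕ) : Type := Coord n → Matrix (Fin n) (Fin n) ℝ

/-- `g` is a smooth Riemannian metric on `ℝⁿ`. -/
structure IsRiemannianMetric {n : ℕ} (g : MetricTensor n) : Prop where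
  smooth : ∀ i j, ContDiff ℝ ∞ (fun p => g p i j)
  posDef : ∀ p, (g p).PosDef

/-- The scalar product `g_p(v, w)`. -/
def innerAt {n : ℕ} (g : MetricTensor n) (p v w : Coord n) : ℝ :=
  v ⬝ᵥ (g p *ᵥ w)

/-- The partial derivative `∂ᵢ F`. -/
def partialDeriv {n : ℕ} (i : Fin n) (F : Coord n → ℝ) (p : Coord n) : ℝ :=
  fderiv ℝ F p (Pi.single i 1)

/-- The Christoffel symbol `Γᵏᵢⱼ` of the Levi-Civita connection of `g`. -/
def christoffel {n : ℕ} (g : MetricTensor n) (k i j : Fin n) (p : Coord n) : ℝ :=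
  (1 / 2) * ∑ l, (g p)⁻¹ k l *
    (partialDeriv i (fun q => g q j l) p + partialDeriv j (fun q => g q i l) p
      - partialDeriv l (fun q => g q i j) p)

/-- The vector `Γ_p(v, w) = ∑ Γᵏᵢⱼ(p) vⁱ wʲ ∂ₖ`. -/
def christoffelVec {n : ℕ} (g : MetricTensor n) (p v w : Coord n) : Coord n :=
  fun k => ∑ i, ∑ j, christoffel g k i j p * v i * w j

/-- The curvature tensor `R(X, Y)Z = ∇_X ∇_Y Z - ∇_Y ∇_X Z - ∇_[X,Y] Z` at the point `p`. -/
def curvature {n : ℕ} (g : MetricTensor n) (p X Y Z : Coord n) : Coord n :=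
  fun l => ∑ i, ∑ j, ∑ k,
    (partialDeriv i (christoffel g l j k) p - partialDeriv j (christoffel g l i k) p
      + ∑ m, (christoffel g l i m p * christoffel g m j k p
          - christoffel g l j m p * christoffel g m i k p)) * X i * Y j * Z k

/-- All sectional curvatures of `g` are equal to `κ`. -/
def HasConstantCurvature {n : ℕ} (g : MetricTensor n) (κ : ℝ) : Prop :=
  ∀ p X Y, innerAt g p (curvature g p X Y Y) X =
    κ * (innerAt g p X X * innerAt g p Y Y - innerAt g p X Y ^ 2)

/-- The covariant derivative along the curve `γ` of the vector field `V` along `γ`. -/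
def covDeriv {n : ℕ} (g : MetricTensor n) (γ V : ℝ → Coord n) (s : ℝ) : Coord n :=
  deriv V s + christoffelVec g (γ s) (deriv γ s) (V s)

/-- `γ : ℝ → ℝⁿ` is a geodesic of `g` (parametrized proportionally to arc length, possibly
constant). -/
def IsGeodesic {n : ℕ} (g : MetricTensor n) (γ : ℝ → Coord n) : Prop :=
  ContDiff ℝ ∞ γ ∧ ∀ s, covDeriv g γ (deriv γ) s = 0

/-- `p` and `q` are conjugate along some geodesic segment `γ|[a,b]` from `p` to `q`: there is a
Jacobi field along the segment that vanishes at both ends, but not identically. -/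
def AreConjugate {n : ℕ} (g : MetricTensor n) (p q : Coord n) : Prop :=
  ∃ (γ : ℝ → Coord n) (a b : ℝ), IsGeodesic g γ ∧ a < b ∧ γ a = p ∧ γ b = q ∧
    ∃ J : ℝ → Coord n, ContDiff ℝ ∞ J ∧
      (∀ s ∈ Icc a b, covDeriv g γ (covDeriv g γ J) s
        + curvature g (γ s) (J s) (deriv γ s) (deriv γ s) = 0) ∧
      J a = 0 ∧ J b = 0 ∧ ∃ s ∈ Icc a b, J s ≠ 0

/-- The norms `‖v‖ = √(g_p(v, v))` of tangent vectors. -/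
abbrev tangentENorm {n : ℕ} (g : MetricTensor n) (p : Coord n) :
    ENorm (TangentSpace 𝓘(ℝ, Coord n) p) :=
  ⟨fun v => ENNReal.ofReal √(innerAt g p v v)⟩

/-- The Riemannian distance of `g`: the infimum of the `g`-lengths of `C¹` paths. -/
def riemDist {n : ℕ} (g : MetricTensor n) (p q : Coord n) : ℝ≥0∞ :=
  letI : ∀ x : Coord n, ENorm (TangentSpace 𝓘(ℝ, Coord n) x) := tangentENorm g
  Manifold.riemannianEDist 𝓘(ℝ, Coord n) p q

/-- The diameter of a set with respect to the Riemannian distance. -/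
def riemDiam {n : ℕ} (g : MetricTensor n) (A : Set (Coord n)) : ℝ≥0∞ :=
  ⨆ p ∈ A, ⨆ q ∈ A, riemDist g p q

/-- The Riemannian distance of `g` is complete. -/
def IsCompleteMetric {n : ℕ} (g : MetricTensor n) : Prop :=
  ∀ u : ℕ → Coord n,
    (∀ ε : ℝ≥0∞, 0 < ε → ∃ N, ∀ i ≥ N, ∀ j ≥ N, riemDist g (u i) (u j) < ε) →
    ∃ x, Tendsto (fun i => riemDist g (u i) x) atTop (𝓝 0)

/-- The pullback `ψ^* g`. -/
def pullback {m n : ℕ} (g : MetricTensor n) (ψ : Coord m → Coord n) : MetricTensor m :=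
  fun u => Matrix.of fun a b =>
    innerAt g (ψ u) (fderiv ℝ ψ u (Pi.single a 1)) (fderiv ℝ ψ u (Pi.single b 1))

/-- `φ` is an isometry of the Riemannian manifold `(ℝⁿ, g)`: a diffeomorphism with `φ^* g = g`. -/
def IsIsometry {n : ℕ} (g : MetricTensor n) (φ : Coord n ≃ Coord n) : Prop :=
  ContDiff ℝ ∞ φ ∧ ContDiff ℝ ∞ φ.symm ∧ pullback g φ = g

/-- The isometry group of `(ℝⁿ, g)` acts transitively. -/
def IsHomogeneous {n : ℕ} (g : MetricTensor n) : Prop :=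
  ∀ p q, ∃ φ : Coord n ≃ Coord n, IsIsometry g φ ∧ φ p = q

/-! ### Plane covers -/

/-- `S` is a closed totally geodesic submanifold of `(ℝⁿ, g)`, diffeomorphic to `ℝ²`, whose induced
metric has constant curvature `κ`. The submanifold is the image of an injective immersion
`ψ` of `ℝ²` that is a homeomorphism onto a closed set; it is totally geodesic if its second
fundamental form vanishes, i.e. the ambient covariant derivatives `∇_a ∂_b ψ` are tangent to it. -/
def IsPlaneOfCurvature {n : ℕ} (g : MetricTensor n) (κ : ℝ) (S : Set (Coord n)) : Prop :=
  ∃ ψ : Coord 2 → Coord n, ContDiff ℝ ∞ ψ ∧ IsClosedEmbedding ψ ∧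
    (∀ u, Function.Injective (fderiv ℝ ψ u)) ∧ range ψ = S ∧
    (∀ u a b, fderiv ℝ (fun u' => fderiv ℝ ψ u' b) u a
        + christoffelVec g (ψ u) (fderiv ℝ ψ u a) (fderiv ℝ ψ u b) ∈ range (fderiv ℝ ψ u)) ∧
    HasConstantCurvature (pullback g ψ) κ

/-- A plane in `(ℝⁿ, g)`. -/
def IsPlane {n : ℕ} (g : MetricTensor n) (S : Set (Coord n)) : Prop :=
  ∃ κ ≤ 0, IsPlaneOfCurvature g κ S

/-- A plane cover of `(ℝⁿ, g)`. -/
def IsPlaneCover {n : ℕ} (g : MetricTensor n) (P : Set (Set (Coord n))) : Prop :=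
  (∀ S ∈ P, IsPlane g S) ∧ ⋃₀ P = univ

/-- `C ⊆ S` contains every geodesic segment of `S` with endpoints in `C`. The set `S` is meant to
be a totally geodesic submanifold, so that its geodesics are the ambient geodesics lying in it. -/
def IsConvexIn {n : ℕ} (g : MetricTensor n) (S C : Set (Coord n)) : Prop :=
  C ⊆ S ∧ ∀ (γ : ℝ → Coord n) (a b : ℝ), IsGeodesic g γ → a ≤ b →
    (∀ s ∈ Icc a b, γ s ∈ S) → γ a ∈ C → γ b ∈ C → ∀ s ∈ Icc a b, γ s ∈ C

/-- The convex hull of `A ∩ S` in `S`. -/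
def convIn {n : ℕ} (g : MetricTensor n) (S A : Set (Coord n)) : Set (Coord n) :=
  ⋂₀ {C | IsConvexIn g S C ∧ A ∩ S ⊆ C}

/-- The set `K̂` of all `x` with `x ∈ conv_S(K)` for every `S ∈ P` through `x`. -/
def planeHull {n : ℕ} (g : MetricTensor n) (P : Set (Set (Coord n))) (K : Set (Coord n)) :
    Set (Coord n) :=
  {x | ∀ S ∈ P, x ∈ S → x ∈ convIn g S K}

/-! ### Support theorems -/

/-- `γ` is an escaping geodesic of unit speed. -/
def IsEscaping {n : ℕ} (g : MetricTensor n) (γ : ℝ → Coord n) : Prop :=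
  IsGeodesic g γ ∧ (∀ s, innerAt g (γ s) (deriv γ s) (deriv γ s) = 1) ∧
    Tendsto γ (cocompact ℝ) (cocompact (Coord n))

/-- The X-ray transform. -/
def xray {n : ℕ} (F : Coord n → ℝ) (γ : ℝ → Coord n) : ℝ :=
  ∫ s, F (γ s)

/-- `(ℝⁿ, g)` has a support theorem. -/
def HasSupportTheorem {n : ℕ} (g : MetricTensor n) : Prop :=
  ∃ hat : TopologicalSpace.Compacts (Coord n) → TopologicalSpace.Compacts (Coord n),
    (∀ (K : TopologicalSpace.Compacts (Coord n)) (F : Coord n → ℝ),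
      Continuous F → HasCompactSupport F →
      (∀ γ, IsEscaping g γ → (∀ s, γ s ∉ K) → xray F γ = 0) →
      tsupport F ⊆ hat K) ∧
    (∀ K : ℕ → TopologicalSpace.Compacts (Coord n),
      (∀ i, K (i + 1) ≤ K i) →
      Tendsto (fun i => riemDiam g (K i : Set (Coord n))) atTop (𝓝 0) →
      Tendsto (fun i => riemDiam g (hat (K i) : Set (Coord n))) atTop (𝓝 0))

/-! ### The examples on `ℝ³` -/

/-- The conditions on the warping function `f(r, t)`; its values for `r < 0` are irrelevant. -/
structure IsWarpingFunction (f : ℝ → ℝ → ℝ) : Prop where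
  smooth : ContDiffOn ℝ ∞ (fun x : ℝ × ℝ => f x.1 x.2) (Ici 0 ×ˢ univ)
  sphere : ∀ r t, 0 ≤ r → r ≤ 3 * Real.pi / 4 → f r t = Real.sin r
  transition : ∃ φ : ℝ → ℝ, ∀ r, 3 * Real.pi / 4 ≤ r → r ≤ Real.pi →
    0 < φ r ∧ φ r ≤ 2 ∧ ∀ t, f r t = φ r
  flat : ∀ r t, Real.pi ≤ r → r ≤ 2 * Real.pi → f r t = 2 + r - Real.pi
  outer_nonpos : ∀ r t, 2 * Real.pi ≤ r → t ≤ 0 → f r t = 2 + r - Real.pi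
  outer_pos : ∀ r t, 2 * Real.pi < r → 0 < t → 2 + r - Real.pi < f r t

/-- The point with cylindrical coordinates `(t, r, α)`. -/
def cyl (t r α : ℝ) : Coord 3 := ![t, r * Real.cos α, r * Real.sin α]

/-- The cylindrical coordinate `r`. -/
def rad (p : Coord 3) : ℝ := √(p 1 ^ 2 + p 2 ^ 2)

/-- Components of the one-form `dt`. -/
def formT : Coord 3 := ![1, 0, 0]

/-- Components of the one-form `dr` off the axis `r = 0`. -/
def formR (p : Coord 3) : Coord 3 := ![0, p 1 / rad p, p 2 / rad p]

/-- Components of the one-form `dα` off the axis `r = 0`. -/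
def formAngle (p : Coord 3) : Coord 3 := ![0, -p 2 / rad p ^ 2, p 1 / rad p ^ 2]

/-- The metric `dt² + dr² + f(r,t)² dα²`. On the axis, where cylindrical coordinates degenerate,
it is given by its continuous extension. -/
def euclMetric (f : ℝ → ℝ → ℝ) : MetricTensor 3 := fun p =>
  if rad p = 0 then Matrix.diagonal ![1, 1, 1]
  else Matrix.vecMulVec formT formT + Matrix.vecMulVec (formR p) (formR p)
    + f (rad p) (p 0) ^ 2 • Matrix.vecMulVec (formAngle p) (formAngle p)

/-- The metric `dt² + e^{2t} (dr² + f(r,t)² dα²)`, extended continuously to the axis. -/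
def hypMetric (f : ℝ → ℝ → ℝ) : MetricTensor 3 := fun p =>
  if rad p = 0 then Matrix.diagonal ![1, Real.exp (2 * p 0), Real.exp (2 * p 0)]
  else Matrix.vecMulVec formT formT
    + Real.exp (2 * p 0) • (Matrix.vecMulVec (formR p) (formR p)
      + f (rad p) (p 0) ^ 2 • Matrix.vecMulVec (formAngle p) (formAngle p))

/-- `E_α`, the union of the half-planes at the angles `α` and `α + π`. -/
def halfPlanePair (α : ℝ) : Set (Coord 3) :=
  {p | ∃ t r, 0 ≤ r ∧ (p = cyl t r α ∨ p = cyl t r (α + Real.pi))}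

/-- The family of all `E_α`, `α ∈ [0, π)`. -/
def halfPlanePairs : Set (Set (Coord 3)) := halfPlanePair '' Ico 0 Real.pi

/-- For every nonempty compact `K`, with `D` the largest distance of a point of `K` from the
origin, `K̂` lies in the closed ball of radius `D` around the origin. -/
def HullInBall (g : MetricTensor 3) : Prop :=
  ∀ K : Set (Coord 3), IsCompact K → K.Nonempty →
    ∃ D : ℝ≥0, IsGreatest (riemDist g 0 '' K) D ∧
      planeHull g halfPlanePairs K ⊆ {x | riemDist g 0 x ≤ D}

end PlaneCovers

end

noncomputable section

namespace PlaneCovers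

/-! ### The Riemannian distance in the global chart -/

section Distance

variable {n : ℕ} {g : MetricTensor n}

/-! The function f enters both metrics only through f² dα², and dα vanishes along the planes E_α,
which contain the axis. With (r² dα) = x dy - y dx the metrics take the form dt² + e^{2lt}(dx² + dy²
+ Q (r² dα)²), where Q = (f² - r²)/r⁴ and l = 0 or l = 1. Near the axis f = sin r, and sin² r = r² +
r⁴ H(r²) with H entire, so Q is smooth everywhere. Positive definiteness amounts to 1 + Q r² > 0,
that is, to f > 0 off the axis. Smoothness, completeness, the plane cover, the hulls and the support
theorem then hold for every such Q.

The form r² dα enters quadratically and vanishes on E_α, so E_α is totally geodesic with the metric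
dt² + e^{2lt} dρ², flat or hyperbolic whatever Q is (`christoffelVec_planeMap`). The distance from
the origin does not see Q either. The model geodesics from the origin run inside the E_α and bound
it from above. The model distance is a function of t and r, and its differential has norm at most 1
for every Q, which bounds it from below (`abs_le_sqrt_innerAt`). So balls are bounded, which gives
completeness, and they cut convex sets out of each E_α, which gives the statement on hulls.

For the support theorem it is enough to use geodesics inside the E_α. In the flat case they are
lines. In the hyperbolic case the chart w = e^{-2t} + ρ² turns the half circles into lines w = aρ +
b, and arc length into a weight that can be absorbed into F. If the integrals of G vanish over all
lines with slopes in an open set and large intercepts, then so do the integrals over half planes.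
Differentiating these in the slope gives the first moment along the lines and, inductively, all
moments, so G = 0 there (`eq_zero_of_line_integrals`). The set assigned to K is the closed convex
hull of K in the three-dimensional chart: a plane separating a point from it cuts E_α in a
separating line, and convex hulls do not increase diameters (`hasSupportTheorem_of_chart`).

The function f matters only for inhomogeneity and conjugate points. Where f = W(r), the curvature is
constant -l² plus a term with factor W''/W. The term is absent at r = 3π/2, where W is affine, and
present at r = π/2, where W = sin. Near r = π/2 the slices are round spheres up to scale, and a
rotation field of the sphere is the Jacobi field that joins opposite points of the equator. -/

lemma innerAt_smul_smul (g : MetricTensor n) (p v : Coord n) (c : ℝ) :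
    innerAt g p (c • v) (c • v) = c ^ 2 * innerAt g p v v := by
  simp only [innerAt, Matrix.mulVec_smul, dotProduct_smul, smul_dotProduct, smul_eq_mul]
  ring

lemma enormSMulClass_tangentENorm (g : MetricTensor n) (p : Coord n) :
    letI := tangentENorm g p
    ENormSMulClass ℝ (TangentSpace 𝓘(ℝ, Coord n) p) := by
  let _ := tangentENorm g p
  refine ⟨fun c v => ?_⟩
  change ENNReal.ofReal √(innerAt g p (c • v) (c • v)) = _ * ENNReal.ofReal √(innerAt g p v v)
  have h : innerAt g p (c • v) (c • v) = c ^ 2 * innerAt g p v v := innerAt_smul_smul g p v c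
  rw [h, Real.sqrt_mul (sq_nonneg c), Real.sqrt_sq_eq_abs, ENNReal.ofReal_mul (abs_nonneg c),
    ← Real.norm_eq_abs, ofReal_norm]

lemma riemDist_self (g : MetricTensor n) (p : Coord n) : riemDist g p p = 0 := by
  let _ : ∀ x : Coord n, ENorm (TangentSpace 𝓘(ℝ, Coord n) x) := tangentENorm g
  have : ∀ x : Coord n, ENormSMulClass ℝ (TangentSpace 𝓘(ℝ, Coord n) x) :=
    enormSMulClass_tangentENorm g
  exact Manifold.riemannianEDist_self

lemma riemDist_comm (g : MetricTensor n) (p q : Coord n) : riemDist g p q = riemDist g q p := by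
  let _ : ∀ x : Coord n, ENorm (TangentSpace 𝓘(ℝ, Coord n) x) := tangentENorm g
  have : ∀ x : Coord n, ENormSMulClass ℝ (TangentSpace 𝓘(ℝ, Coord n) x) :=
    enormSMulClass_tangentENorm g
  exact Manifold.riemannianEDist_comm

lemma riemDist_triangle (g : MetricTensor n) (p q r : Coord n) :
    riemDist g p r ≤ riemDist g p q + riemDist g q r := by
  let _ : ∀ x : Coord n, ENorm (TangentSpace 𝓘(ℝ, Coord n) x) := tangentENorm g
  have : ∀ x : Coord n, ENormSMulClass ℝ (TangentSpace 𝓘(ℝ, Coord n) x) :=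
    enormSMulClass_tangentENorm g
  exact Manifold.riemannianEDist_triangle

lemma riemDist_le_of_curve {γ : ℝ → Coord n} {a b L : ℝ} (hab : a ≤ b) (hL : 0 ≤ L)
    (hγ : ContDiff ℝ 1 γ)
    (h : ∀ s ∈ Icc a b, innerAt g (γ s) (deriv γ s) (deriv γ s) ≤ L ^ 2) :
    riemDist g (γ a) (γ b) ≤ ENNReal.ofReal (L * (b - a)) := by
  let _ : ∀ x : Coord n, ENorm (TangentSpace 𝓘(ℝ, Coord n) x) := tangentENorm g
  have : ∀ x : Coord n, ENormSMulClass ℝ (TangentSpace 𝓘(ℝ, Coord n) x) :=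
    enormSMulClass_tangentENorm g
  have h1 : riemDist g (γ a) (γ b) ≤ Manifold.pathELength 𝓘(ℝ, Coord n) γ a b :=
    Manifold.riemannianEDist_le_pathELength (contMDiff_iff_contDiff.2 hγ).contMDiffOn rfl rfl hab
  refine h1.trans ?_
  rw [Manifold.pathELength_eq_lintegral_mfderiv_Icc]
  calc _ ≤ ∫⁻ _ in Icc a b, ENNReal.ofReal L := by
        refine setLIntegral_mono measurable_const fun s hs => ?_
        have e : (mfderiv 𝓘(ℝ, ℝ) 𝓘(ℝ, Coord n) γ s 1 : Coord n) = deriv γ s := by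
          rw [mfderiv_eq_fderiv]; rfl
        change ENNReal.ofReal √(innerAt g (γ s) (mfderiv 𝓘(ℝ, ℝ) 𝓘(ℝ, Coord n) γ s 1 : Coord n)
          (mfderiv 𝓘(ℝ, ℝ) 𝓘(ℝ, Coord n) γ s 1 : Coord n)) ≤ _
        rw [e]
        exact ENNReal.ofReal_le_ofReal ((Real.sqrt_le_left hL).2 (h s hs))
    _ = _ := by
        rw [setLIntegral_const, Real.volume_Icc, ENNReal.ofReal_mul hL]

/-- Lower bounds by calibration: along a path, the increment of u is the integral of du, which is at
most the length. -/
lemma ofReal_abs_sub_le_riemDist {u : Coord n → ℝ} (hu : ContDiff ℝ 1 u)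
    (h : ∀ p v, |fderiv ℝ u p v| ≤ √(innerAt g p v v)) (p q : Coord n) :
    ENNReal.ofReal |u q - u p| ≤ riemDist g p q := by
  let _ : ∀ x : Coord n, ENorm (TangentSpace 𝓘(ℝ, Coord n) x) := tangentENorm g
  have : ∀ x : Coord n, ENormSMulClass ℝ (TangentSpace 𝓘(ℝ, Coord n) x) :=
    enormSMulClass_tangentENorm g
  refine le_of_forall_gt fun r hr => ?_
  -- A nearly shortest path that is C¹ on all of ℝ, so that u ∘ γ is differentiable at the endpoints
  -- too.
  obtain ⟨γ, h0, h1, hγ, hlen, -⟩ :=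
    Manifold.exists_lt_locally_constant_of_riemannianEDist_lt hr zero_lt_one
  refine lt_of_le_of_lt ?_ hlen
  rw [contMDiff_iff_contDiff] at hγ
  rw [Manifold.pathELength_eq_lintegral_mfderiv_Icc, ← h0, ← h1]
  have huγ : ContDiff ℝ 1 (u ∘ γ) := hu.comp hγ
  have hint := intervalIntegral.integral_deriv_eq_sub (f := u ∘ γ) (a := 0) (b := 1)
    (fun x _ => (huγ.differentiable one_ne_zero) x)
    ((huγ.continuous_deriv le_rfl).intervalIntegrable _ _)
  rw [intervalIntegral.integral_of_le zero_le_one, ← integral_Icc_eq_integral_Ioc] at hint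
  simp only [Function.comp_apply] at hint
  rw [← hint, ← Real.norm_eq_abs, ofReal_norm]
  refine (enorm_integral_le_lintegral_enorm _).trans ?_
  refine lintegral_mono fun s => ?_
  have e : (mfderiv 𝓘(ℝ, ℝ) 𝓘(ℝ, Coord n) γ s 1 : Coord n) = deriv γ s := by
    rw [mfderiv_eq_fderiv]; rfl
  change _ ≤ ENNReal.ofReal √(innerAt g (γ s) (mfderiv 𝓘(ℝ, ℝ) 𝓘(ℝ, Coord n) γ s 1 : Coord n)
    (mfderiv 𝓘(ℝ, ℝ) 𝓘(ℝ, Coord n) γ s 1 : Coord n))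
  rw [e, ← ofReal_norm, Real.norm_eq_abs]
  refine ENNReal.ofReal_le_ofReal ?_
  have hd : deriv (u ∘ γ) s = fderiv ℝ u (γ s) (deriv γ s) :=
    fderiv_comp_deriv s (hu.differentiable one_ne_zero _) (hγ.differentiable one_ne_zero _)
  rw [hd]
  exact h _ _

lemma IsRiemannianMetric.continuous_innerAt (hg : IsRiemannianMetric g) :
    Continuous fun x : Coord n × Coord n => innerAt g x.1 x.2 x.2 := by
  have h : ∀ i j, Continuous fun p => g p i j := fun i j => (hg.smooth i j).continuous
  simp only [innerAt, dotProduct, Matrix.mulVec]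
  refine continuous_finsetSum _ fun i _ => ?_
  refine Continuous.mul (by fun_prop) (continuous_finsetSum _ fun j _ => ?_)
  exact ((h i j).comp continuous_fst).mul (by fun_prop)

lemma IsRiemannianMetric.innerAt_pos (hg : IsRiemannianMetric g) (p : Coord n) {v : Coord n}
    (hv : v ≠ 0) : 0 < innerAt g p v v := by
  simpa [innerAt] using (hg.posDef p).dotProduct_mulVec_pos hv

/-- By homogeneity only unit vectors matter, and g(v, v) has a positive minimum and a maximum on the
compact set of unit vectors over the ball. -/
lemma IsRiemannianMetric.exists_norm_bounds (hg : IsRiemannianMetric g) (B : ℝ) :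
    ∃ c > 0, ∃ C > 0, ∀ p ∈ Metric.closedBall (0 : Coord n) B, ∀ v : Coord n,
      c * ‖v‖ ≤ √(innerAt g p v v) ∧ innerAt g p v v ≤ (C * ‖v‖) ^ 2 := by
  set S := Metric.closedBall (0 : Coord n) B ×ˢ Metric.sphere (0 : Coord n) 1
  have hS : IsCompact S := (isCompact_closedBall _ _).prod (isCompact_sphere _ _)
  rcases S.eq_empty_or_nonempty with he | hne
  · refine ⟨1, one_pos, 1, one_pos, fun p hp v => ?_⟩
    have hv : v = 0 := by
      by_contra hv
      have : ((p, ‖v‖⁻¹ • v) : Coord n × Coord n) ∈ S :=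
        ⟨hp, by simp [norm_smul, norm_ne_zero_iff.2 hv]⟩
      simp [he] at this
    simp [hv, innerAt]
  obtain ⟨x, hx, hxmin⟩ := hS.exists_isMinOn hne hg.continuous_innerAt.continuousOn
  obtain ⟨y, hy, hymax⟩ := hS.exists_isMaxOn hne hg.continuous_innerAt.continuousOn
  have hpos : ∀ z ∈ S, 0 < innerAt g z.1 z.2 z.2 := fun z hz =>
    hg.innerAt_pos _ (by rintro h; simpa [h] using hz.2)
  refine ⟨√(innerAt g x.1 x.2 x.2), Real.sqrt_pos.2 (hpos x hx), √(innerAt g y.1 y.2 y.2),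
    Real.sqrt_pos.2 (hpos y hy), fun p hp v => ?_⟩
  rcases eq_or_ne v 0 with rfl | hv
  · simp [innerAt]
  have hmem : ((p, ‖v‖⁻¹ • v) : Coord n × Coord n) ∈ S :=
    ⟨hp, by simp [norm_smul, norm_ne_zero_iff.2 hv]⟩
  have h1 := hxmin hmem
  have h2 := hymax hmem
  simp only [mem_ofPred_eq, innerAt_smul_smul] at h1 h2
  have hn : 0 < ‖v‖ := norm_pos_iff.2 hv
  rw [inv_pow, inv_mul_eq_div, le_div_iff₀ (by positivity)] at h1
  rw [inv_pow, inv_mul_eq_div, div_le_iff₀ (by positivity)] at h2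
  constructor
  · refine Real.le_sqrt_of_sq_le ?_
    rwa [mul_pow, Real.sq_sqrt (hpos x hx).le]
  · rwa [mul_pow, Real.sq_sqrt (hpos y hy).le]

lemma IsRiemannianMetric.exists_riemDist_le (hg : IsRiemannianMetric g) (B : ℝ) :
    ∃ C > 0, ∀ p ∈ Metric.closedBall (0 : Coord n) B, ∀ q ∈ Metric.closedBall (0 : Coord n) B,
      riemDist g p q ≤ ENNReal.ofReal (C * ‖q - p‖) := by
  obtain ⟨c, _, C, hC, h⟩ := hg.exists_norm_bounds B
  refine ⟨C, hC, fun p hp q hq => ?_⟩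
  have hd : ∀ s : ℝ, HasDerivAt (fun s : ℝ => p + s • (q - p)) (q - p) s := fun s => by
    simpa using ((hasDerivAt_id s).smul_const (q - p)).const_add p
  have := riemDist_le_of_curve (g := g) (γ := fun s : ℝ => p + s • (q - p)) zero_le_one
    (L := C * ‖q - p‖) (by positivity) (by fun_prop) fun s hs => by
      rw [(hd s).deriv]
      exact (h _ ((convex_closedBall (0 : Coord n) B).add_smul_sub_mem hp hq hs) _).2
  simpa using this

/-- The coordinates, cut off by a bump function and scaled, are calibrating functions: inside the
larger ball their differential is controlled by the norm bounds, and outside it vanishes. A path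
that leaves the ball therefore needs no separate treatment. -/
lemma IsRiemannianMetric.exists_norm_sub_le (hg : IsRiemannianMetric g) {B : ℝ} (hB : 0 < B) :
    ∃ C > 0, ∀ p ∈ Metric.closedBall (0 : Coord n) B, ∀ q ∈ Metric.closedBall (0 : Coord n) B,
      ENNReal.ofReal (C * ‖q - p‖) ≤ riemDist g p q := by
  obtain ⟨c, hc, C, _, h⟩ := hg.exists_norm_bounds (B + 1)
  let χ : ContDiffBump (0 : Coord n) := ⟨B, B + 1, hB, by linarith⟩
  let u : Fin n → Coord n → ℝ := fun i p => χ p * p i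
  have hu : ∀ i, ContDiff ℝ 1 (u i) := fun i => χ.contDiff.mul (contDiff_apply ℝ ℝ i)
  have hM : ∃ M > 0, ∀ i p, ‖fderiv ℝ (u i) p‖ ≤ M := by
    have : ∀ i, ∃ M, ∀ p, ‖fderiv ℝ (u i) p‖ ≤ M := fun i => by
      have h1 : HasCompactSupport (u i) := χ.hasCompactSupport.mul_right
      exact (h1.fderiv (𝕜 := ℝ)).exists_bound_of_continuous
        ((hu i).continuous_fderiv one_ne_zero)
    choose M hM using this
    refine ⟨1 + ∑ i, |M i|, by positivity, fun i p => (hM i p).trans ?_⟩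
    have := Finset.single_le_sum (f := fun i => |M i|) (fun j _ => abs_nonneg _)
      (Finset.mem_univ i)
    linarith [le_abs_self (M i)]
  obtain ⟨M, hM0, hM⟩ := hM
  have key : ∀ i p v, |fderiv ℝ (fun p => (c / M) * u i p) p v| ≤ √(innerAt g p v v) := by
    intro i p v
    rw [fderiv_const_mul ((hu i).differentiable one_ne_zero _)]
    by_cases hp : p ∈ Metric.closedBall (0 : Coord n) (B + 1)
    · refine le_trans ?_ (h p hp v).1
      have h1 := (fderiv ℝ (u i) p).le_of_opNorm_le (hM i p) v
      rw [Real.norm_eq_abs] at h1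
      change |c / M * (fderiv ℝ (u i) p v)| ≤ _
      rw [abs_mul, abs_of_pos (by positivity)]
      calc c / M * |fderiv ℝ (u i) p v| ≤ c / M * (M * ‖v‖) := by gcongr
        _ = c * ‖v‖ := by field_simp
    · have : p ∉ tsupport (u i) := fun hp' => hp (by
        have := tsupport_mul_subset_left hp'
        rwa [χ.tsupport_eq] at this)
      have h0 : fderiv ℝ (u i) p = 0 := by
        have := support_fderiv_subset ℝ (f := u i)
        by_contra hne
        exact ‹p ∉ tsupport (u i)› (this hne)
      simp [h0]
  refine ⟨c / M, by positivity, fun p hp q hq => ?_⟩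
  rcases isEmpty_or_nonempty (Fin n) with hn | hn
  · simp [Subsingleton.elim q p]
  obtain ⟨i, hi⟩ : ∃ i, ‖q - p‖ = ‖(q - p) i‖ := by
    obtain ⟨i, -, hi⟩ := Finset.exists_mem_eq_sup Finset.univ Finset.univ_nonempty
      fun i => ‖(q - p) i‖₊
    exact ⟨i, by rw [Pi.norm_def, hi]; rfl⟩
  have h1 := ofReal_abs_sub_le_riemDist ((hu i).const_smul (c / M)) (key i) p q
  have e1 : u i p = p i := by simp [u, χ.one_of_mem_closedBall hp]
  have e2 : u i q = q i := by simp [u, χ.one_of_mem_closedBall hq]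
  refine le_trans (le_of_eq ?_) h1
  simp only [smul_eq_mul, e1, e2, hi]
  rw [← mul_sub, abs_mul, abs_of_pos (by positivity : 0 < c / M)]
  rfl

lemma IsRiemannianMetric.continuous_riemDist (hg : IsRiemannianMetric g) (p : Coord n) :
    Continuous fun q => riemDist g p q := by
  rw [continuous_iff_continuousAt]
  intro q
  obtain ⟨C, hC, h⟩ := hg.exists_riemDist_le (‖q‖ + 1)
  have hlim : Tendsto (fun x => ENNReal.ofReal (C * ‖x - q‖)) (𝓝 q) (𝓝 0) := by
    have : Continuous fun x : Coord n => ENNReal.ofReal (C * ‖x - q‖) :=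
      ENNReal.continuous_ofReal.comp (by fun_prop)
    simpa using this.tendsto q
  have hball : ∀ᶠ x in 𝓝 q, riemDist g q x ≤ ENNReal.ofReal (C * ‖x - q‖) := by
    filter_upwards [Metric.ball_mem_nhds q one_pos] with x hx
    refine h q (by simp) x ?_
    rw [mem_ball_iff_norm] at hx
    simpa using (norm_le_norm_add_norm_sub' x q).trans (by gcongr)
  have hlow : Tendsto (fun x => riemDist g p q - ENNReal.ofReal (C * ‖x - q‖)) (𝓝 q)
      (𝓝 (riemDist g p q)) := by
    simpa using ENNReal.Tendsto.sub tendsto_const_nhds hlim (Or.inr ENNReal.zero_ne_top)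
  have hupp : Tendsto (fun x => riemDist g p q + ENNReal.ofReal (C * ‖x - q‖)) (𝓝 q)
      (𝓝 (riemDist g p q)) := by
    simpa using tendsto_const_nhds.add hlim
  refine tendsto_of_tendsto_of_tendsto_of_le_of_le' hlow hupp ?_ ?_
  · filter_upwards [hball] with x hx
    rw [tsub_le_iff_right]
    refine (riemDist_triangle g p x q).trans ?_
    gcongr
    rwa [riemDist_comm]
  · filter_upwards [hball] with x hx
    exact (riemDist_triangle g p q x).trans (by gcongr)

lemma IsRiemannianMetric.riemDist_ne_top (hg : IsRiemannianMetric g) (p q : Coord n) :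
    riemDist g p q ≠ ⊤ := by
  obtain ⟨C, -, h⟩ := hg.exists_riemDist_le (max ‖p‖ ‖q‖)
  exact ne_top_of_le_ne_top ENNReal.ofReal_ne_top (h p (by simp) q (by simp))

/-- A Cauchy sequence stays in a bounded part of the chart, so a subsequence converges in
coordinates, hence in the Riemannian distance; the Cauchy property carries this over to the whole
sequence. -/
lemma IsRiemannianMetric.isCompleteMetric (hg : IsRiemannianMetric g)
    (hb : ∀ D : ℝ≥0, Bornology.IsBounded {x | riemDist g 0 x ≤ D}) : IsCompleteMetric g := by
  intro u hu
  obtain ⟨N, hN⟩ := hu 1 one_pos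
  have hfin : riemDist g 0 (u N) + 1 ≠ ⊤ :=
    ENNReal.add_ne_top.2 ⟨hg.riemDist_ne_top _ _, ENNReal.one_ne_top⟩
  have hmem : ∀ i, u (i + N) ∈ {x | riemDist g 0 x ≤ (riemDist g 0 (u N) + 1).toNNReal} := by
    intro i
    rw [mem_ofPred_eq, ENNReal.coe_toNNReal hfin]
    refine (riemDist_triangle g 0 (u N) _).trans ?_
    gcongr
    exact (hN N le_rfl (i + N) (by omega)).le
  obtain ⟨x, -, φ, hφ, hx⟩ := tendsto_subseq_of_bounded (hb _) hmem
  refine ⟨x, ?_⟩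
  have hx' : Tendsto (fun i => riemDist g x (u (φ i + N))) atTop (𝓝 0) := by
    have := ((hg.continuous_riemDist x).tendsto x).comp hx
    rwa [riemDist_self] at this
  rw [ENNReal.tendsto_nhds_zero]
  intro ε hε
  obtain ⟨N', hN'⟩ := hu (ε / 2) (ENNReal.half_pos hε.ne')
  obtain ⟨k, hk1, hk2⟩ := ((ENNReal.tendsto_nhds_zero.1 hx' (ε / 2)
    (ENNReal.half_pos hε.ne')).and (eventually_ge_atTop N')).exists
  filter_upwards [eventually_ge_atTop N'] with i hi
  calc riemDist g (u i) x ≤ riemDist g (u i) (u (φ k + N)) + riemDist g (u (φ k + N)) x :=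
        riemDist_triangle _ _ _ _
    _ ≤ ε / 2 + ε / 2 := by
        gcongr
        · exact (hN' i hi _ (le_trans hk2 ((hφ.id_le k).trans (Nat.le_add_right _ _)))).le
        · rwa [riemDist_comm]
    _ = ε := ENNReal.add_halves ε

end Distance

/-! ### Bilinear expressions with variable coefficients -/

section Bilinear

variable {n : ℕ}

/-- The bilinear expression with coefficients `c i j`. -/
def bilinSum (c : Fin n → Fin n → ℝ) (a b : Coord n) : ℝ := ∑ i, ∑ j, c i j * a i * b j

lemma bilinSum_add_left (c : Fin n → Fin n → ℝ) (a a' b : Coord n) :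
    bilinSum c (a + a') b = bilinSum c a b + bilinSum c a' b := by
  simp only [bilinSum, Pi.add_apply, mul_add, add_mul, Finset.sum_add_distrib]

lemma bilinSum_smul_left (c : Fin n → Fin n → ℝ) (r : ℝ) (a b : Coord n) :
    bilinSum c (r • a) b = r * bilinSum c a b := by
  simp only [bilinSum, Pi.smul_apply, smul_eq_mul, Finset.mul_sum]
  exact Finset.sum_congr rfl fun i _ => Finset.sum_congr rfl fun j _ => by ring

lemma bilinSum_flip (c : Fin n → Fin n → ℝ) (a b : Coord n) :
    bilinSum c a b = bilinSum (fun i j => c j i) b a := by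
  simp only [bilinSum]
  rw [Finset.sum_comm]
  exact Finset.sum_congr rfl fun i _ => Finset.sum_congr rfl fun j _ => by ring

lemma bilinSum_add_right (c : Fin n → Fin n → ℝ) (a b b' : Coord n) :
    bilinSum c a (b + b') = bilinSum c a b + bilinSum c a b' := by
  rw [bilinSum_flip, bilinSum_add_left, bilinSum_flip, bilinSum_flip _ b']

lemma bilinSum_smul_right (c : Fin n → Fin n → ℝ) (r : ℝ) (a b : Coord n) :
    bilinSum c a (r • b) = r * bilinSum c a b := by
  rw [bilinSum_flip, bilinSum_smul_left, bilinSum_flip]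

/-- The product rule for fields A, B along ψ. It serves the metric (derivatives of inner products)
and the Christoffel symbols (second covariant derivatives) alike. -/
lemma fderiv_bilinSum {E : Type*} [NormedAddCommGroup E] [NormedSpace ℝ E]
    {c : Fin n → Fin n → Coord n → ℝ} {ψ A B : E → Coord n} {u : E}
    (hc : ∀ i j, DifferentiableAt ℝ (c i j) (ψ u)) (hψ : DifferentiableAt ℝ ψ u)
    (hA : DifferentiableAt ℝ A u) (hB : DifferentiableAt ℝ B u) (v : E) :
    fderiv ℝ (fun q => bilinSum (fun i j => c i j (ψ q)) (A q) (B q)) u v =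
      fderiv ℝ (fun p => bilinSum (fun i j => c i j p) (A u) (B u)) (ψ u) (fderiv ℝ ψ u v)
      + bilinSum (fun i j => c i j (ψ u)) (fderiv ℝ A u v) (B u)
      + bilinSum (fun i j => c i j (ψ u)) (A u) (fderiv ℝ B u v) := by
  have h1 : ∀ i j, HasFDerivAt (fun q => c i j (ψ q)) ((fderiv ℝ (c i j) (ψ u)).comp
      (fderiv ℝ ψ u)) u := fun i j => (hc i j).hasFDerivAt.comp u hψ.hasFDerivAt
  have h2 : ∀ i, HasFDerivAt (fun q => A q i) ((ContinuousLinearMap.proj i).comp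
      (fderiv ℝ A u)) u := fun i => hasFDerivAt_pi'.1 hA.hasFDerivAt i
  have h3 : ∀ i, HasFDerivAt (fun q => B q i) ((ContinuousLinearMap.proj i).comp
      (fderiv ℝ B u)) u := fun i => hasFDerivAt_pi'.1 hB.hasFDerivAt i
  have h4 : HasFDerivAt (fun q => bilinSum (fun i j => c i j (ψ q)) (A q) (B q)) _ u :=
    HasFDerivAt.fun_sum (u := Finset.univ) fun i _ => HasFDerivAt.fun_sum (u := Finset.univ)
      fun j _ => ((h1 i j).mul (h2 i)).mul (h3 j)
  have h5 : HasFDerivAt (fun p => bilinSum (fun i j => c i j p) (A u) (B u)) _ (ψ u) :=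
    HasFDerivAt.fun_sum (u := Finset.univ) fun i _ => HasFDerivAt.fun_sum (u := Finset.univ)
      fun j _ => ((hc i j).hasFDerivAt.mul_const (A u i)).mul_const (B u j)
  rw [h4.fderiv, h5.fderiv]
  simp only [bilinSum, _root_.sum_apply, ← Finset.sum_add_distrib]
  refine Finset.sum_congr rfl fun i _ => Finset.sum_congr rfl fun j _ => ?_
  simp only [_root_.add_apply, _root_.smul_apply,
    ContinuousLinearMap.comp_apply, ContinuousLinearMap.proj_apply, smul_eq_mul, Pi.mul_apply]
  ring

lemma differentiableAt_bilinSum {E : Type*} [NormedAddCommGroup E] [NormedSpace ℝ E]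
    {c : Fin n → Fin n → E → ℝ} {A B : E → Coord n} {u : E}
    (hc : ∀ i j, DifferentiableAt ℝ (c i j) u)
    (hA : DifferentiableAt ℝ A u) (hB : DifferentiableAt ℝ B u) :
    DifferentiableAt ℝ (fun q => bilinSum (fun i j => c i j q) (A q) (B q)) u := by
  unfold bilinSum
  have h2 := differentiableAt_pi.1 hA
  have h3 := differentiableAt_pi.1 hB
  fun_prop

lemma innerAt_eq_bilinSum (g : MetricTensor n) (p v w : Coord n) :
    innerAt g p v w = bilinSum (fun i j => g p i j) v w := by
  simp only [innerAt, dotProduct, Matrix.mulVec, bilinSum, Finset.mul_sum]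
  exact Finset.sum_congr rfl fun i _ => Finset.sum_congr rfl fun j _ => by ring

lemma christoffelVec_apply (g : MetricTensor n) (p v w : Coord n) (k : Fin n) :
    christoffelVec g p v w k = bilinSum (fun i j => christoffel g k i j p) v w := rfl

end Bilinear

/-! ### The Levi-Civita connection -/

section Connection

variable {n : ℕ} {g : MetricTensor n}

lemma innerAt_add_left (g : MetricTensor n) (p v v' w : Coord n) :
    innerAt g p (v + v') w = innerAt g p v w + innerAt g p v' w := by
  simp only [innerAt_eq_bilinSum, bilinSum_add_left]

lemma innerAt_add_right (g : MetricTensor n) (p v w w' : Coord n) :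
    innerAt g p v (w + w') = innerAt g p v w + innerAt g p v w' := by
  simp only [innerAt_eq_bilinSum, bilinSum_add_right]

lemma innerAt_smul_left (g : MetricTensor n) (p : Coord n) (c : ℝ) (v w : Coord n) :
    innerAt g p (c • v) w = c * innerAt g p v w := by
  simp only [innerAt_eq_bilinSum, bilinSum_smul_left]

lemma innerAt_smul_right (g : MetricTensor n) (p : Coord n) (c : ℝ) (v w : Coord n) :
    innerAt g p v (c • w) = c * innerAt g p v w := by
  simp only [innerAt_eq_bilinSum, bilinSum_smul_right]

lemma innerAt_sub_right (g : MetricTensor n) (p v w w' : Coord n) :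
    innerAt g p v (w - w') = innerAt g p v w - innerAt g p v w' := by
  rw [sub_eq_add_neg, ← neg_one_smul ℝ w', innerAt_add_right, innerAt_smul_right]
  ring

lemma innerAt_single (g : MetricTensor n) (p : Coord n) (i j : Fin n) :
    innerAt g p (Pi.single i 1) (Pi.single j 1) = g p i j := by
  simp [innerAt]

lemma christoffelVec_add_right (g : MetricTensor n) (p v w w' : Coord n) :
    christoffelVec g p v (w + w') = christoffelVec g p v w + christoffelVec g p v w' := by
  ext k
  simp only [christoffelVec_apply, Pi.add_apply, bilinSum_add_right]

/-- The metric `g` is smooth and positive definite near `u`. -/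
structure RegularAt (g : MetricTensor n) (u : Coord n) : Prop where
  eventually_smooth : ∀ᶠ p in 𝓝 u, ∀ i j, ContDiffAt ℝ ∞ (fun p => g p i j) p
  posDef : ∀ᶠ p in 𝓝 u, (g p).PosDef

lemma IsRiemannianMetric.regularAt (hg : IsRiemannianMetric g) (u : Coord n) : RegularAt g u :=
  ⟨Eventually.of_forall fun _ i j => (hg.smooth i j).contDiffAt, Eventually.of_forall hg.posDef⟩

lemma RegularAt.smooth {u : Coord n} (hg : RegularAt g u) (i j : Fin n) :
    ContDiffAt ℝ ∞ (fun p => g p i j) u :=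
  hg.eventually_smooth.self_of_nhds i j

lemma RegularAt.eventually {u : Coord n} (hg : RegularAt g u) : ∀ᶠ p in 𝓝 u, RegularAt g p := by
  filter_upwards [hg.eventually_smooth.eventually_nhds, hg.posDef.eventually_nhds] with p hp hp'
    using ⟨hp, hp'⟩

lemma innerAt_comm_of_posDef {p : Coord n} (hp : (g p).PosDef) (v w : Coord n) :
    innerAt g p v w = innerAt g p w v := by
  rw [innerAt_eq_bilinSum, innerAt_eq_bilinSum, bilinSum_flip]
  congr 1
  ext i j
  simpa using (hp.isHermitian.apply i j)

/-- Connections are computed by testing against all z with the Koszul formula, so no inverse metric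
has to be written out. -/
lemma eq_of_innerAt_eq {p : Coord n} (hp : (g p).PosDef) {a b : Coord n}
    (h : ∀ z, innerAt g p z a = innerAt g p z b) : a = b := by
  by_contra hne
  have h1 : 0 < innerAt g p (a - b) (a - b) := by
    simpa [innerAt] using hp.dotProduct_mulVec_pos (sub_ne_zero.2 hne)
  rw [innerAt_sub_right, h, sub_self] at h1
  exact lt_irrefl _ h1

lemma RegularAt.differentiableAt {u : Coord n} (hg : RegularAt g u) (i j : Fin n) :
    DifferentiableAt ℝ (fun p => g p i j) u :=
  (hg.smooth i j).differentiableAt (by simp)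

lemma fderiv_eq_sum_partialDeriv (F : Coord n → ℝ) (u z : Coord n) :
    fderiv ℝ F u z = ∑ m, partialDeriv m F u * z m := by
  conv_lhs => rw [← Finset.univ_sum_single z]
  simp only [map_sum, partialDeriv]
  refine Finset.sum_congr rfl fun m _ => ?_
  have : (Pi.single m (z m) : Coord n) = z m • Pi.single m 1 := by
    rw [← Pi.single_smul, smul_eq_mul, mul_one]
  rw [this, map_smul, smul_eq_mul]
  ring

lemma fderiv_innerAt_const {u : Coord n} (hg : RegularAt g u) (a b z : Coord n) :
    fderiv ℝ (fun q => innerAt g q a b) u z =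
      ∑ i, ∑ j, ∑ l, partialDeriv l (fun q => g q i j) u * z l * a i * b j := by
  simp only [innerAt_eq_bilinSum]
  have h5 : HasFDerivAt (fun p => bilinSum (fun i j => g p i j) a b) _ u :=
    HasFDerivAt.fun_sum (u := Finset.univ) fun i _ => HasFDerivAt.fun_sum (u := Finset.univ)
      fun j _ => ((hg.differentiableAt i j).hasFDerivAt.mul_const (a i)).mul_const (b j)
  rw [h5.fderiv]
  simp only [_root_.sum_apply]
  refine Finset.sum_congr rfl fun i _ => Finset.sum_congr rfl fun j _ => ?_
  simp only [_root_.smul_apply, smul_eq_mul, fderiv_eq_sum_partialDeriv _ _ z, Finset.mul_sum]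
  exact Finset.sum_congr rfl fun l _ => by ring

lemma sum_mul_christoffel {p : Coord n} (hp : (g p).PosDef) (k i j : Fin n) :
    ∑ l, g p k l * christoffel g l i j p = (1 / 2) *
      (partialDeriv i (fun q => g q j k) p + partialDeriv j (fun q => g q i k) p
        - partialDeriv k (fun q => g q i j) p) := by
  have hu : IsUnit (g p).det := hp.det_pos.ne'.isUnit
  have h1 := Matrix.mul_nonsing_inv (g p) hu
  simp only [christoffel]
  set D : Fin n → ℝ := fun l => partialDeriv i (fun q => g q j l) p
    + partialDeriv j (fun q => g q i l) p - partialDeriv l (fun q => g q i j) p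
  have h2 : (g p * (g p)⁻¹) *ᵥ D = D := by rw [h1, Matrix.one_mulVec]
  have h3 := congrFun h2 k
  rw [← Matrix.mulVec_mulVec] at h3
  simp only [Matrix.mulVec, dotProduct] at h3
  change _ = 1 / 2 * D k
  rw [← h3, Finset.mul_sum]
  exact Finset.sum_congr rfl fun l _ => by ring

/-- The Koszul formula. -/
lemma innerAt_christoffelVec {u : Coord n} (hg : RegularAt g u) (z v w : Coord n) :
    innerAt g u z (christoffelVec g u v w) = (1 / 2) *
      (fderiv ℝ (fun q => innerAt g q w z) u v + fderiv ℝ (fun q => innerAt g q v z) u w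
        - fderiv ℝ (fun q => innerAt g q v w) u z) := by
  have hp := hg.posDef.self_of_nhds
  have h1 : innerAt g u z (christoffelVec g u v w) =
      ∑ k, ∑ i, ∑ j, z k * v i * w j * ∑ l, g u k l * christoffel g l i j u := by
    simp only [innerAt, dotProduct, Matrix.mulVec, christoffelVec, Finset.mul_sum]
    refine Finset.sum_congr rfl fun k _ => ?_
    rw [Finset.sum_comm]
    refine Finset.sum_congr rfl fun i _ => ?_
    rw [Finset.sum_comm]
    exact Finset.sum_congr rfl fun j _ => Finset.sum_congr rfl fun l _ => by ring
  rw [h1]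
  simp only [sum_mul_christoffel hp, fderiv_innerAt_const hg]
  have e1 : ∑ i, ∑ j, ∑ l, partialDeriv l (fun q => g q i j) u * v l * w i * z j =
      ∑ k, ∑ i, ∑ j, z k * v i * w j * partialDeriv i (fun q => g q j k) u := by
    rw [Finset.sum_comm]
    refine Finset.sum_congr rfl fun k _ => ?_
    rw [Finset.sum_comm]
    exact Finset.sum_congr rfl fun i _ => Finset.sum_congr rfl fun j _ => by ring
  have e2 : ∑ i, ∑ j, ∑ l, partialDeriv l (fun q => g q i j) u * w l * v i * z j =
      ∑ k, ∑ i, ∑ j, z k * v i * w j * partialDeriv j (fun q => g q i k) u := by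
    rw [Finset.sum_comm]
    exact Finset.sum_congr rfl fun k _ => Finset.sum_congr rfl fun i _ =>
      Finset.sum_congr rfl fun j _ => by ring
  have e3 : ∑ i, ∑ j, ∑ l, partialDeriv l (fun q => g q i j) u * z l * v i * w j =
      ∑ k, ∑ i, ∑ j, z k * v i * w j * partialDeriv k (fun q => g q i j) u := by
    calc _ = ∑ i, ∑ l, ∑ j, partialDeriv l (fun q => g q i j) u * z l * v i * w j :=
          Finset.sum_congr rfl fun i _ => Finset.sum_comm
      _ = _ := by
          rw [Finset.sum_comm]
          exact Finset.sum_congr rfl fun k _ => Finset.sum_congr rfl fun i _ =>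
            Finset.sum_congr rfl fun j _ => by ring
  rw [e1, e2, e3]
  simp only [← Finset.sum_add_distrib, ← Finset.sum_sub_distrib, Finset.mul_sum]
  exact Finset.sum_congr rfl fun k _ => Finset.sum_congr rfl fun i _ =>
    Finset.sum_congr rfl fun j _ => by ring

lemma RegularAt.contDiffAt_christoffel {u : Coord n} (hg : RegularAt g u) (k i j : Fin n) :
    ContDiffAt ℝ ∞ (christoffel g k i j) u := by
  have hpd : ∀ i a b, ContDiffAt ℝ ∞ (partialDeriv i fun q => g q a b) u := fun i a b =>
    ((hg.smooth a b).fderiv_right (m := ∞) (by simp)).clm_apply contDiffAt_const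
  have hdet : ∀ M : Coord n → Matrix (Fin n) (Fin n) ℝ,
      (∀ a b, ContDiffAt ℝ ∞ (fun p => M p a b) u) → ContDiffAt ℝ ∞ (fun p => (M p).det) u := by
    intro M hM
    simp only [Matrix.det_apply']
    exact ContDiffAt.sum fun σ _ => contDiffAt_const.mul (contDiffAt_prod fun i _ => hM _ _)
  have hinv : ∀ a b, ContDiffAt ℝ ∞ (fun p => (g p)⁻¹ a b) u := by
    intro a b
    simp only [Matrix.inv_def, Matrix.smul_apply, smul_eq_mul, Ring.inverse_eq_inv',
      Matrix.adjugate_apply]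
    refine ((hdet g hg.smooth).inv hg.posDef.self_of_nhds.det_pos.ne').mul (hdet _ fun c d => ?_)
    simp only [Matrix.updateRow_apply]
    split_ifs
    · exact contDiffAt_const
    · exact hg.smooth c d
  unfold christoffel
  exact contDiffAt_const.mul (ContDiffAt.sum fun l _ => (hinv k l).mul
    (((hpd _ _ _).add (hpd _ _ _)).sub (hpd _ _ _)))

lemma RegularAt.differentiableAt_christoffel {u : Coord n} (hg : RegularAt g u) (k i j : Fin n) :
    DifferentiableAt ℝ (christoffel g k i j) u :=
  (hg.contDiffAt_christoffel k i j).differentiableAt (by simp)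

lemma RegularAt.differentiableAt_christoffelVec {u : Coord n} (hg : RegularAt g u)
    (v w : Coord n) : DifferentiableAt ℝ (fun q => christoffelVec g q v w) u :=
  differentiableAt_pi.2 fun k => differentiableAt_bilinSum
    (fun i j => hg.differentiableAt_christoffel k i j) (by fun_prop) (by fun_prop)

lemma fderiv_coord_apply {E : Type*} [NormedAddCommGroup E] [NormedSpace ℝ E] {A : E → Coord n}
    {u : E} (hA : DifferentiableAt ℝ A u) (v : E) (k : Fin n) :
    fderiv ℝ A u v k = fderiv ℝ (fun q => A q k) u v := by
  rw [(hasFDerivAt_pi'.1 hA.hasFDerivAt k).fderiv]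
  rfl

lemma fderiv_christoffelVec {E : Type*} [NormedAddCommGroup E] [NormedSpace ℝ E]
    {ψ A B : E → Coord n} {u : E} (hg : RegularAt g (ψ u)) (hψ : DifferentiableAt ℝ ψ u)
    (hA : DifferentiableAt ℝ A u) (hB : DifferentiableAt ℝ B u) (v : E) :
    fderiv ℝ (fun q => christoffelVec g (ψ q) (A q) (B q)) u v =
      fderiv ℝ (fun p => christoffelVec g p (A u) (B u)) (ψ u) (fderiv ℝ ψ u v)
      + christoffelVec g (ψ u) (fderiv ℝ A u v) (B u)
      + christoffelVec g (ψ u) (A u) (fderiv ℝ B u v) := by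
  have hd : DifferentiableAt ℝ (fun q => christoffelVec g (ψ q) (A q) (B q)) u :=
    differentiableAt_pi.2 fun k => differentiableAt_bilinSum
      (fun i j => (hg.differentiableAt_christoffel k i j).comp u hψ) hA hB
  ext k
  rw [fderiv_coord_apply hd, Pi.add_apply, Pi.add_apply,
    fderiv_coord_apply (hg.differentiableAt_christoffelVec _ _)]
  exact fderiv_bilinSum (fun i j => hg.differentiableAt_christoffel k i j) hψ hA hB v

lemma fderiv_christoffelVec_const {u : Coord n} (hg : RegularAt g u) (a b z : Coord n)
    (l : Fin n) :
    fderiv ℝ (fun q => christoffelVec g q a b) u z l =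
      ∑ i, ∑ j, ∑ k, partialDeriv i (christoffel g l j k) u * z i * a j * b k := by
  rw [fderiv_coord_apply (hg.differentiableAt_christoffelVec _ _)]
  have h5 : HasFDerivAt (fun p => christoffelVec g p a b l) _ u :=
    HasFDerivAt.fun_sum (u := Finset.univ) fun i _ => HasFDerivAt.fun_sum (u := Finset.univ)
      fun j _ => ((hg.differentiableAt_christoffel l i j).hasFDerivAt.mul_const (a i)).mul_const
        (b j)
  rw [h5.fderiv]
  simp only [_root_.sum_apply]
  simp only [_root_.smul_apply, smul_eq_mul, fderiv_eq_sum_partialDeriv _ _ z, Finset.mul_sum]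
  calc _ = ∑ j, ∑ i, ∑ k, partialDeriv i (christoffel g l j k) u * z i * a j * b k := by
        refine Finset.sum_congr rfl fun j _ => ?_
        rw [Finset.sum_comm]
        exact Finset.sum_congr rfl fun i _ => Finset.sum_congr rfl fun k _ => by ring
    _ = _ := Finset.sum_comm

/-- The definition of R evaluated on constant extensions of X, Y, Z, whose brackets vanish. In this
form only the vector-valued Christoffel map and its derivative are needed. -/
lemma curvature_eq {u : Coord n} (hg : RegularAt g u) (X Y Z : Coord n) :
    curvature g u X Y Z =
      fderiv ℝ (fun q => christoffelVec g q Y Z) u X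
      - fderiv ℝ (fun q => christoffelVec g q X Z) u Y
      + christoffelVec g u X (christoffelVec g u Y Z)
      - christoffelVec g u Y (christoffelVec g u X Z) := by
  ext l
  simp only [Pi.add_apply, Pi.sub_apply, fderiv_christoffelVec_const hg]
  have e2 : ∑ i, ∑ j, ∑ k, partialDeriv i (christoffel g l j k) u * Y i * X j * Z k =
      ∑ i, ∑ j, ∑ k, partialDeriv j (christoffel g l i k) u * X i * Y j * Z k := by
    rw [Finset.sum_comm]
    exact Finset.sum_congr rfl fun i _ => Finset.sum_congr rfl fun j _ =>
      Finset.sum_congr rfl fun k _ => by ring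
  have e3 : ∀ X Y : Coord n, christoffelVec g u X (christoffelVec g u Y Z) l =
      ∑ i, ∑ j, ∑ k, (∑ m, christoffel g l i m u * christoffel g m j k u) * X i * Y j * Z k := by
    intro X Y
    simp only [christoffelVec, Finset.mul_sum, Finset.sum_mul]
    refine Finset.sum_congr rfl fun i _ => ?_
    rw [Finset.sum_comm]
    refine Finset.sum_congr rfl fun j _ => ?_
    rw [Finset.sum_comm]
    exact Finset.sum_congr rfl fun k _ => Finset.sum_congr rfl fun m _ => by ring
  have e4 : christoffelVec g u Y (christoffelVec g u X Z) l =
      ∑ i, ∑ j, ∑ k, (∑ m, christoffel g l j m u * christoffel g m i k u) * X i * Y j * Z k := by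
    rw [e3 Y X, Finset.sum_comm]
    exact Finset.sum_congr rfl fun i _ => Finset.sum_congr rfl fun j _ =>
      Finset.sum_congr rfl fun k _ => by ring
  rw [e2, e3 X Y, e4]
  simp only [curvature, ← Finset.sum_add_distrib, ← Finset.sum_sub_distrib]
  refine Finset.sum_congr rfl fun i _ => Finset.sum_congr rfl fun j _ =>
    Finset.sum_congr rfl fun k _ => ?_
  rw [Finset.sum_sub_distrib]
  ring

end Connection

/-! ### Naturality of the connection and the curvature -/

section Naturality

variable {m n : ℕ} {g : MetricTensor n}

lemma innerAt_pullback (g : MetricTensor n) (ψ : Coord m → Coord n) (u v w : Coord m) :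
    innerAt (pullback g ψ) u v w = innerAt g (ψ u) (fderiv ℝ ψ u v) (fderiv ℝ ψ u w) := by
  let B : Coord m →ₗ[ℝ] Coord m →ₗ[ℝ] ℝ := LinearMap.mk₂ ℝ
    (fun v w => innerAt g (ψ u) (fderiv ℝ ψ u v) (fderiv ℝ ψ u w))
    (fun _ _ _ => by rw [map_add, innerAt_add_left])
    (fun _ _ _ => by rw [map_smul, innerAt_smul_left, smul_eq_mul])
    (fun _ _ _ => by rw [map_add, innerAt_add_right])
    (fun _ _ _ => by rw [map_smul, innerAt_smul_right, smul_eq_mul])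
  have hs : ∀ v : Coord m, v = ∑ i, v i • (Pi.single i 1 : Coord m) := fun v => by
    conv_lhs => rw [← Finset.univ_sum_single v]
    refine Finset.sum_congr rfl fun i _ => ?_
    rw [← Pi.single_smul, smul_eq_mul, mul_one]
  change _ = B v w
  conv_rhs => rw [hs v, hs w]
  simp only [map_sum, LinearMap.sum_apply, map_smul, LinearMap.smul_apply, smul_eq_mul]
  rw [innerAt_eq_bilinSum, bilinSum, Finset.sum_comm]
  simp only [Finset.mul_sum]
  refine Finset.sum_congr rfl fun j _ => Finset.sum_congr rfl fun i _ => ?_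
  simp only [pullback, Matrix.of_apply, B, LinearMap.mk₂_apply]
  ring

variable {ψ : Coord m → Coord n}

lemma contDiff_fderiv_apply (hψ : ContDiff ℝ ∞ ψ) (v : Coord m) :
    ContDiff ℝ ∞ fun q => fderiv ℝ ψ q v :=
  (hψ.fderiv_right (m := ∞) (by simp)).clm_apply contDiff_const

lemma fderiv_fderiv_apply (hψ : ContDiff ℝ ∞ ψ) (u v w : Coord m) :
    fderiv ℝ (fun q => fderiv ℝ ψ q w) u v = fderiv ℝ (fderiv ℝ ψ) u v w := by
  have h1 : DifferentiableAt ℝ (fderiv ℝ ψ) u :=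
    (hψ.fderiv_right (m := ∞) (by simp)).differentiable (by simp) u
  have := (h1.hasFDerivAt.clm_apply (hasFDerivAt_const w u)).fderiv
  rw [this]
  simp

lemma fderiv_fderiv_symm (hψ : ContDiff ℝ ∞ ψ) (u v w : Coord m) :
    fderiv ℝ (fun q => fderiv ℝ ψ q w) u v = fderiv ℝ (fun q => fderiv ℝ ψ q v) u w := by
  rw [fderiv_fderiv_apply hψ, fderiv_fderiv_apply hψ]
  exact (hψ.contDiffAt.isSymmSndFDerivAt
    (by simpa using WithTop.coe_le_coe.2 (le_top : (2 : ℕ∞) ≤ ⊤))) v w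

lemma fderiv_innerAt_pullback {h : MetricTensor m} {u : Coord m} (hψ : ContDiff ℝ ∞ ψ)
    (hg : RegularAt g (ψ u)) (hE : ∀ᶠ q in 𝓝 u, h q = pullback g ψ q) (v w z : Coord m) :
    fderiv ℝ (fun q => innerAt h q w z) u v =
      fderiv ℝ (fun p => innerAt g p (fderiv ℝ ψ u w) (fderiv ℝ ψ u z)) (ψ u) (fderiv ℝ ψ u v)
      + innerAt g (ψ u) (fderiv ℝ (fun q => fderiv ℝ ψ q w) u v) (fderiv ℝ ψ u z)
      + innerAt g (ψ u) (fderiv ℝ ψ u w) (fderiv ℝ (fun q => fderiv ℝ ψ q z) u v) := by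
  have h1 : (fun q => innerAt h q w z) =ᶠ[𝓝 u]
      fun q => bilinSum (fun i j => g (ψ q) i j) (fderiv ℝ ψ q w) (fderiv ℝ ψ q z) := by
    filter_upwards [hE] with q hq
    rw [← innerAt_eq_bilinSum, ← innerAt_pullback]
    simp only [innerAt, hq]
  rw [h1.fderiv_eq]
  simp only [innerAt_eq_bilinSum]
  exact fderiv_bilinSum hg.differentiableAt (hψ.differentiable (by simp) u)
    ((contDiff_fderiv_apply hψ w).differentiable (by simp) u)
    ((contDiff_fderiv_apply hψ z).differentiable (by simp) u) v

/-- The tangential part of the Gauss formula. -/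
lemma innerAt_gauss {h : MetricTensor m} {u : Coord m} (hψ : ContDiff ℝ ∞ ψ)
    (hg : RegularAt g (ψ u)) (hh : RegularAt h u) (hE : ∀ᶠ q in 𝓝 u, h q = pullback g ψ q)
    (z v w : Coord m) :
    innerAt g (ψ u) (fderiv ℝ ψ u z) (fderiv ℝ (fun q => fderiv ℝ ψ q w) u v
      + christoffelVec g (ψ u) (fderiv ℝ ψ u v) (fderiv ℝ ψ u w)) =
      innerAt h u z (christoffelVec h u v w) := by
  have hc := innerAt_comm_of_posDef hg.posDef.self_of_nhds
  rw [innerAt_add_right, innerAt_christoffelVec hg, innerAt_christoffelVec hh,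
    fderiv_innerAt_pullback hψ hg hE v w z, fderiv_innerAt_pullback hψ hg hE w v z,
    fderiv_innerAt_pullback hψ hg hE z v w,
    fderiv_fderiv_symm hψ u w v, fderiv_fderiv_symm hψ u z v, fderiv_fderiv_symm hψ u z w,
    hc (fderiv ℝ ψ u z)]
  rw [hc (fderiv ℝ ψ u w), hc (fderiv ℝ ψ u v)]
  ring

end Naturality

/-! ### Local isometries: Christoffel symbols, covariant derivatives and curvature. -/

section LocalDiffeo

variable {n : ℕ} {g h : MetricTensor n} {ψ : Coord n → Coord n} {u : Coord n}

/-- Near `u` the smooth map `ψ` is a local isometry from `h` to `g`. -/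
structure LocalIsometryAt (h g : MetricTensor n) (ψ : Coord n → Coord n) (u : Coord n) :
    Prop where
  contDiff : ContDiff ℝ ∞ ψ
  target : RegularAt g (ψ u)
  source : RegularAt h u
  eq_pullback : ∀ᶠ q in 𝓝 u, h q = pullback g ψ q

lemma LocalIsometryAt.eventually (H : LocalIsometryAt h g ψ u) :
    ∀ᶠ q in 𝓝 u, LocalIsometryAt h g ψ q := by
  filter_upwards [H.contDiff.continuous.continuousAt.eventually H.target.eventually,
    H.source.eventually, H.eq_pullback.eventually_nhds] with q h1 h2 h3
    using ⟨H.contDiff, h1, h2, h3⟩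

lemma LocalIsometryAt.innerAt_fderiv (H : LocalIsometryAt h g ψ u) (v w : Coord n) :
    innerAt g (ψ u) (fderiv ℝ ψ u v) (fderiv ℝ ψ u w) = innerAt h u v w := by
  rw [← innerAt_pullback]
  simp only [innerAt, H.eq_pullback.self_of_nhds]

lemma LocalIsometryAt.injective (H : LocalIsometryAt h g ψ u) :
    Function.Injective (fderiv ℝ ψ u) := by
  intro a b hab
  refine eq_of_innerAt_eq H.source.posDef.self_of_nhds fun z => ?_
  rw [← H.innerAt_fderiv, ← H.innerAt_fderiv, hab]

lemma LocalIsometryAt.surjective (H : LocalIsometryAt h g ψ u) :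
    Function.Surjective (fderiv ℝ ψ u) :=
  (LinearMap.injective_iff_surjective (f := (fderiv ℝ ψ u : Coord n →ₗ[ℝ] Coord n))).1 H.injective

/-- In equal dimensions dψ is onto, so the tangential part computed in `innerAt_gauss` determines
the whole vector. -/
lemma LocalIsometryAt.christoffelVec (H : LocalIsometryAt h g ψ u) (v w : Coord n) :
    fderiv ℝ (fun q => fderiv ℝ ψ q w) u v
      + christoffelVec g (ψ u) (fderiv ℝ ψ u v) (fderiv ℝ ψ u w) =
      fderiv ℝ ψ u (christoffelVec h u v w) := by
  refine eq_of_innerAt_eq H.target.posDef.self_of_nhds fun z' => ?_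
  obtain ⟨z, rfl⟩ := H.surjective z'
  rw [innerAt_gauss H.contDiff H.target H.source H.eq_pullback, H.innerAt_fderiv]

lemma fderiv_fderiv_apply_fun {E : Type*} [NormedAddCommGroup E] [NormedSpace ℝ E]
    {γ V : E → Coord n} {s : E} (hψ : ContDiff ℝ ∞ ψ) (hγ : DifferentiableAt ℝ γ s)
    (hV : DifferentiableAt ℝ V s) (e : E) :
    fderiv ℝ (fun s => fderiv ℝ ψ (γ s) (V s)) s e =
      fderiv ℝ (fun q => fderiv ℝ ψ q (V s)) (γ s) (fderiv ℝ γ s e)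
        + fderiv ℝ ψ (γ s) (fderiv ℝ V s e) := by
  have h1 : DifferentiableAt ℝ (fderiv ℝ ψ) (γ s) :=
    (hψ.fderiv_right (m := ∞) (by simp)).differentiable (by simp) _
  have h2 : HasFDerivAt (fun s => fderiv ℝ ψ (γ s)) _ s :=
    h1.hasFDerivAt.comp s hγ.hasFDerivAt
  rw [(h2.clm_apply hV.hasFDerivAt).fderiv, fderiv_fderiv_apply hψ]
  simp [add_comm]

lemma LocalIsometryAt.covDeriv {γ V : ℝ → Coord n} {s : ℝ} (H : LocalIsometryAt h g ψ (γ s))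
    (hγ : Differentiable ℝ γ) (hV : DifferentiableAt ℝ V s) :
    covDeriv g (ψ ∘ γ) (fun s => fderiv ℝ ψ (γ s) (V s)) s =
      fderiv ℝ ψ (γ s) (covDeriv h γ V s) := by
  have h1 : deriv (ψ ∘ γ) s = fderiv ℝ ψ (γ s) (deriv γ s) :=
    fderiv_comp_deriv s (H.contDiff.differentiable (by simp) _) (hγ s)
  unfold PlaneCovers.covDeriv
  rw [map_add, ← H.christoffelVec, h1, ← fderiv_apply_one_eq_deriv,
    fderiv_fderiv_apply_fun H.contDiff (hγ s) hV]
  simp only [fderiv_apply_one_eq_deriv, Function.comp_apply]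
  abel

/-- The transformation law of the Christoffel symbols holds near u, hence may be differentiated in
the direction X. -/
lemma LocalIsometryAt.fderiv_christoffelVec (H : LocalIsometryAt h g ψ u) (X Y Z : Coord n) :
    fderiv ℝ (fun q => fderiv ℝ (fun q => fderiv ℝ ψ q Z) q Y) u X
      + (fderiv ℝ (fun p => PlaneCovers.christoffelVec g p (fderiv ℝ ψ u Y) (fderiv ℝ ψ u Z))
          (ψ u) (fderiv ℝ ψ u X)
        + PlaneCovers.christoffelVec g (ψ u) (fderiv ℝ (fun q => fderiv ℝ ψ q Y) u X)
            (fderiv ℝ ψ u Z)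
        + PlaneCovers.christoffelVec g (ψ u) (fderiv ℝ ψ u Y)
            (fderiv ℝ (fun q => fderiv ℝ ψ q Z) u X)) =
      fderiv ℝ (fun q => fderiv ℝ ψ q (PlaneCovers.christoffelVec h u Y Z)) u X
        + fderiv ℝ ψ u (fderiv ℝ (fun q => PlaneCovers.christoffelVec h q Y Z) u X) := by
  have hd : ∀ v, DifferentiableAt ℝ (fun q => fderiv ℝ ψ q v) u := fun v =>
    (contDiff_fderiv_apply H.contDiff v).differentiable (by simp) u
  have hψd : DifferentiableAt ℝ ψ u := H.contDiff.differentiable (by simp) u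
  have hE : (fun q => fderiv ℝ (fun q => fderiv ℝ ψ q Z) q Y
      + PlaneCovers.christoffelVec g (ψ q) (fderiv ℝ ψ q Y) (fderiv ℝ ψ q Z)) =ᶠ[𝓝 u]
      fun q => fderiv ℝ ψ q (PlaneCovers.christoffelVec h q Y Z) := by
    filter_upwards [H.eventually] with q hq using hq.christoffelVec Y Z
  have h1 := congrArg (fun L : Coord n →L[ℝ] Coord n => L X) hE.fderiv_eq
  have hd2 : DifferentiableAt ℝ (fun q => fderiv ℝ (fun q => fderiv ℝ ψ q Z) q Y) u :=
    (contDiff_fderiv_apply (contDiff_fderiv_apply H.contDiff Z) Y).differentiable (by simp) u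
  have hd3 : DifferentiableAt ℝ
      (fun q => PlaneCovers.christoffelVec g (ψ q) (fderiv ℝ ψ q Y) (fderiv ℝ ψ q Z)) u :=
    differentiableAt_pi.2 fun k => differentiableAt_bilinSum
      (fun i j => (H.target.differentiableAt_christoffel k i j).comp u hψd) (hd _) (hd _)
  have h2 := PlaneCovers.fderiv_christoffelVec H.target hψd (hd Y) (hd Z) X
  have h3 := fderiv_fderiv_apply_fun (γ := id) (V := fun q => PlaneCovers.christoffelVec h q Y Z)
    H.contDiff differentiableAt_id (H.source.differentiableAt_christoffelVec Y Z) X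
  simp only [id, ContinuousLinearMap.coe_id', fderiv_id] at h3
  rw [fderiv_fun_add hd2 hd3, _root_.add_apply, h2, h3] at h1
  exact h1

/-- Local isometries preserve the curvature tensor. -/
lemma LocalIsometryAt.curvature (H : LocalIsometryAt h g ψ u) (X Y Z : Coord n) :
    curvature g (ψ u) (fderiv ℝ ψ u X) (fderiv ℝ ψ u Y) (fderiv ℝ ψ u Z) =
      fderiv ℝ ψ u (curvature h u X Y Z) := by
  rw [curvature_eq H.target, curvature_eq H.source]
  -- The difference of the differentiated laws for (X, Y) and (Y, X) is the claim: by symmetry the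
  -- third derivatives of ψ cancel (e3), as do the terms containing its second derivative in the
  -- directions X and Y (e4).
  have e1 := H.fderiv_christoffelVec X Y Z
  have e2 := H.fderiv_christoffelVec Y X Z
  have e3 : fderiv ℝ (fun q => fderiv ℝ (fun q => fderiv ℝ ψ q Z) q Y) u X =
      fderiv ℝ (fun q => fderiv ℝ (fun q => fderiv ℝ ψ q Z) q X) u Y :=
    fderiv_fderiv_symm (contDiff_fderiv_apply H.contDiff Z) u X Y
  have e4 := fderiv_fderiv_symm H.contDiff u X Y
  have c1 := H.christoffelVec X Z
  have c2 := H.christoffelVec Y Z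
  have c3 := H.christoffelVec X (PlaneCovers.christoffelVec h u Y Z)
  have c4 := H.christoffelVec Y (PlaneCovers.christoffelVec h u X Z)
  rw [← c2, christoffelVec_add_right] at c3
  rw [← c1, christoffelVec_add_right] at c4
  simp only [map_sub, map_add]
  rw [← c3, ← c4]
  rw [e3] at e1
  rw [e4] at e1
  rw [← sub_eq_zero] at e1 e2 ⊢
  rw [← sub_eq_zero.2 (e1.trans e2.symm)]
  abel

lemma LocalIsometryAt.innerAt_curvature (H : LocalIsometryAt h g ψ u) (X Y Z W : Coord n) :
    innerAt g (ψ u) (PlaneCovers.curvature g (ψ u) (fderiv ℝ ψ u X) (fderiv ℝ ψ u Y)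
      (fderiv ℝ ψ u Z)) (fderiv ℝ ψ u W) = innerAt h u (PlaneCovers.curvature h u X Y Z) W := by
  rw [H.curvature, H.innerAt_fderiv]

end LocalDiffeo

/-! ### A support theorem for line integrals in the plane -/

section Radon

/-- Vanishing moments make H orthogonal to all polynomials, and these approximate H uniformly on the
interval that carries it. Hence ∫ H² = 0. -/
lemma eq_zero_of_forall_integral_pow_mul {H : ℝ → ℝ} (hH : Continuous H) {B : ℝ}
    (hB : ∀ x, B ≤ |x| → H x = 0) (h : ∀ k : ℕ, ∫ x, x ^ k * H x = 0) (x : ℝ) : H x = 0 := by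
  have hc : HasCompactSupport H := HasCompactSupport.intro (isCompact_Icc (a := -B) (b := B))
    fun x hx => hB x (by by_contra hlt; exact hx (abs_le.1 (not_le.1 hlt).le))
  have hpoly : ∀ p : Polynomial ℝ, ∫ x, p.eval x * H x = 0 := by
    intro p
    simp only [Polynomial.eval_eq_sum_range, Finset.sum_mul, mul_assoc]
    rw [integral_finsetSum]
    · exact Finset.sum_eq_zero fun k _ => by rw [integral_const_mul, h, mul_zero]
    · intro k _
      exact Continuous.integrable_of_hasCompactSupport (by fun_prop)
        (hc.mul_left.mul_left)
  have hHH : Integrable fun x => H x * H x :=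
    Continuous.integrable_of_hasCompactSupport (by fun_prop) hc.mul_left
  have hle : ∀ δ > 0, ∫ x, H x * H x ≤ δ * ∫ x, |H x| := by
    intro δ hδ
    obtain ⟨p, hp⟩ := exists_polynomial_near_of_continuousOn (-B) B H hH.continuousOn δ hδ
    have e : ∫ x, H x * H x = ∫ x, (H x - p.eval x) * H x := by
      simp only [sub_mul]
      rw [integral_sub hHH, hpoly, sub_zero]
      exact Continuous.integrable_of_hasCompactSupport (by fun_prop) hc.mul_left
    rw [e, ← integral_const_mul]
    refine integral_mono (Continuous.integrable_of_hasCompactSupport (by fun_prop) hc.mul_left)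
      (Continuous.integrable_of_hasCompactSupport (by fun_prop) hc.abs.mul_left) fun x => ?_
    change (H x - p.eval x) * H x ≤ δ * |H x|
    by_cases hx : B ≤ |x|
    · simp [hB x hx]
    · have := hp x (abs_le.1 (not_le.1 hx).le)
      calc (H x - p.eval x) * H x ≤ |H x - p.eval x| * |H x| := by
            rw [← abs_mul]; exact le_abs_self _
        _ ≤ δ * |H x| := by
            rw [abs_sub_comm]
            gcongr
  have h0 : ∫ x, H x * H x ≤ 0 := by
    refine le_of_forall_pos_le_add fun δ hδ => ?_
    have hI : 0 ≤ ∫ x, |H x| := integral_nonneg fun x => abs_nonneg _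
    calc ∫ x, H x * H x ≤ (δ / (1 + ∫ x, |H x|)) * ∫ x, |H x| := hle _ (by positivity)
      _ ≤ δ := by
          rw [div_mul_eq_mul_div, div_le_iff₀ (by positivity)]
          nlinarith
      _ = 0 + δ := by ring
  by_contra hx
  have := Continuous.integral_pos_of_hasCompactSupport_nonneg_nonzero (μ := volume)
    (f := fun x => H x * H x) (x := x) (by fun_prop) hc.mul_left
    (fun x => mul_self_nonneg _) (mul_self_ne_zero.2 hx)
  linarith

variable {G : ℝ × ℝ → ℝ} {B : ℝ}

lemma integrable_of_forall_abs_ge {H : ℝ → ℝ} (hH : Continuous H)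
    (hB : ∀ x, B ≤ |x| → H x = 0) : Integrable H :=
  hH.integrable_of_hasCompactSupport <|
    HasCompactSupport.intro (isCompact_Icc (a := -B) (b := B))
      fun x hx => hB x (by by_contra hlt; exact hx (abs_le.1 (not_le.1 hlt).le))

/-- Since G vanishes at heights ≥ B, the inner integral from B down to the line is minus the
integral over the ray above the line. By Fubini these rays assemble into integrals over parallel
lines with larger intercepts. -/
lemma integral_upper_half_plane_eq_zero (hG : Continuous G)
    (hB : ∀ x y, B ≤ |x| ∨ B ≤ |y| → G (x, y) = 0) {a b : ℝ}
    (h : ∀ b' > b, ∫ x, G (x, a * x + b') = 0) :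
    ∫ x, ∫ y in B..(a * x + b), G (x, y) = 0 := by
  -- For |x| ≤ |B|, the line shifted up by T lies at heights ≥ B, beyond the support of G.
  set T := |B| + |a| * |B| + |b|
  have hT : 0 ≤ T := by positivity
  have key : ∀ x, ∫ y in B..(a * x + b), G (x, y) = - ∫ τ in Ioc 0 T, G (x, a * x + b + τ) := by
    intro x
    by_cases hx : B ≤ |x|
    · simp [hB x _ (Or.inl hx)]
    · have hx' : |x| ≤ |B| := (not_le.1 hx).le.trans (le_abs_self B)
      have hax : |a * x| ≤ |a| * |B| := by rw [abs_mul]; gcongr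
      have hge : B ≤ a * x + b + T := by
        have h1 := neg_abs_le (a * x)
        have h2 := neg_abs_le b
        have h3 := le_abs_self B
        simp only [T]
        linarith
      have hc : Continuous fun y => G (x, y) := by fun_prop
      have hi : ∀ c d, IntervalIntegrable (fun y => G (x, y)) volume c d := fun c d =>
        hc.intervalIntegrable c d
      have h0 : ∫ y in B..(a * x + b + T), G (x, y) = 0 := by
        rw [intervalIntegral.integral_congr (g := fun _ => 0)]
        · simp
        · intro y hy
          rw [uIcc_of_le hge] at hy
          exact hB x y (Or.inr (hy.1.trans (le_abs_self y)))
      rw [← intervalIntegral.integral_of_le hT,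
        intervalIntegral.integral_comp_add_left (fun y => G (x, y)), add_zero]
      have := intervalIntegral.integral_add_adjacent_intervals (hi B (a * x + b))
        (hi (a * x + b) (a * x + b + T))
      linarith
  simp only [key]
  rw [integral_neg, neg_eq_zero]
  have hint : Integrable (Function.uncurry fun x τ => G (x, a * x + b + τ))
      (volume.prod (volume.restrict (Ioc 0 T))) := by
    have h1 : Integrable (Function.uncurry fun x τ => G (x, a * x + b + τ))
        ((volume : Measure ℝ).prod (volume : Measure ℝ)) := by
      refine Continuous.integrable_of_hasCompactSupport (by
        unfold Function.uncurry; fun_prop) (HasCompactSupport.intro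
        ((isCompact_Icc (a := -|B|) (b := |B|)).prod
          (isCompact_Icc (a := -T) (b := T))) ?_)
      rintro ⟨x, τ⟩ hx
      by_contra hne
      change G (x, a * x + b + τ) ≠ 0 at hne
      have h2 : ¬ (B ≤ |x| ∨ B ≤ |a * x + b + τ|) := fun h' => hne (hB _ _ h')
      push Not at h2
      have hx' : |x| ≤ |B| := h2.1.le.trans (le_abs_self B)
      have hax : |a * x| ≤ |a| * |B| := by rw [abs_mul]; gcongr
      have h4 := abs_le.1 (h2.2.le.trans (le_abs_self B))
      have h5 := abs_le.1 hax
      have h6 := abs_le.1 (le_refl |b|)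
      refine hx ⟨abs_le.1 hx', ?_, ?_⟩ <;> simp only [T] <;> linarith
    have h3 := h1.restrict (s := univ ×ˢ Ioc 0 T)
    rwa [← Measure.prod_restrict, Measure.restrict_univ] at h3
  rw [integral_integral_swap hint]
  refine setIntegral_eq_zero_of_forall_eq_zero fun τ hτ => ?_
  rw [← h (b + τ) (by linarith [hτ.1])]
  simp only [add_assoc]

/-- The half-plane integral vanishes for all slopes near a, and its derivative in the slope is the
first moment of G along the boundary line. -/
lemma integral_mul_eq_zero_of_lines (hG : Continuous G)
    (hB : ∀ x y, B ≤ |x| ∨ B ≤ |y| → G (x, y) = 0) {A : Set ℝ} (hA : IsOpen A) {b₁ : ℝ}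
    (h : ∀ a ∈ A, ∀ b > b₁, ∫ x, G (x, a * x + b) = 0) :
    ∀ a ∈ A, ∀ b > b₁, ∫ x, x * G (x, a * x + b) = 0 := by
  intro a ha b hb
  obtain ⟨M, hM⟩ : ∃ M, ∀ z, ‖G z‖ ≤ M := by
    refine HasCompactSupport.exists_bound_of_continuous (HasCompactSupport.intro
      ((isCompact_Icc (a := -B) (b := B)).prod (isCompact_Icc (a := -B) (b := B))) ?_) hG
    rintro ⟨x, y⟩ hxy
    refine hB x y ?_
    by_contra hlt
    push Not at hlt
    exact hxy ⟨abs_le.1 hlt.1.le, abs_le.1 hlt.2.le⟩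
  have hcont : ∀ a', Continuous fun x => ∫ y in B..(a' * x + b), G (x, y) := fun a' =>
    intervalIntegral.continuous_parametric_intervalIntegral_of_continuous
      (f := fun x y => G (x, y)) (by unfold Function.uncurry; fun_prop) (by fun_prop)
  have hder := hasDerivAt_integral_of_dominated_loc_of_deriv_le (μ := volume) (s := univ)
    (F := fun a' x => ∫ y in B..(a' * x + b), G (x, y)) (x₀ := a)
    (F' := fun a' x => G (x, a' * x + b) * x)
    (bound := fun x => (Icc (-B) B).indicator (fun _ => M * B) x)
    univ_mem (Eventually.of_forall fun a' => (hcont a').aestronglyMeasurable)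
    (integrable_of_forall_abs_ge (B := B) (hcont a) fun x hx => by
      simp [hB x _ (Or.inl hx)])
    (Continuous.aestronglyMeasurable (by fun_prop))
    (Eventually.of_forall fun x a' _ => by
      by_cases hx : B ≤ |x|
      · simp only [hB x _ (Or.inl hx), zero_mul, norm_zero]
        refine indicator_nonneg (fun y hy => ?_) x
        exact mul_nonneg ((norm_nonneg _).trans (hM 0)) (by linarith [hy.1, hy.2])
      · have hx' := (not_le.1 hx).le
        rw [indicator_of_mem (show x ∈ Icc (-B) B from abs_le.1 hx'), norm_mul]
        exact mul_le_mul (hM _) hx' (norm_nonneg _) ((norm_nonneg _).trans (hM 0)))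
    ((integrable_indicator_iff measurableSet_Icc).2 (integrableOn_const (by simp)))
    (Eventually.of_forall fun x a' _ => by
      have hc : Continuous fun y => G (x, y) := by fun_prop
      have h1 : HasDerivAt (fun w => ∫ y in B..w, G (x, y)) (G (x, a' * x + b)) (a' * x + b) :=
        intervalIntegral.integral_hasDerivAt_right (hc.intervalIntegrable _ _)
          hc.stronglyMeasurable.stronglyMeasurableAtFilter hc.continuousAt
      have h2 : HasDerivAt (fun a' : ℝ => a' * x + b) x a' := by
        simpa using ((hasDerivAt_id a').mul_const x).add_const b
      exact h1.comp a' h2)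
  have hzero : (fun a' => ∫ x, ∫ y in B..(a' * x + b), G (x, y)) =ᶠ[𝓝 a] fun _ => 0 := by
    filter_upwards [hA.mem_nhds ha] with a' ha'
    exact integral_upper_half_plane_eq_zero hG hB fun b' hb' => h a' ha' b' (hb.trans hb')
  have h0 := hzero.deriv_eq
  rw [hder.2.deriv, deriv_const] at h0
  rw [← h0]
  exact integral_congr_ae (Eventually.of_forall fun x => mul_comm _ _)

/-- If the integrals of `G` over all lines `y = a x + b` with slopes in an open set and `b > b₁`
vanish, then `G` vanishes on all these lines. -/
lemma eq_zero_of_line_integrals (hG : Continuous G)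
    (hB : ∀ x y, B ≤ |x| ∨ B ≤ |y| → G (x, y) = 0) {A : Set ℝ} (hA : IsOpen A) {b₁ : ℝ}
    (h : ∀ a ∈ A, ∀ b > b₁, ∫ x, G (x, a * x + b) = 0) {a b : ℝ} (ha : a ∈ A) (hb : b₁ < b)
    (x : ℝ) : G (x, a * x + b) = 0 := by
  -- The function x^k G satisfies the same hypotheses as G, so the previous lemma can be iterated.
  have key : ∀ k : ℕ, ∀ a ∈ A, ∀ b > b₁, ∫ x, x ^ k * G (x, a * x + b) = 0 := by
    intro k
    induction k with
    | zero => simpa using h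
    | succ k ih =>
      have := integral_mul_eq_zero_of_lines (G := fun z => z.1 ^ k * G z) (B := B) (b₁ := b₁)
        (by fun_prop) (fun x y hxy => by simp [hB x y hxy]) hA ih
      intro a ha b hb
      rw [← this a ha b hb]
      exact integral_congr_ae (Eventually.of_forall fun x => by simp only [pow_succ]; ring)
  exact eq_zero_of_forall_integral_pow_mul (H := fun x => G (x, a * x + b)) (B := B)
    (by fun_prop) (fun x hx => hB x _ (Or.inl hx)) (fun k => key k a ha b hb) x

end Radon

/-! ### Rotationally warped metrics -/

section Warp

/-- Components of the one-form `r² dα`. -/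
def angForm (p : Coord 3) : Coord 3 := ![0, -p 2, p 1]

/-- The metric `dt² + e^{2lt} (dx² + dy² + Q r⁴ dα²)`. -/
def warpMetric (l : ℝ) (Q : Coord 3 → ℝ) : MetricTensor 3 := fun p =>
  Matrix.vecMulVec formT formT + Real.exp (2 * l * p 0) •
    (Matrix.diagonal ![0, 1, 1] + Q p • Matrix.vecMulVec (angForm p) (angForm p))

/-- The functions `Q` for which `warpMetric l Q` is a Riemannian metric. -/
structure IsAdmissible (Q : Coord 3 → ℝ) : Prop where
  contDiff : ContDiff ℝ ∞ Q
  pos : ∀ p, 0 < 1 + Q p * (p 1 ^ 2 + p 2 ^ 2)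

variable {l : ℝ} {Q : Coord 3 → ℝ}

lemma innerAt_warpMetric (p v w : Coord 3) : innerAt (warpMetric l Q) p v w =
    v 0 * w 0 + Real.exp (2 * l * p 0) * (v 1 * w 1 + v 2 * w 2
      + Q p * (p 1 * v 2 - p 2 * v 1) * (p 1 * w 2 - p 2 * w 1)) := by
  simp only [innerAt, warpMetric, formT, angForm, Matrix.mulVec, dotProduct, Fin.sum_univ_three,
    Matrix.add_apply, Matrix.smul_apply, Matrix.vecMulVec_apply, Matrix.diagonal_apply,
    Matrix.cons_val, smul_eq_mul]
  simp
  ring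

/-- With θ = p₁v₂ - p₂v₁ the right side equals the left side plus (1 + Q r²) θ². This is the bound
|r dr(v)| ≤ r |v| for the horizontal metric, and it is uniform in Q. -/
lemma IsAdmissible.sq_le (hQ : IsAdmissible Q) (p v : Coord 3) :
    (p 1 * v 1 + p 2 * v 2) ^ 2 ≤ (p 1 ^ 2 + p 2 ^ 2) * (v 1 * v 1 + v 2 * v 2
      + Q p * (p 1 * v 2 - p 2 * v 1) * (p 1 * v 2 - p 2 * v 1)) := by
  have h := mul_nonneg (hQ.pos p).le (sq_nonneg (p 1 * v 2 - p 2 * v 1))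
  nlinarith [h]

/-- On the axis the Q term vanishes. Off the axis, r² times the expression is the sum of the radial
square and (1 + Q r²) times the angular square, which do not vanish together. -/
lemma IsAdmissible.horizontal_pos (hQ : IsAdmissible Q) (p v : Coord 3) (hv : v 1 ≠ 0 ∨ v 2 ≠ 0) :
    0 < v 1 * v 1 + v 2 * v 2
      + Q p * (p 1 * v 2 - p 2 * v 1) * (p 1 * v 2 - p 2 * v 1) := by
  have hvv : 0 < v 1 * v 1 + v 2 * v 2 := by
    rcases hv with h | h
    · nlinarith [mul_self_pos.2 h, mul_self_nonneg (v 2)]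
    · nlinarith [mul_self_pos.2 h, mul_self_nonneg (v 1)]
  rcases (add_nonneg (sq_nonneg (p 1)) (sq_nonneg (p 2))).eq_or_lt with h0 | h0
  · have h1 : p 1 = 0 := by nlinarith [sq_nonneg (p 1), sq_nonneg (p 2)]
    have h2 : p 2 = 0 := by nlinarith [sq_nonneg (p 1), sq_nonneg (p 2)]
    simpa [h1, h2] using hvv
  · refine pos_of_mul_pos_right (?_ : 0 < (p 1 ^ 2 + p 2 ^ 2) * _) h0.le
    have hid : (p 1 ^ 2 + p 2 ^ 2) * (v 1 * v 1 + v 2 * v 2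
        + Q p * (p 1 * v 2 - p 2 * v 1) * (p 1 * v 2 - p 2 * v 1)) =
        (p 1 * v 1 + p 2 * v 2) ^ 2 +
          (1 + Q p * (p 1 ^ 2 + p 2 ^ 2)) * (p 1 * v 2 - p 2 * v 1) ^ 2 := by ring
    rw [hid]
    by_cases hθ : p 1 * v 2 - p 2 * v 1 = 0
    · have : (p 1 * v 1 + p 2 * v 2) ^ 2 = (p 1 ^ 2 + p 2 ^ 2) * (v 1 * v 1 + v 2 * v 2)
          - (p 1 * v 2 - p 2 * v 1) ^ 2 := by ring
      rw [this, hθ]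
      have := mul_pos h0 hvv
      nlinarith
    · have := mul_pos (hQ.pos p) (by positivity : 0 < (p 1 * v 2 - p 2 * v 1) ^ 2)
      nlinarith [sq_nonneg (p 1 * v 1 + p 2 * v 2)]

lemma IsAdmissible.isRiemannianMetric (hQ : IsAdmissible Q) (l : ℝ) :
    IsRiemannianMetric (warpMetric l Q) := by
  refine ⟨fun i j => ?_, fun p => ?_⟩
  · have := hQ.contDiff
    have e : (fun p => warpMetric l Q p i j) = fun p =>
        innerAt (warpMetric l Q) p (Pi.single i 1) (Pi.single j 1) := by
      ext p; rw [innerAt_single]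
    rw [e]
    simp only [innerAt_warpMetric]
    fun_prop
  · refine Matrix.PosDef.of_dotProduct_mulVec_pos ?_ fun v hv => ?_
    · ext i j
      have h1 := innerAt_single (warpMetric l Q) p i j
      have h2 := innerAt_single (warpMetric l Q) p j i
      rw [innerAt_warpMetric] at h1 h2
      simp only [Matrix.conjTranspose_apply, star_trivial, ← h1, ← h2]
      ring
    · change 0 < innerAt (warpMetric l Q) p v v
      rw [innerAt_warpMetric]
      by_cases h : v 1 ≠ 0 ∨ v 2 ≠ 0
      · have := mul_pos (Real.exp_pos (2 * l * p 0)) (hQ.horizontal_pos p v h)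
        nlinarith [mul_self_nonneg (v 0)]
      · push Not at h
        have h0 : v 0 ≠ 0 := fun h0 => hv (by ext i; fin_cases i <;> simp [h0, h.1, h.2])
        simp only [h.1, h.2]
        have := mul_self_pos.2 h0
        simpa using this

lemma fderiv_innerAt_warpMetric (hQ : IsAdmissible Q) (p v w z : Coord 3) :
    fderiv ℝ (fun q => innerAt (warpMetric l Q) q w z) p v =
      2 * l * v 0 * Real.exp (2 * l * p 0) * (w 1 * z 1 + w 2 * z 2
        + Q p * (p 1 * w 2 - p 2 * w 1) * (p 1 * z 2 - p 2 * z 1))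
      + Real.exp (2 * l * p 0) *
        (fderiv ℝ Q p v * (p 1 * w 2 - p 2 * w 1) * (p 1 * z 2 - p 2 * z 1)
        + Q p * (v 1 * w 2 - v 2 * w 1) * (p 1 * z 2 - p 2 * z 1)
        + Q p * (p 1 * w 2 - p 2 * w 1) * (v 1 * z 2 - v 2 * z 1)) := by
  have hc : ∀ i, HasFDerivAt (fun q : Coord 3 => q i) (ContinuousLinearMap.proj i) p := fun i =>
    hasFDerivAt_apply (𝕜 := ℝ) (F' := fun _ : Fin 3 => ℝ) i p
  have hQ' := (hQ.contDiff.differentiable (by simp) p).hasFDerivAt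
  have hexp := ((hc 0).const_mul (2 * l)).exp
  have hθ : ∀ w : Coord 3, HasFDerivAt (fun q : Coord 3 => q 1 * w 2 - q 2 * w 1)
      _ p := fun w => ((hc 1).mul_const (w 2)).sub ((hc 2).mul_const (w 1))
  have h := (hexp.mul (((hQ'.mul (hθ w)).mul (hθ z)).const_add
    (w 1 * z 1 + w 2 * z 2))).const_add (w 0 * z 0)
  have e : (fun q => innerAt (warpMetric l Q) q w z) = _ :=
    funext fun q => innerAt_warpMetric q w z
  rw [e]
  refine (DFunLike.congr_fun h.fderiv v).trans ?_
  simp only [_root_.add_apply, _root_.smul_apply, _root_.sub_apply, Pi.mul_apply,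
    ContinuousLinearMap.proj_apply, smul_eq_mul]
  ring

/-- The linear parametrization of the plane `E_α`. -/
def planeMap (α : ℝ) : Coord 2 →L[ℝ] Coord 3 :=
  ContinuousLinearMap.pi ![ContinuousLinearMap.proj 0, Real.cos α • ContinuousLinearMap.proj 1,
    Real.sin α • ContinuousLinearMap.proj 1]

@[simp] lemma planeMap_zero (α : ℝ) (u : Coord 2) : planeMap α u 0 = u 0 := rfl

@[simp] lemma planeMap_one (α : ℝ) (u : Coord 2) : planeMap α u 1 = Real.cos α * u 1 := rfl

@[simp] lemma planeMap_two (α : ℝ) (u : Coord 2) : planeMap α u 2 = Real.sin α * u 1 := rfl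

lemma planeMap_injective (α : ℝ) : Function.Injective (planeMap α) := by
  intro u v h
  have h0 := congrFun h 0
  have h1 := congrFun h 1
  have h2 := congrFun h 2
  simp only [planeMap_zero, planeMap_one, planeMap_two] at h0 h1 h2
  have h3 : u 1 = v 1 := by
    linear_combination Real.cos α * h1 + Real.sin α * h2
      - (u 1 - v 1) * Real.cos_sq_add_sin_sq α
  ext i
  fin_cases i
  · exact h0
  · exact h3

lemma halfPlanePair_eq_range (α : ℝ) : halfPlanePair α = range (planeMap α) := by
  ext p
  constructor
  · rintro ⟨t, r, -, rfl | rfl⟩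
    · refine ⟨![t, r], ?_⟩
      ext i; fin_cases i <;> simp [cyl, mul_comm]
    · refine ⟨![t, -r], ?_⟩
      ext i; fin_cases i <;> simp [cyl, Real.cos_add_pi, Real.sin_add_pi, mul_comm]
  · rintro ⟨u, rfl⟩
    rcases le_total 0 (u 1) with h | h
    · refine ⟨u 0, u 1, h, Or.inl ?_⟩
      ext i; fin_cases i <;> simp [cyl, mul_comm]
    · refine ⟨u 0, -u 1, by linarith, Or.inr ?_⟩
      ext i; fin_cases i <;> simp [cyl, Real.cos_add_pi, Real.sin_add_pi, mul_comm]

lemma innerAt_warpMetric_planeMap (α : ℝ) (u a b : Coord 2) :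
    innerAt (warpMetric l Q) (planeMap α u) (planeMap α a) (planeMap α b) =
      a 0 * b 0 + Real.exp (2 * l * u 0) * (a 1 * b 1) := by
  rw [innerAt_warpMetric]
  simp only [planeMap_zero, planeMap_one, planeMap_two]
  linear_combination Real.exp (2 * l * u 0) * a 1 * b 1 * Real.cos_sq_add_sin_sq α

/-- The vector-valued Christoffel form of `dt² + e^{2lt} dρ²`. -/
def planeChristoffel (l : ℝ) (u a b : Coord 2) : Coord 2 :=
  ![-l * Real.exp (2 * l * u 0) * (a 1 * b 1), l * (a 0 * b 1 + a 1 * b 0)]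

/-- For base point and vectors in E_α, every Q term of the Koszul formula contains a factor p₁w₂ -
p₂w₁ or v₁w₂ - v₂w₁ with all entries from E_α, which is zero. This holds even when tested against
transversal z, so E_α is totally geodesic. -/
lemma christoffelVec_planeMap (hQ : IsAdmissible Q) (α : ℝ) (u a b : Coord 2) :
    christoffelVec (warpMetric l Q) (planeMap α u) (planeMap α a) (planeMap α b) =
      planeMap α (planeChristoffel l u a b) := by
  have hg := (hQ.isRiemannianMetric l).regularAt (planeMap α u)
  refine eq_of_innerAt_eq hg.posDef.self_of_nhds fun z => ?_
  rw [innerAt_christoffelVec hg]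
  simp only [fderiv_innerAt_warpMetric hQ]
  simp only [innerAt_warpMetric, planeMap_zero, planeMap_one,
    planeMap_two, planeChristoffel, Matrix.cons_val_zero, Matrix.cons_val_one]
  linear_combination (-(l * z 0 * Real.exp (2 * l * u 0) * a 1 * b 1)) *
    Real.cos_sq_add_sin_sq α

/-- The metric `dt² + e^{2lt} dρ²`. -/
def planeMetric (l : ℝ) : MetricTensor 2 := fun u => Matrix.diagonal ![1, Real.exp (2 * l * u 0)]

lemma pullback_planeMap (α : ℝ) : pullback (warpMetric l Q) (planeMap α) =
    planeMetric l := by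
  ext u i j
  simp only [pullback, Matrix.of_apply, ContinuousLinearMap.fderiv, innerAt_warpMetric_planeMap,
    planeMetric]
  fin_cases i <;> fin_cases j <;> simp

lemma regularAt_planeMetric (l : ℝ) (u : Coord 2) :
    RegularAt (planeMetric l) u := by
  refine ⟨Eventually.of_forall fun p i j => ?_, Eventually.of_forall fun p => ?_⟩
  · fin_cases i <;> fin_cases j <;> simp [planeMetric] <;> fun_prop
  · refine Matrix.PosDef.diagonal fun i => ?_
    fin_cases i <;> simp [Real.exp_pos]

lemma innerAt_planeMetric (l : ℝ) (u v w : Coord 2) :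
    innerAt (planeMetric l) u v w =
      v 0 * w 0 + Real.exp (2 * l * u 0) * (v 1 * w 1) := by
  simp only [innerAt, planeMetric, Matrix.mulVec_diagonal, dotProduct, Fin.sum_univ_two, Matrix.cons_val_zero,
    Matrix.cons_val_one]
  ring

lemma hasFDerivAt_exp_coord_zero {n : ℕ} [NeZero n] (l : ℝ) (u : Coord n) :
    HasFDerivAt (fun q : Coord n => Real.exp (2 * l * q 0))
      (Real.exp (2 * l * u 0) • ((2 * l) • (ContinuousLinearMap.proj 0 : Coord n →L[ℝ] ℝ))) u :=
  ((hasFDerivAt_apply (𝕜 := ℝ) (F' := fun _ : Fin n => ℝ) 0 u).const_mul (2 * l)).exp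

lemma christoffelVec_planeMetric (l : ℝ) (u a b : Coord 2) :
    christoffelVec (planeMetric l) u a b =
      planeChristoffel l u a b := by
  have hg := regularAt_planeMetric l u
  have hd : ∀ v w z : Coord 2, fderiv ℝ (fun q => innerAt (planeMetric l) q w z) u v =
      2 * l * v 0 * Real.exp (2 * l * u 0) * (w 1 * z 1) := by
    intro v w z
    simp only [innerAt_planeMetric]
    rw [(((hasFDerivAt_exp_coord_zero l u).mul_const (w 1 * z 1)).const_add _).fderiv]
    simp only [_root_.smul_apply, ContinuousLinearMap.proj_apply, smul_eq_mul]
    ring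
  refine eq_of_innerAt_eq hg.posDef.self_of_nhds fun z => ?_
  rw [innerAt_christoffelVec hg]
  simp only [hd]
  simp only [innerAt_planeMetric, planeChristoffel, Matrix.cons_val_zero, Matrix.cons_val_one]
  ring

lemma hasConstantCurvature_planeMetric (l : ℝ) : HasConstantCurvature (planeMetric l) (-l ^ 2) := by
  intro u X Y
  have hd : ∀ X Y Z : Coord 2, fderiv ℝ (fun q => planeChristoffel l q Y Z) u X =
      ![-2 * l ^ 2 * X 0 * Real.exp (2 * l * u 0) * (Y 1 * Z 1), 0] := by
    intro X Y Z
    have h : HasFDerivAt (fun q => planeChristoffel l q Y Z) (ContinuousLinearMap.pi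
        ![(Y 1 * Z 1) • ((-l) • (Real.exp (2 * l * u 0) •
          ((2 * l) • (ContinuousLinearMap.proj 0 : Coord 2 →L[ℝ] ℝ)))), 0]) u := by
      refine hasFDerivAt_pi.2 fun i => ?_
      fin_cases i
      · exact ((hasFDerivAt_exp_coord_zero l u).const_mul (-l)).mul_const (Y 1 * Z 1)
      · exact hasFDerivAt_const _ _
    rw [h.fderiv]
    ext i
    fin_cases i
    · simp; ring
    · simp
  rw [curvature_eq (regularAt_planeMetric l u)]
  simp only [christoffelVec_planeMetric, hd, innerAt_planeMetric]
  simp only [planeChristoffel, Pi.add_apply, Pi.sub_apply, Matrix.cons_val_zero,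
    Matrix.cons_val_one]
  ring

lemma isPlaneOfCurvature_halfPlanePair (hQ : IsAdmissible Q) (l α : ℝ) :
    IsPlaneOfCurvature (warpMetric l Q) (-l ^ 2) (halfPlanePair α) := by
  refine ⟨planeMap α, (planeMap α).contDiff, ?_, fun u => ?_, ?_, fun u a b => ?_, ?_⟩
  · exact LinearMap.isClosedEmbedding_of_injective (f := (planeMap α : Coord 2 →ₗ[ℝ] Coord 3))
      (LinearMap.ker_eq_bot.2 (planeMap_injective α))
  · rw [ContinuousLinearMap.fderiv]
    exact planeMap_injective α
  · exact (halfPlanePair_eq_range α).symm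
  · simp only [ContinuousLinearMap.fderiv, christoffelVec_planeMap hQ]
    refine ⟨planeChristoffel l u a b, ?_⟩
    simp
  · rw [pullback_planeMap]
    exact hasConstantCurvature_planeMetric l

lemma exists_cyl (p : Coord 3) : ∃ t r α, 0 ≤ r ∧ α ∈ Ico 0 (2 * Real.pi) ∧ p = cyl t r α := by
  set z : ℂ := ⟨p 1, p 2⟩
  have h1 : ‖z‖ * Real.cos z.arg = p 1 := Complex.norm_mul_cos_arg z
  have h2 : ‖z‖ * Real.sin z.arg = p 2 := Complex.norm_mul_sin_arg z
  obtain ⟨β, hβ, k, hk⟩ : ∃ β ∈ Ico 0 (2 * Real.pi), ∃ k : ℤ, β = z.arg + k * (2 * Real.pi) := by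
    refine ⟨toIcoMod Real.two_pi_pos 0 z.arg, ?_, -toIcoDiv Real.two_pi_pos 0 z.arg, ?_⟩
    · simpa using toIcoMod_mem_Ico Real.two_pi_pos 0 z.arg
    · have := toIcoMod_add_toIcoDiv_zsmul Real.two_pi_pos 0 z.arg
      rw [zsmul_eq_mul] at this
      push_cast
      linarith
  refine ⟨p 0, ‖z‖, β, norm_nonneg _, hβ, ?_⟩
  ext i
  fin_cases i
  · rfl
  · simp [cyl, hk, Real.cos_add_int_mul_two_pi, h1]
  · simp [cyl, hk, Real.sin_add_int_mul_two_pi, h2]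

lemma sUnion_halfPlanePairs : ⋃₀ halfPlanePairs = univ := by
  refine eq_univ_of_forall fun p => ?_
  obtain ⟨t, r, α, hr, hα, rfl⟩ := exists_cyl p
  rcases lt_or_ge α Real.pi with h | h
  · exact ⟨_, ⟨α, ⟨hα.1, h⟩, rfl⟩, t, r, hr, Or.inl rfl⟩
  · refine ⟨_, ⟨α - Real.pi, ⟨by linarith, by linarith [hα.2]⟩, rfl⟩, t, r, hr, Or.inr ?_⟩
    rw [sub_add_cancel]

lemma isPlaneOfCurvature_of_mem (hQ : IsAdmissible Q) (l : ℝ) {S : Set (Coord 3)}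
    (hS : S ∈ halfPlanePairs) : IsPlaneOfCurvature (warpMetric l Q) (-l ^ 2) S := by
  obtain ⟨α, -, rfl⟩ := hS
  exact isPlaneOfCurvature_halfPlanePair hQ l α

lemma isPlaneCover_halfPlanePairs (hQ : IsAdmissible Q) (l : ℝ) :
    IsPlaneCover (warpMetric l Q) halfPlanePairs :=
  ⟨fun _ hS => ⟨-l ^ 2, by nlinarith [sq_nonneg l], isPlaneOfCurvature_of_mem hQ l hS⟩,
    sUnion_halfPlanePairs⟩

end Warp

/-! ### Distances from the origin and hulls -/

section WarpDistance

variable {l : ℝ} {Q : Coord 3 → ℝ}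

/-- Cauchy–Schwarz for the covector A dt + B r dr: its squared norm is A² + B² r² e^{-2lt}, whatever
Q is, and the hypothesis says that this is at most 1. -/
lemma IsAdmissible.abs_le_sqrt_innerAt (hQ : IsAdmissible Q) (p v : Coord 3) {A B : ℝ}
    (hAB : A ^ 2 * Real.exp (2 * l * p 0) + B ^ 2 * (p 1 ^ 2 + p 2 ^ 2) ≤
      Real.exp (2 * l * p 0)) :
    |A * v 0 + B * (p 1 * v 1 + p 2 * v 2)| ≤ √(innerAt (warpMetric l Q) p v v) := by
  refine Real.abs_le_sqrt ?_
  rw [innerAt_warpMetric]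
  have hle := hQ.sq_le p v
  set h := v 1 * v 1 + v 2 * v 2 + Q p * (p 1 * v 2 - p 2 * v 1) * (p 1 * v 2 - p 2 * v 1)
  set X := p 1 * v 1 + p 2 * v 2
  set E := Real.exp (2 * l * p 0)
  set R := p 1 ^ 2 + p 2 ^ 2
  have hE : 0 < E := Real.exp_pos _
  have hR : 0 ≤ R := by positivity
  have hh : 0 ≤ h := by
    by_cases hv : v 1 ≠ 0 ∨ v 2 ≠ 0
    · exact (hQ.horizontal_pos p v hv).le
    · push Not at hv
      simp [h, hv.1, hv.2]
  have h1 : B ^ 2 * X ^ 2 ≤ B ^ 2 * R * h := by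
    rw [mul_assoc]; gcongr
  have h2 : 2 * E * (A * v 0 * (B * X)) ≤ B ^ 2 * R * v 0 ^ 2 + A ^ 2 * E ^ 2 * h := by
    refine (le_abs_self _).trans (abs_le_of_sq_le_sq ?_ (by positivity))
    have h3 : (A * v 0 * E) ^ 2 * (B ^ 2 * X ^ 2) ≤ (A * v 0 * E) ^ 2 * (B ^ 2 * R * h) := by
      gcongr
    nlinarith [sq_nonneg (B ^ 2 * R * v 0 ^ 2 - A ^ 2 * E ^ 2 * h)]
  have h4 : E * (A * v 0 + B * X) ^ 2 ≤ E * (v 0 * v 0 + E * h) := by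
    have h5 : (A ^ 2 * E + B ^ 2 * R) * (v 0 ^ 2 + E * h) ≤ E * (v 0 ^ 2 + E * h) := by
      gcongr
    have h6 : E * (B ^ 2 * X ^ 2) ≤ E * (B ^ 2 * R * h) := by gcongr
    nlinarith
  exact le_of_mul_le_mul_left h4 hE

lemma rad_sq (p : Coord 3) : rad p ^ 2 = p 1 ^ 2 + p 2 ^ 2 := Real.sq_sqrt (by positivity)

lemma riemDist_zero_warpMetric_zero (hQ : IsAdmissible Q) (p : Coord 3) :
    riemDist (warpMetric 0 Q) 0 p = ENNReal.ofReal √(p 0 ^ 2 + rad p ^ 2) := by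
  rw [rad_sq]
  refine le_antisymm ?_ ?_
  -- The straight segment from the origin has velocity parallel to its position, so the Q term
  -- vanishes along it.
  · have hd : ∀ s : ℝ, HasDerivAt (fun s : ℝ => s • p) p s := fun s => by
      simpa using (hasDerivAt_id s).smul_const p
    have := riemDist_le_of_curve (g := warpMetric 0 Q) (γ := fun s : ℝ => s • p) zero_le_one
      (L := √(p 0 ^ 2 + (p 1 ^ 2 + p 2 ^ 2))) (by positivity) (by fun_prop) fun s hs => by
        rw [(hd s).deriv, innerAt_warpMetric, Real.sq_sqrt (by positivity)]
        simp only [Pi.smul_apply, smul_eq_mul, mul_zero, zero_mul, Real.exp_zero]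
        exact le_of_eq (by ring)
    simpa using this
  -- The distance function is not smooth at the origin; √(δ + t² + r²) is, has differential of norm
  -- at most 1, and recovers it as δ → 0.
  · have key : ∀ δ > 0, ENNReal.ofReal |√(δ + (p 0 ^ 2 + (p 1 ^ 2 + p 2 ^ 2))) - √δ| ≤
        riemDist (warpMetric 0 Q) 0 p := by
      intro δ hδ
      have hpos : ∀ q : Coord 3, 0 < δ + (q 0 ^ 2 + (q 1 ^ 2 + q 2 ^ 2)) := fun q => by positivity
      have hu : ContDiff ℝ 1 fun q : Coord 3 => √(δ + (q 0 ^ 2 + (q 1 ^ 2 + q 2 ^ 2))) :=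
        ContDiff.sqrt (by fun_prop) fun q => (hpos q).ne'
      have := ofReal_abs_sub_le_riemDist (g := warpMetric 0 Q) hu (fun q v => ?_) 0 p
      · simpa using this
      have hc : ∀ i, HasFDerivAt (fun q : Coord 3 => q i) (ContinuousLinearMap.proj i) q :=
        fun i => hasFDerivAt_apply (𝕜 := ℝ) (F' := fun _ : Fin 3 => ℝ) i q
      have hd := ((((hc 0).pow 2).add (((hc 1).pow 2).add ((hc 2).pow 2))).const_add δ).sqrt
        (hpos q).ne'
      have e : fderiv ℝ (fun q : Coord 3 => √(δ + (q 0 ^ 2 + (q 1 ^ 2 + q 2 ^ 2)))) q v =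
          q 0 / √(δ + (q 0 ^ 2 + (q 1 ^ 2 + q 2 ^ 2))) * v 0 +
          1 / √(δ + (q 0 ^ 2 + (q 1 ^ 2 + q 2 ^ 2))) * (q 1 * v 1 + q 2 * v 2) := by
        refine (DFunLike.congr_fun hd.fderiv v).trans ?_
        simp
        field_simp
      rw [e]
      refine hQ.abs_le_sqrt_innerAt q v ?_
      rw [div_pow, div_pow, Real.sq_sqrt (hpos q).le]
      simp only [mul_zero, zero_mul, Real.exp_zero, mul_one]
      rw [one_pow, div_mul_eq_mul_div, one_mul, ← add_div, div_le_one (hpos q)]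
      linarith
    have hlim : Tendsto (fun δ : ℝ => ENNReal.ofReal
        |√(δ + (p 0 ^ 2 + (p 1 ^ 2 + p 2 ^ 2))) - √δ|) (𝓝[>] 0)
        (𝓝 (ENNReal.ofReal √(p 0 ^ 2 + (p 1 ^ 2 + p 2 ^ 2)))) := by
      have hc : Continuous fun δ : ℝ => ENNReal.ofReal
          |√(δ + (p 0 ^ 2 + (p 1 ^ 2 + p 2 ^ 2))) - √δ| :=
        ENNReal.continuous_ofReal.comp (by fun_prop)
      have := (hc.tendsto 0).mono_left (nhdsWithin_le_nhds (s := Ioi 0))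
      simpa [abs_of_nonneg (Real.sqrt_nonneg _)] using this
    exact le_of_tendsto hlim (eventually_mem_nhdsWithin.mono key)

/-- The hyperbolic cosine of the hyperbolic distance from the origin. -/
def coshDist (p : Coord 3) : ℝ :=
  Real.cosh (p 0) + Real.exp (p 0) * (p 1 ^ 2 + p 2 ^ 2) / 2

lemma one_le_coshDist (p : Coord 3) : 1 ≤ coshDist p := by
  have := Real.one_le_cosh (p 0)
  have : 0 ≤ Real.exp (p 0) * (p 1 ^ 2 + p 2 ^ 2) / 2 := by positivity
  unfold coshDist
  linarith

/-- The right side is the squared norm of the differential of `coshDist` for l = 1, so this is the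
equation |∇ cosh d|² = sinh² d of the hyperbolic distance d. -/
lemma coshDist_sq_sub_one (p : Coord 3) : coshDist p ^ 2 - 1 =
    (Real.sinh (p 0) + Real.exp (p 0) * (p 1 ^ 2 + p 2 ^ 2) / 2) ^ 2 + (p 1 ^ 2 + p 2 ^ 2) := by
  have h1 := Real.cosh_sq (p 0)
  have h2 := Real.cosh_sub_sinh (p 0)
  have h3 : Real.exp (p 0) * Real.exp (-p 0) = 1 := by rw [← Real.exp_add]; simp
  unfold coshDist
  linear_combination h1 + Real.exp (p 0) * (p 1 ^ 2 + p 2 ^ 2) * h2 + (p 1 ^ 2 + p 2 ^ 2) * h3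

/-- The calibrating function is arcosh c = log(c + √(c² - 1)), made smooth by adding δ under the
root. With c = `coshDist` its differential is dc/√(c² - 1 + δ), of squared norm (c² - 1)/(c² - 1 +
δ) ≤ 1. -/
lemma arcosh_coshDist_le_riemDist (hQ : IsAdmissible Q) (p : Coord 3) :
    ENNReal.ofReal (Real.arcosh (coshDist p)) ≤ riemDist (warpMetric 1 Q) 0 p := by
  have key : ∀ δ > 0, ENNReal.ofReal |Real.log (coshDist p + √(coshDist p ^ 2 - 1 + δ))
      - Real.log (1 + √δ)| ≤ riemDist (warpMetric 1 Q) 0 p := by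
    intro δ hδ
    have hpos : ∀ q, 0 < coshDist q ^ 2 - 1 + δ := fun q => by
      have := one_le_coshDist q
      nlinarith
    have hpos' : ∀ q, 0 < coshDist q + √(coshDist q ^ 2 - 1 + δ) := fun q => by
      have := one_le_coshDist q
      positivity
    have hcd : ContDiff ℝ 1 coshDist := by
      unfold coshDist
      fun_prop
    have hu : ContDiff ℝ 1 fun q => Real.log (coshDist q + √(coshDist q ^ 2 - 1 + δ)) :=
      (hcd.add (ContDiff.sqrt (by fun_prop) fun q => (hpos q).ne')).log fun q => (hpos' q).ne'
    have := ofReal_abs_sub_le_riemDist (g := warpMetric 1 Q) hu (fun q v => ?_) 0 p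
    · simpa [coshDist] using this
    have hc : ∀ i, HasFDerivAt (fun q : Coord 3 => q i) (ContinuousLinearMap.proj i) q :=
      fun i => hasFDerivAt_apply (𝕜 := ℝ) (F' := fun _ : Fin 3 => ℝ) i q
    have hcosh : HasFDerivAt coshDist _ q :=
      (hc 0).cosh.add (((hc 0).exp.mul (((hc 1).pow 2).add ((hc 2).pow 2))).mul_const (1 / 2 : ℝ))
        |>.congr_of_eventuallyEq (Eventually.of_forall fun x => by
          simp only [coshDist, Pi.add_apply, Pi.mul_apply]; ring)
    have hd := (hcosh.add (((hcosh.pow 2).sub_const 1).add_const δ |>.sqrt (hpos q).ne')).log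
      (hpos' q).ne'
    have e : fderiv ℝ (fun q => Real.log (coshDist q + √(coshDist q ^ 2 - 1 + δ))) q v =
        (Real.sinh (q 0) + Real.exp (q 0) * (q 1 ^ 2 + q 2 ^ 2) / 2) /
          √(coshDist q ^ 2 - 1 + δ) * v 0 +
        Real.exp (q 0) / √(coshDist q ^ 2 - 1 + δ) * (q 1 * v 1 + q 2 * v 2) := by
      refine (DFunLike.congr_fun hd.fderiv v).trans ?_
      have h1 := (hpos' q).ne'
      have h2 := (Real.sqrt_pos.2 (hpos q)).ne'
      simp
      field_simp
      ring
    rw [e]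
    refine hQ.abs_le_sqrt_innerAt q v ?_
    have hexp : Real.exp (2 * 1 * q 0) = Real.exp (q 0) ^ 2 := by
      rw [← Real.exp_nat_mul]; simp
    rw [div_pow, div_pow, Real.sq_sqrt (hpos q).le, hexp, div_mul_eq_mul_div, div_mul_eq_mul_div,
      ← add_div, div_le_iff₀ (hpos q), mul_comm (Real.exp (q 0) ^ 2), ← add_mul,
      ← coshDist_sq_sub_one, mul_comm]
    gcongr
    linarith
  have hlim : Tendsto (fun δ : ℝ => ENNReal.ofReal
      |Real.log (coshDist p + √(coshDist p ^ 2 - 1 + δ)) - Real.log (1 + √δ)|) (𝓝[>] 0)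
      (𝓝 (ENNReal.ofReal (Real.arcosh (coshDist p)))) := by
    have h1 := one_le_coshDist p
    have hc : ContinuousAt (fun δ : ℝ => ENNReal.ofReal
        |Real.log (coshDist p + √(coshDist p ^ 2 - 1 + δ)) - Real.log (1 + √δ)|) 0 := by
      refine ENNReal.continuous_ofReal.continuousAt.comp (ContinuousAt.abs (ContinuousAt.sub
        (ContinuousAt.log (by fun_prop) ?_) (ContinuousAt.log (by fun_prop) ?_))) <;> positivity
    have := hc.tendsto.mono_left (nhdsWithin_le_nhds (s := Ioi 0))
    have hnn := Real.arcosh_nonneg h1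
    rw [Real.arcosh] at hnn ⊢
    simpa [abs_of_nonneg hnn] using this
  exact le_of_tendsto hlim (eventually_mem_nhdsWithin.mono key)

/-- The unit speed hyperbolic geodesic from the origin with initial direction k is e^t = cosh s + k₀
sinh s, (x, y) = (k₁, k₂) sinh s / e^t. It stays in one E_α, so the Q term does not contribute to
its length. -/
lemma riemDist_le_arcosh_coshDist (p : Coord 3) :
    riemDist (warpMetric 1 Q) 0 p ≤ ENNReal.ofReal (Real.arcosh (coshDist p)) := by
  set d := Real.arcosh (coshDist p)
  have hcosh : Real.cosh d = coshDist p := Real.cosh_arcosh (one_le_coshDist p)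
  have hd0 : 0 ≤ d := Real.arcosh_nonneg (one_le_coshDist p)
  have hsq := coshDist_sq_sub_one p
  -- For d = 0 the point is the origin; this case is separate because k involves division by sinh d.
  rcases hd0.eq_or_lt with h0 | hd
  · rw [← h0, Real.cosh_zero] at hcosh
    rw [← hcosh] at hsq
    have h1 : p 1 = 0 := by
      nlinarith [sq_nonneg (Real.sinh (p 0) + Real.exp (p 0) * (p 1 ^ 2 + p 2 ^ 2) / 2),
        sq_nonneg (p 1), sq_nonneg (p 2)]
    have h2 : p 2 = 0 := by
      nlinarith [sq_nonneg (Real.sinh (p 0) + Real.exp (p 0) * (p 1 ^ 2 + p 2 ^ 2) / 2),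
        sq_nonneg (p 1), sq_nonneg (p 2)]
    have h3 : p 0 = 0 := Real.sinh_eq_zero.1 (pow_eq_zero_iff two_ne_zero |>.1
      (by simpa [h1, h2] using hsq.symm))
    have : p = 0 := by ext i; fin_cases i <;> simp [h1, h2, h3]
    rw [this, riemDist_self]
    exact zero_le
  set S := Real.sinh d
  have hS : 0 < S := Real.sinh_pos_iff.2 hd
  have hS2 : S ^ 2 = coshDist p ^ 2 - 1 := by rw [← hcosh, Real.cosh_sq]; ring
  -- The direction is found by solving γ(d) = p, using cosh d = `coshDist p`; in particular k₀ =
  -- (e^t - cosh d)/sinh d at p.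
  set k : Coord 3 := ![(Real.sinh (p 0) - Real.exp (p 0) * (p 1 ^ 2 + p 2 ^ 2) / 2) / S,
    Real.exp (p 0) * p 1 / S, Real.exp (p 0) * p 2 / S]
  have hexp : Real.exp (p 0) = Real.cosh (p 0) + Real.sinh (p 0) := (Real.cosh_add_sinh _).symm
  have hk : k 0 ^ 2 + k 1 ^ 2 + k 2 ^ 2 = 1 := by
    have : k 0 ^ 2 + k 1 ^ 2 + k 2 ^ 2 = ((Real.sinh (p 0) - Real.exp (p 0) *
        (p 1 ^ 2 + p 2 ^ 2) / 2) ^ 2 + Real.exp (p 0) ^ 2 * (p 1 ^ 2 + p 2 ^ 2)) / S ^ 2 := by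
      simp only [k, Matrix.cons_val]
      field_simp
      ring
    rw [this, div_eq_one_iff_eq (by positivity), hS2, coshDist]
    linear_combination -Real.cosh_sq (p 0) +
      (p 1 ^ 2 + p 2 ^ 2) * Real.exp (p 0) * hexp
  have hk0 : |k 0| ≤ 1 := by
    rw [← sq_le_one_iff_abs_le_one]
    nlinarith [sq_nonneg (k 1), sq_nonneg (k 2)]
  set D : ℝ → ℝ := fun s => Real.cosh s + k 0 * Real.sinh s
  have hD : ∀ s, 0 < D s := fun s => by
    have h1 : |k 0 * Real.sinh s| ≤ |Real.sinh s| := by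
      rw [abs_mul]; exact mul_le_of_le_one_left (abs_nonneg _) hk0
    have h2 : |Real.sinh s| < Real.cosh s :=
      abs_lt_of_sq_lt_sq (by rw [Real.cosh_sq]; linarith) (Real.cosh_pos s).le
    have := neg_abs_le (k 0 * Real.sinh s)
    simp only [D]
    linarith
  have hDd : ∀ s, HasDerivAt D (Real.sinh s + k 0 * Real.cosh s) s := fun s =>
    (Real.hasDerivAt_cosh s).add ((Real.hasDerivAt_sinh s).const_mul (k 0))
  set γ : ℝ → Coord 3 := fun s =>
    ![Real.log (D s), k 1 * Real.sinh s / D s, k 2 * Real.sinh s / D s]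
  have hγd : ∀ s, HasDerivAt γ
      ![(Real.sinh s + k 0 * Real.cosh s) / D s, k 1 / D s ^ 2, k 2 / D s ^ 2] s := by
    intro s
    have hk' : ∀ c : ℝ, HasDerivAt (fun s => c * Real.sinh s / D s) (c / D s ^ 2) s := by
      intro c
      refine (((Real.hasDerivAt_sinh s).const_mul c).div (hDd s) (hD s).ne').congr_deriv ?_
      congr 1
      linear_combination c * Real.cosh_sq s
    refine hasDerivAt_pi.2 fun i => ?_
    fin_cases i
    · exact (hDd s).log (hD s).ne'
    · exact hk' _
    · exact hk' _
  have hDc : ContDiff ℝ 1 D := by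
    simp only [D]
    have := Real.contDiff_cosh (n := 1)
    have := Real.contDiff_sinh (n := 1)
    fun_prop
  have hγ : ContDiff ℝ 1 γ := by
    have hk' : ∀ c : ℝ, ContDiff ℝ 1 fun s => c * Real.sinh s / D s := fun c =>
      (contDiff_const.mul Real.contDiff_sinh).div hDc fun s => (hD s).ne'
    refine contDiff_pi.2 fun i => ?_
    fin_cases i
    · exact hDc.log fun s => (hD s).ne'
    · exact hk' _
    · exact hk' _
  have h := riemDist_le_of_curve (g := warpMetric 1 Q) hd0 zero_le_one hγ fun s hs => by
    rw [(hγd s).deriv, innerAt_warpMetric]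
    have hexp : Real.exp (2 * 1 * γ s 0) = D s ^ 2 := by
      simp only [γ, Matrix.cons_val_zero]
      rw [mul_one, mul_comm, Real.exp_mul, Real.exp_log (hD s), Real.rpow_two]
    have hne := (hD s).ne'
    rw [hexp]
    simp only [γ, Matrix.cons_val]
    refine le_of_eq ?_
    have h1 : (Real.sinh s + k 0 * Real.cosh s) ^ 2 + (k 1 ^ 2 + k 2 ^ 2) = D s ^ 2 := by
      simp only [D]
      linear_combination hk + (k 0 ^ 2 - 1) * Real.cosh_sq s
    generalize D s = e at h1 hne ⊢
    field_simp
    linear_combination e ^ 2 * h1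
  have hγ0 : γ 0 = 0 := by
    ext i
    fin_cases i <;> simp [γ, D]
  have hγ1 : γ d = p := by
    have hDS : D d = Real.exp (p 0) := by
      simp only [D, k, Matrix.cons_val_zero]
      change Real.cosh d + _ / S * S = _
      rw [div_mul_cancel₀ _ hS.ne', hcosh, coshDist, hexp]
      ring
    have hne := hS.ne'
    have hne' := (Real.exp_pos (p 0)).ne'
    ext i
    fin_cases i
    · simp [γ, hDS]
    · change k 1 * S / D d = p 1
      rw [hDS]
      simp only [k, Matrix.cons_val]
      field_simp
    · change k 2 * S / D d = p 2
      rw [hDS]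
      simp only [k, Matrix.cons_val]
      field_simp
  rw [hγ0, hγ1] at h
  simpa using h

lemma riemDist_zero_warpMetric_one (hQ : IsAdmissible Q) (p : Coord 3) :
    riemDist (warpMetric 1 Q) 0 p = ENNReal.ofReal (Real.arcosh (coshDist p)) :=
  le_antisymm (riemDist_le_arcosh_coshDist p) (arcosh_coshDist_le_riemDist hQ p)

end WarpDistance

/-! ### Convexity of balls in the planes, hulls, and completeness. -/

section Hull

variable {l : ℝ} {Q : Coord 3 → ℝ}

/-- The geodesic equation for geodesics inside `E_α`, in the coordinates of that plane. -/
lemma IsGeodesic.exists_plane_coordinates (hQ : IsAdmissible Q) {γ : ℝ → Coord 3} {α a b : ℝ}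
    (hγ : IsGeodesic (warpMetric l Q) γ) (hS : ∀ s ∈ Icc a b, γ s ∈ halfPlanePair α) :
    ∃ η : ℝ → Coord 2, ContDiff ℝ ∞ η ∧ (∀ s ∈ Icc a b, γ s = planeMap α (η s)) ∧
      ∀ s ∈ Ioo a b, deriv (deriv η) s = -planeChristoffel l (η s) (deriv η s) (deriv η s) := by
  let L : Coord 3 →L[ℝ] Coord 2 := ContinuousLinearMap.pi ![ContinuousLinearMap.proj 0,
    Real.cos α • ContinuousLinearMap.proj 1 + Real.sin α • ContinuousLinearMap.proj 2]
  have hL : ∀ u, L (planeMap α u) = u := by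
    intro u
    ext i
    fin_cases i
    · rfl
    · change Real.cos α * (Real.cos α * u 1) + Real.sin α * (Real.sin α * u 1) = u 1
      linear_combination u 1 * Real.cos_sq_add_sin_sq α
  have hη : ContDiff ℝ ∞ (fun s => L (γ s)) := L.contDiff.comp hγ.1
  have hη' : ContDiff ℝ ∞ (deriv fun s => L (γ s)) := (contDiff_infty_iff_deriv.1 hη).2
  have heq : ∀ s ∈ Icc a b, γ s = planeMap α (L (γ s)) := by
    intro s hs
    have := hS s hs
    rw [halfPlanePair_eq_range] at this
    obtain ⟨u, hu⟩ := this
    rw [← hu, hL]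
  refine ⟨fun s => L (γ s), hη, heq, fun s hs => ?_⟩
  -- Derivatives are compared on the open interval only, since γ need not stay in E_α outside [a,
  -- b].
  have hd1 : ∀ s ∈ Ioo a b, deriv γ s = planeMap α (deriv (fun s => L (γ s)) s) := by
    intro s hs
    have h1 : γ =ᶠ[𝓝 s] fun s => planeMap α (L (γ s)) := by
      filter_upwards [Icc_mem_nhds hs.1 hs.2] with r hr using heq r hr
    rw [h1.deriv_eq]
    exact ((planeMap α).hasFDerivAt.comp_hasDerivAt s
      (hη.differentiable (by simp) s).hasDerivAt).deriv
  have hd2 : deriv (deriv γ) s = planeMap α (deriv (deriv fun s => L (γ s)) s) := by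
    have h1 : deriv γ =ᶠ[𝓝 s] fun s => planeMap α (deriv (fun s => L (γ s)) s) := by
      filter_upwards [isOpen_Ioo.mem_nhds hs] with r hr using hd1 r hr
    rw [h1.deriv_eq]
    exact ((planeMap α).hasFDerivAt.comp_hasDerivAt s
      (hη'.differentiable (by simp) s).hasDerivAt).deriv
  have h := hγ.2 s
  rw [covDeriv, hd2, hd1 s hs, heq s ⟨hs.1.le, hs.2.le⟩, christoffelVec_planeMap hQ,
    ← map_add] at h
  have h0 := planeMap_injective α (h.trans (map_zero _).symm)
  exact eq_neg_of_add_eq_zero_left h0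

lemma le_of_convexity {c : ℝ → ℝ} {c' c'' : ℝ → ℝ} {a b m : ℝ}
    (hc : ∀ s, HasDerivAt c (c' s) s) (hc' : ∀ s, HasDerivAt c' (c'' s) s)
    (h : ∀ s ∈ Ioo a b, 0 ≤ c'' s) (ha : c a ≤ m) (hb : c b ≤ m) : ∀ s ∈ Icc a b, c s ≤ m := by
  have hconv : ConvexOn ℝ (Icc a b) c := by
    refine convexOn_of_deriv2_nonneg (convex_Icc a b)
      (fun s _ => (hc s).continuousAt.continuousWithinAt)
      (fun s _ => (hc s).differentiableAt.differentiableWithinAt) ?_ ?_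
    · rw [show deriv c = c' from funext fun s => (hc s).deriv]
      exact fun s _ => (hc' s).differentiableAt.differentiableWithinAt
    · intro s hs
      rw [interior_Icc] at hs
      have : deriv^[2] c s = c'' s := by
        simp only [Function.iterate_succ, Function.iterate_zero, Function.comp_apply, id]
        rw [show deriv c = c' from funext fun s => (hc s).deriv, (hc' s).deriv]
      rw [this]
      exact h s hs
  intro s hs
  have hab := hs.1.trans hs.2
  exact (hconv.le_max_of_mem_Icc (left_mem_Icc.2 hab) (right_mem_Icc.2 hab) hs).trans
    (max_le ha hb)

/-- Sublevel sets of `c` are convex in the planes `E_α`. -/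
def HasConvexSublevels (g : MetricTensor 3) (c : Coord 3 → ℝ) : Prop :=
  ∀ (γ : ℝ → Coord 3) (α a b m : ℝ), IsGeodesic g γ → (∀ s ∈ Icc a b, γ s ∈ halfPlanePair α) →
    a ≤ b → c (γ a) ≤ m → c (γ b) ≤ m → ∀ s ∈ Icc a b, c (γ s) ≤ m

/-- Any point lies in some E_α, where the sublevel set of c through a farthest point k of K is
convex and contains K ∩ E_α, hence contains the hull taken there. Here c is a convenient increasing
function of the distance. -/
lemma hullInBall_of_convexSublevels {g : MetricTensor 3} (hg : IsRiemannianMetric g)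
    {c : Coord 3 → ℝ} (hc : HasConvexSublevels g c)
    (hmono : ∀ p q, riemDist g 0 p ≤ riemDist g 0 q ↔ c p ≤ c q) : HullInBall g := by
  intro K hK hne
  obtain ⟨k, hk, hmax⟩ := hK.exists_isMaxOn hne (hg.continuous_riemDist 0).continuousOn
  have hcoe : ((riemDist g 0 k).toNNReal : ℝ≥0∞) = riemDist g 0 k :=
    ENNReal.coe_toNNReal (hg.riemDist_ne_top 0 k)
  refine ⟨(riemDist g 0 k).toNNReal, ⟨⟨k, hk, hcoe.symm⟩, ?_⟩, fun x hx => ?_⟩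
  · rintro _ ⟨q, hq, rfl⟩
    rw [hcoe]
    exact hmax hq
  · obtain ⟨S, hS, hxS⟩ : x ∈ ⋃₀ halfPlanePairs := by
      rw [sUnion_halfPlanePairs]; trivial
    obtain ⟨α, -, rfl⟩ := id hS
    have hmem : x ∈ halfPlanePair α ∩ {y | c y ≤ c k} := by
      refine mem_sInter.1 (hx _ hS hxS) _ ⟨⟨inter_subset_left, ?_⟩, ?_⟩
      · intro γ a b hγ hab hin ha hb s hs
        exact ⟨hin s hs, hc γ α a b _ hγ hin hab ha.2 hb.2 s hs⟩
      · rintro y ⟨hyK, hyS⟩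
        exact ⟨hyS, (hmono y k).1 (hmax hyK)⟩
    change riemDist g 0 x ≤ _
    rw [hcoe]
    exact (hmono x k).2 hmem.2

lemma hasConvexSublevels_zero (hQ : IsAdmissible Q) :
    HasConvexSublevels (warpMetric 0 Q) fun p => p 0 ^ 2 + (p 1 ^ 2 + p 2 ^ 2) := by
  intro γ α a b m hγ hS hab ha hb
  obtain ⟨η, hη, heq, hode⟩ := hγ.exists_plane_coordinates hQ hS
  have hc : ∀ s ∈ Icc a b, γ s 0 ^ 2 + (γ s 1 ^ 2 + γ s 2 ^ 2) = η s 0 ^ 2 + η s 1 ^ 2 := by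
    intro s hs
    rw [heq s hs]
    simp only [planeMap_zero, planeMap_one, planeMap_two]
    linear_combination η s 1 ^ 2 * Real.cos_sq_add_sin_sq α
  have h1 : ∀ i s, HasDerivAt (fun s => η s i) (deriv η s i) s := fun i s =>
    hasDerivAt_pi.1 (hη.differentiable (by simp) s).hasDerivAt i
  have h2 : ∀ i s, HasDerivAt (fun s => deriv η s i) (deriv (deriv η) s i) s := fun i s =>
    hasDerivAt_pi.1 ((contDiff_infty_iff_deriv.1 hη).2.differentiable (by simp) s).hasDerivAt i
  have key := le_of_convexity (a := a) (b := b) (m := m)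
    (fun s => ((h1 0 s).pow 2).add ((h1 1 s).pow 2))
    (fun s => (((((h1 0 s).pow 1).const_mul (2 : ℝ)).mul (h2 0 s)).add
      ((((h1 1 s).pow 1).const_mul (2 : ℝ)).mul (h2 1 s))).congr_of_eventuallyEq
        (Eventually.of_forall fun s => by simp))
    (fun s hs => ?_) ?_ ?_
  · intro s hs
    exact (hc s hs).le.trans (key s hs)
  -- In the flat plane η'' = 0, and the second derivative is 2 |η'|².
  · rw [hode s hs]
    simp [planeChristoffel]
    nlinarith [mul_self_nonneg (deriv η s 0), mul_self_nonneg (deriv η s 1)]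
  · exact (hc a ⟨le_rfl, hab⟩).ge.trans ha
  · exact (hc b ⟨hab, le_rfl⟩).ge.trans hb

lemma hasConvexSublevels_one (hQ : IsAdmissible Q) :
    HasConvexSublevels (warpMetric 1 Q) coshDist := by
  intro γ α a b m hγ hS hab ha hb
  obtain ⟨η, hη, heq, hode⟩ := hγ.exists_plane_coordinates hQ hS
  have hc : ∀ s ∈ Icc a b, coshDist (γ s) =
      Real.cosh (η s 0) + Real.exp (η s 0) * η s 1 ^ 2 / 2 := by
    intro s hs
    rw [heq s hs, coshDist]
    simp only [planeMap_zero, planeMap_one, planeMap_two]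
    linear_combination Real.exp (η s 0) / 2 * η s 1 ^ 2 * Real.cos_sq_add_sin_sq α
  have h1 : ∀ i s, HasDerivAt (fun s => η s i) (deriv η s i) s := fun i s =>
    hasDerivAt_pi.1 (hη.differentiable (by simp) s).hasDerivAt i
  have h2 : ∀ i s, HasDerivAt (fun s => deriv η s i) (deriv (deriv η) s i) s := fun i s =>
    hasDerivAt_pi.1 ((contDiff_infty_iff_deriv.1 hη).2.differentiable (by simp) s).hasDerivAt i
  have key := le_of_convexity (a := a) (b := b) (m := m)
    (c := fun s => Real.cosh (η s 0) + Real.exp (η s 0) * η s 1 ^ 2 / 2)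
    (c' := fun s => (Real.sinh (η s 0) + Real.exp (η s 0) * η s 1 ^ 2 / 2) * deriv η s 0
      + Real.exp (η s 0) * η s 1 * deriv η s 1)
    (c'' := fun s => (Real.cosh (η s 0) * deriv η s 0 + (Real.exp (η s 0) * deriv η s 0 *
      η s 1 ^ 2 + Real.exp (η s 0) * (2 * η s 1 * deriv η s 1)) / 2) * deriv η s 0
      + (Real.sinh (η s 0) + Real.exp (η s 0) * η s 1 ^ 2 / 2) * deriv (deriv η) s 0
      + ((Real.exp (η s 0) * deriv η s 0 * η s 1 + Real.exp (η s 0) * deriv η s 1) * deriv η s 1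
        + Real.exp (η s 0) * η s 1 * deriv (deriv η) s 1))
    (fun s => ?_) (fun s => ?_) (fun s hs => ?_) ?_ ?_
  · intro s hs
    rw [hc s hs]
    exact key s hs
  · refine ((h1 0 s).cosh.add (((h1 0 s).exp.mul ((h1 1 s).pow 2)).div_const 2)).congr_deriv ?_
    simp
    ring
  · have hA := ((h1 0 s).sinh.add (((h1 0 s).exp.mul ((h1 1 s).pow 2)).div_const 2)).mul (h2 0 s)
    have hB := ((h1 0 s).exp.mul (h1 1 s)).mul (h2 1 s)
    refine (hA.add hB).congr_deriv ?_
    simp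
  · rw [hode s hs]
    have hexp : Real.exp (2 * η s 0) = Real.exp (η s 0) ^ 2 := by
      rw [← Real.exp_nat_mul]; simp
    have h0 : Real.exp (η s 0) * (Real.cosh (η s 0) - Real.sinh (η s 0)) = 1 := by
      rw [Real.cosh_sub_sinh, ← Real.exp_add]; simp
    -- The Hessian of cosh d in the hyperbolic plane is cosh d times the metric, so the second
    -- derivative is cosh d times the squared speed.
    have hpos : 0 ≤ (Real.cosh (η s 0) + Real.exp (η s 0) * η s 1 ^ 2 / 2) *
        (deriv η s 0 ^ 2 + Real.exp (η s 0) ^ 2 * deriv η s 1 ^ 2) := by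
      have := Real.cosh_pos (η s 0)
      positivity
    refine hpos.trans_eq ?_
    simp only [planeChristoffel, Pi.neg_apply, Matrix.cons_val_zero, Matrix.cons_val_one, mul_one,
      hexp]
    linear_combination Real.exp (η s 0) * deriv η s 1 ^ 2 * h0
  · simpa only [← hc a ⟨le_rfl, hab⟩] using ha
  · simpa only [← hc b ⟨hab, le_rfl⟩] using hb

lemma hullInBall_warpMetric_zero (hQ : IsAdmissible Q) : HullInBall (warpMetric 0 Q) := by
  refine hullInBall_of_convexSublevels (hQ.isRiemannianMetric 0) (hasConvexSublevels_zero hQ)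
    fun p q => ?_
  rw [riemDist_zero_warpMetric_zero hQ, riemDist_zero_warpMetric_zero hQ, rad_sq, rad_sq,
    ENNReal.ofReal_le_ofReal_iff (Real.sqrt_nonneg _), Real.sqrt_le_sqrt_iff (by positivity)]

lemma hullInBall_warpMetric_one (hQ : IsAdmissible Q) : HullInBall (warpMetric 1 Q) := by
  refine hullInBall_of_convexSublevels (hQ.isRiemannianMetric 1) (hasConvexSublevels_one hQ)
    fun p q => ?_
  rw [riemDist_zero_warpMetric_one hQ, riemDist_zero_warpMetric_one hQ,
    ENNReal.ofReal_le_ofReal_iff (Real.arcosh_nonneg (one_le_coshDist _)),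
    Real.arcosh_le_arcosh (zero_lt_one.trans_le (one_le_coshDist _))
      (zero_lt_one.trans_le (one_le_coshDist _))]

lemma isCompleteMetric_warpMetric_zero (hQ : IsAdmissible Q) :
    IsCompleteMetric (warpMetric 0 Q) := by
  refine (hQ.isRiemannianMetric 0).isCompleteMetric fun D => ?_
  refine (Metric.isBounded_closedBall (x := (0 : Coord 3)) (r := D)).subset fun x hx => ?_
  rw [mem_ofPred_eq, riemDist_zero_warpMetric_zero hQ, rad_sq, ENNReal.ofReal_le_coe,
    Real.sqrt_le_left D.coe_nonneg] at hx
  rw [mem_closedBall_zero_iff, pi_norm_le_iff_of_nonneg D.coe_nonneg]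
  intro i
  refine abs_le_of_sq_le_sq ?_ D.coe_nonneg
  fin_cases i <;> simp only [Fin.zero_eta, Fin.mk_one, Fin.reduceFinMk] <;>
    nlinarith [sq_nonneg (x 0), sq_nonneg (x 1), sq_nonneg (x 2)]

lemma isCompleteMetric_warpMetric_one (hQ : IsAdmissible Q) :
    IsCompleteMetric (warpMetric 1 Q) := by
  refine (hQ.isRiemannianMetric 1).isCompleteMetric fun D => ?_
  set C := Real.cosh D
  have hC : 1 ≤ C := Real.one_le_cosh D
  refine (Metric.isBounded_closedBall (x := (0 : Coord 3)) (r := D + 2 * C)).subset fun x hx => ?_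
  rw [mem_ofPred_eq, riemDist_zero_warpMetric_one hQ, ENNReal.ofReal_le_coe] at hx
  have hx1 : coshDist x ≤ C := by
    rw [← Real.cosh_arcosh (one_le_coshDist x)]
    exact Real.cosh_le_cosh.2 (by
      rwa [abs_of_nonneg (Real.arcosh_nonneg (one_le_coshDist x)), abs_of_nonneg D.coe_nonneg])
  have hr : 0 ≤ Real.exp (x 0) * (x 1 ^ 2 + x 2 ^ 2) / 2 := by positivity
  have h0 : |x 0| ≤ D := by
    have : Real.cosh (x 0) ≤ Real.cosh D := by
      unfold coshDist at hx1
      linarith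
    rw [Real.cosh_le_cosh] at this
    rwa [abs_of_nonneg D.coe_nonneg] at this
  have hcosh := Real.cosh_pos (x 0)
  have h1 : x 1 ^ 2 + x 2 ^ 2 ≤ (2 * C) ^ 2 := by
    have h2 : Real.exp (x 0) * (x 1 ^ 2 + x 2 ^ 2) ≤ 2 * C := by
      unfold coshDist at hx1
      linarith
    have h3 : Real.exp (-x 0) ≤ 2 * C := by
      have := Real.cosh_eq (x 0)
      have := Real.exp_pos (x 0)
      unfold coshDist at hx1
      linarith
    calc x 1 ^ 2 + x 2 ^ 2 = Real.exp (-x 0) * (Real.exp (x 0) * (x 1 ^ 2 + x 2 ^ 2)) := by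
          rw [← mul_assoc, ← Real.exp_add]; simp
      _ ≤ 2 * C * (2 * C) := by gcongr
      _ = _ := by ring
  rw [mem_closedBall_zero_iff, pi_norm_le_iff_of_nonneg (by positivity)]
  intro i
  have h4 : |x 1| ≤ 2 * C := abs_le_of_sq_le_sq (by nlinarith [sq_nonneg (x 2)]) (by positivity)
  have h5 : |x 2| ≤ 2 * C := abs_le_of_sq_le_sq (by nlinarith [sq_nonneg (x 1)]) (by positivity)
  have hD := D.coe_nonneg
  fin_cases i <;> simp only [Fin.zero_eta, Fin.mk_one, Fin.reduceFinMk, Real.norm_eq_abs] <;>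
    linarith

end Hull

/-! ### Support theorems from charts that straighten the geodesics -/

section SupportChart

/-- The set `S` is `ε`-small. -/
def IsSmall {n : ℕ} (ε : ℝ) (S : Set (Coord n)) : Prop := ∀ p ∈ S, ∀ q ∈ S, ‖q - p‖ ≤ ε

lemma IsSmall.closure_convexHull {n : ℕ} {ε : ℝ} (hε : 0 ≤ ε) {S : Set (Coord n)}
    (hS : IsSmall ε S) : IsSmall ε (closure (convexHull ℝ S)) := by
  have hb : Bornology.IsBounded S := Metric.isBounded_iff.2 ⟨ε, fun p hp q hq => by
    rw [dist_comm, dist_eq_norm]; exact hS p hp q hq⟩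
  have hb' : Bornology.IsBounded (closure (convexHull ℝ S)) :=
    (isBounded_convexHull.2 hb).closure
  have hd : Metric.diam (closure (convexHull ℝ S)) ≤ ε := by
    rw [Metric.diam_closure, convexHull_diam]
    exact Metric.diam_le_of_forall_dist_le hε fun p hp q hq => by
      rw [dist_comm, dist_eq_norm]; exact hS p hp q hq
  intro p hp q hq
  rw [← dist_eq_norm]
  exact (Metric.dist_le_diam_of_mem hb' hq hp).trans hd

lemma isSmall_image {n : ℕ} {f : Coord n → Coord n} {S : Set (Coord n)} (hS : IsCompact S)
    (hf : ContinuousOn f S) {T : ℕ → Set (Coord n)} (hT : ∀ i, T i ⊆ S)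
    (h : ∀ ε > 0, ∀ᶠ i in atTop, IsSmall ε (T i)) :
    ∀ ε > 0, ∀ᶠ i in atTop, IsSmall ε (f '' T i) := by
  intro ε hε
  obtain ⟨δ, hδ, hu⟩ := Metric.uniformContinuousOn_iff.1
    (hS.uniformContinuousOn_of_continuous hf) ε hε
  filter_upwards [h (δ / 2) (by positivity)] with i hi
  rintro _ ⟨p, hp, rfl⟩ _ ⟨q, hq, rfl⟩
  rw [← dist_eq_norm]
  refine (hu q (hT i hq) p (hT i hp) ?_).le
  rw [dist_eq_norm]
  linarith [hi p hp q hq]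

variable {g : MetricTensor 3}

lemma IsRiemannianMetric.eventually_isSmall (hg : IsRiemannianMetric g) {S : Set (Coord 3)}
    (hS : Bornology.IsBounded S) {T : ℕ → Set (Coord 3)} (hT : ∀ i, T i ⊆ S)
    (h : Tendsto (fun i => riemDiam g (T i)) atTop (𝓝 0)) :
    ∀ ε > 0, ∀ᶠ i in atTop, IsSmall ε (T i) := by
  intro ε hε
  obtain ⟨B, hB, hSB⟩ := hS.subset_closedBall_lt 0 0
  obtain ⟨C, hC, hCd⟩ := hg.exists_norm_sub_le hB
  filter_upwards [ENNReal.tendsto_nhds_zero.1 h (ENNReal.ofReal (C * ε))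
    (by rw [gt_iff_lt, ENNReal.ofReal_pos]; positivity)] with i hi p hp q hq
  have h1 : riemDist g p q ≤ riemDiam g (T i) := 
    le_iSup₂_of_le p hp (le_iSup₂_of_le q hq le_rfl)
  have h2 := ((hCd p (hSB (hT i hp)) q (hSB (hT i hq))).trans h1).trans hi
  rw [ENNReal.ofReal_le_ofReal_iff (by positivity)] at h2
  exact le_of_mul_le_mul_left h2 hC

lemma IsRiemannianMetric.tendsto_riemDiam (hg : IsRiemannianMetric g) {S : Set (Coord 3)}
    (hS : Bornology.IsBounded S) {T : ℕ → Set (Coord 3)} (hT : ∀ i, T i ⊆ S)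
    (h : ∀ ε > 0, ∀ᶠ i in atTop, IsSmall ε (T i)) :
    Tendsto (fun i => riemDiam g (T i)) atTop (𝓝 0) := by
  obtain ⟨B, hSB⟩ := hS.subset_closedBall 0
  obtain ⟨C, hC, hCd⟩ := hg.exists_riemDist_le B
  refine ENNReal.tendsto_nhds_zero.2 fun ε hε => ?_
  obtain ⟨r, hr0, hr, hrε⟩ : ∃ r : ℝ, 0 ≤ r ∧ 0 < ENNReal.ofReal r ∧ ENNReal.ofReal r < ε := by
    obtain ⟨r, hr, hrε⟩ := ENNReal.lt_iff_exists_real_btwn.1 hε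
    exact ⟨r, hr, hrε⟩
  rw [ENNReal.ofReal_pos] at hr
  filter_upwards [h (r / C) (by positivity)] with i hi
  refine iSup₂_le fun p hp => iSup₂_le fun q hq => ?_
  refine ((hCd p (hSB (hT i hp)) q (hSB (hT i hq))).trans ?_).trans hrε.le
  refine ENNReal.ofReal_le_ofReal ?_
  calc C * ‖q - p‖ ≤ C * (r / C) := by gcongr; exact hi p hp q hq
    _ = r := by field_simp

/-- To K is assigned Ψ(closed convex hull of Φ(K)). Taking convex hulls preserves diameter bounds,
and Φ, Ψ are uniformly continuous on the compact sets that occur, so small K have small images. -/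
lemma hasSupportTheorem_of_chart (hg : IsRiemannianMetric g) {Φ Ψ : Coord 3 → Coord 3}
    {U : Set (Coord 3)} (hΦ : Continuous Φ) (hΨ : ContinuousOn Ψ U) (hΨΦ : ∀ p, Ψ (Φ p) = p)
    (hU : ∀ K : Set (Coord 3), IsCompact K → closure (convexHull ℝ (Φ '' K)) ⊆ U)
    (hsupp : ∀ (K : TopologicalSpace.Compacts (Coord 3)) (F : Coord 3 → ℝ),
      Continuous F → HasCompactSupport F →
      (∀ γ, IsEscaping g γ → (∀ s, γ s ∉ K) → xray F γ = 0) →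
      ∀ x, Φ x ∉ closure (convexHull ℝ (Φ '' (K : Set (Coord 3)))) → F x = 0) :
    HasSupportTheorem g := by
  have hcpt : ∀ K : Set (Coord 3), IsCompact K → IsCompact (closure (convexHull ℝ (Φ '' K))) :=
    fun K hK => Metric.isCompact_of_isClosed_isBounded isClosed_closure
      (isBounded_convexHull.2 (hK.image hΦ).isBounded).closure
  refine ⟨fun K => ⟨Ψ '' closure (convexHull ℝ (Φ '' (K : Set (Coord 3)))),
    (hcpt K K.isCompact).image_of_continuousOn (hΨ.mono (hU K K.isCompact))⟩, ?_, ?_⟩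
  · intro K F hF hFc hx
    refine closure_minimal (fun x hxF => ?_) (TopologicalSpace.Compacts.isCompact _).isClosed
    refine ⟨Φ x, ?_, hΨΦ x⟩
    by_contra hne
    exact hxF (hsupp K F hF hFc hx x hne)
  · intro K hK hlim
    -- All K i lie in the compact set K 0, where the Riemannian distance and the coordinate norm are
    -- comparable.
    have hK0 : ∀ i, (K i : Set (Coord 3)) ⊆ K 0 := fun i =>
      antitone_nat_of_succ_le (f := K) hK (Nat.zero_le i)
    have h1 := hg.eventually_isSmall (K 0).isCompact.isBounded hK0 hlim
    have h2 := isSmall_image (K 0).isCompact hΦ.continuousOn hK0 h1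
    have h3 : ∀ ε > 0, ∀ᶠ i in atTop,
        IsSmall ε (closure (convexHull ℝ (Φ '' (K i : Set (Coord 3))))) := fun ε hε =>
      (h2 ε hε).mono fun i hi => hi.closure_convexHull hε.le
    have hsub : ∀ i, closure (convexHull ℝ (Φ '' (K i : Set (Coord 3)))) ⊆
        closure (convexHull ℝ (Φ '' (K 0 : Set (Coord 3)))) := fun i =>
      closure_mono (convexHull_mono (image_mono (hK0 i)))
    have hcont := hΨ.mono (hU _ (K 0).isCompact)
    have h4 := isSmall_image (hcpt _ (K 0).isCompact) hcont hsub h3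
    exact hg.tendsto_riemDiam ((hcpt _ (K 0).isCompact).image_of_continuousOn hcont).isBounded
      (fun i => image_mono (hsub i)) h4

end SupportChart

/-! ### Separation by lines in one plane. -/

section PlanarSupport

/-- The line of slope -m through z₀ lies strictly above T. The lines of nearby slopes with
intercepts above the midpoint (c + b₀)/2 still miss T, so `eq_zero_of_line_integrals` applies. -/
lemma planar_support_below {G : ℝ × ℝ → ℝ} (hG : Continuous G) {B : ℝ}
    (hB : ∀ x y, B ≤ |x| ∨ B ≤ |y| → G (x, y) = 0) {T : Set (ℝ × ℝ)} {M : ℝ}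
    (hT : ∀ z ∈ T, |z.1| ≤ M)
    (H : ∀ a b, (∀ z ∈ T, z.2 ≠ a * z.1 + b) → ∫ x, G (x, a * x + b) = 0) {m c : ℝ}
    (hlt : ∀ z ∈ T, z.2 + m * z.1 < c) {z₀ : ℝ × ℝ} (h₀ : c < z₀.2 + m * z₀.1) : G z₀ = 0 := by
  set b₀ := z₀.2 + m * z₀.1
  -- Over |x| ≤ M, changing the slope by ε moves a line by at most half of the gap b₀ - c.
  set ε := (b₀ - c) / (2 * (|M| + 1))
  have hε : 0 < ε := div_pos (by linarith) (by positivity)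
  have hεM : ε * |M| ≤ (b₀ - c) / 2 := by
    have : ε * (|M| + 1) = (b₀ - c) / 2 := by simp only [ε]; field_simp
    nlinarith
  have := eq_zero_of_line_integrals hG hB (Metric.isOpen_ball (x := -m) (ε := ε))
    (b₁ := (c + b₀) / 2) (fun a ha b hb => H a b fun z hz => ne_of_lt ?_)
    (Metric.mem_ball_self hε) (b := b₀) (by linarith) z₀.1
  · convert this using 2
    ext
    · rfl
    · simp only [b₀]; ring
  · have h1 := hlt z hz
    rw [Metric.mem_ball, Real.dist_eq] at ha
    have h2 : |(a - -m) * z.1| ≤ ε * |M| := by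
      rw [abs_mul]
      exact mul_le_mul ha.le ((hT z hz).trans (le_abs_self M)) (abs_nonneg _) hε.le
    have h3 := neg_abs_le ((a - -m) * z.1)
    linarith

/-- The reflection y ↦ -y reduces this to the previous lemma. -/
lemma planar_support_above {G : ℝ × ℝ → ℝ} (hG : Continuous G) {B : ℝ}
    (hB : ∀ x y, B ≤ |x| ∨ B ≤ |y| → G (x, y) = 0) {T : Set (ℝ × ℝ)} {M : ℝ}
    (hT : ∀ z ∈ T, |z.1| ≤ M)
    (H : ∀ a b, (∀ z ∈ T, z.2 ≠ a * z.1 + b) → ∫ x, G (x, a * x + b) = 0) {m c : ℝ}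
    (hlt : ∀ z ∈ T, c < z.2 + m * z.1) {z₀ : ℝ × ℝ} (h₀ : z₀.2 + m * z₀.1 < c) : G z₀ = 0 := by
  have := planar_support_below (G := fun z => G (z.1, -z.2)) (B := B)
    (T := {z | (z.1, -z.2) ∈ T}) (M := M) (m := -m) (c := -c) (z₀ := (z₀.1, -z₀.2))
    (by fun_prop) (fun x y hxy => hB _ _ (by rwa [abs_neg])) (fun z hz => hT (z.1, -z.2) hz)
    (fun a b hab => ?_) (fun z hz => ?_) ?_
  · simpa using this
  · rw [← H (-a) (-b) fun z hz hz' => hab (z.1, -z.2) (by simpa using hz) (by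
      simp only [hz']; ring)]
    refine integral_congr_ae (Eventually.of_forall fun x => ?_)
    simp only
    congr 2
    ring
  · have := hlt _ hz
    simp only at this
    linarith
  · simp only
    linarith

/-- A point outside of a compact convex set can be separated from it by a plane that is not
vertical. -/
lemma exists_nonvertical_separation {S : Set (Coord 3)} (hS : Bornology.IsBounded S)
    {x : Coord 3} (hx : x ∉ closure (convexHull ℝ S)) : ∃ m₁ m₂ c : ℝ,
      ((∀ p ∈ S, p 0 + m₁ * p 1 + m₂ * p 2 < c) ∧ c < x 0 + m₁ * x 1 + m₂ * x 2) ∨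
      ((∀ p ∈ S, c < p 0 + m₁ * p 1 + m₂ * p 2) ∧ x 0 + m₁ * x 1 + m₂ * x 2 < c) := by
  obtain ⟨f, u, hf, hfx⟩ := geometric_hahn_banach_closed_point
    (convex_convexHull ℝ S).closure isClosed_closure hx
  obtain ⟨M, hM⟩ := (hS.union (Bornology.isBounded_singleton (x := x))).exists_norm_le
  have hexp : ∀ p : Coord 3, f p = f (Pi.single 0 1) * p 0 + f (Pi.single 1 1) * p 1
      + f (Pi.single 2 1) * p 2 := by
    intro p
    have : p = p 0 • (Pi.single 0 1 : Coord 3) + p 1 • (Pi.single 1 1 : Coord 3)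
        + p 2 • (Pi.single 2 1 : Coord 3) := by
      ext i; fin_cases i <;> simp
    conv_lhs => rw [this]
    simp only [map_add, map_smul, smul_eq_mul]
    ring
  obtain ⟨A, v, hA, h1, h2⟩ : ∃ A v : ℝ, A ≠ 0 ∧
      (∀ p ∈ S, A * p 0 + f (Pi.single 1 1) * p 1 + f (Pi.single 2 1) * p 2 < v) ∧
      v < A * x 0 + f (Pi.single 1 1) * x 1 + f (Pi.single 2 1) * x 2 := by
    -- A vertical separating plane is tilted slightly. On the bounded set S ∪ {x} the added term ε
    -- p₀ is smaller than half of the gap, so the plane through the middle still separates.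
    by_cases hA : f (Pi.single 0 1) = 0
    · set ε := (f x - u) / (2 * (|M| + 1))
      have hε : 0 < ε := div_pos (by linarith) (by positivity)
      have hεM : ε * |M| < (f x - u) / 2 := by
        have : ε * (|M| + 1) = (f x - u) / 2 := by simp only [ε]; field_simp
        nlinarith
      have hb : ∀ p ∈ S ∪ {x}, |ε * p 0| ≤ ε * |M| := by
        intro p hp
        rw [abs_mul, abs_of_pos hε]
        exact mul_le_mul_of_nonneg_left
          (((norm_le_pi_norm p 0).trans (hM p hp)).trans (le_abs_self M)) hε.le
      refine ⟨ε, (f x + u) / 2, hε.ne', fun p hp => ?_, ?_⟩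
      · have e1 := hexp p
        have e2 := hf p (subset_closure (subset_convexHull ℝ S hp))
        have e3 := abs_le.1 (hb p (Or.inl hp))
        rw [hA] at e1
        linarith
      · have e1 := hexp x
        have e3 := abs_le.1 (hb x (Or.inr rfl))
        rw [hA] at e1
        linarith
    · refine ⟨_, u, hA, fun p hp => ?_, ?_⟩
      · rw [← hexp]
        exact hf p (subset_closure (subset_convexHull ℝ S hp))
      · rwa [← hexp]
  have hdiv : ∀ p : Coord 3, p 0 + f (Pi.single 1 1) / A * p 1 + f (Pi.single 2 1) / A * p 2 =
      (A * p 0 + f (Pi.single 1 1) * p 1 + f (Pi.single 2 1) * p 2) / A := by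
    intro p; field_simp
  refine ⟨f (Pi.single 1 1) / A, f (Pi.single 2 1) / A, v / A, ?_⟩
  simp only [hdiv]
  rcases hA.lt_or_gt with hneg | hpos
  · exact Or.inr ⟨fun p hp => div_lt_div_of_neg_of_lt hneg (h1 p hp),
      div_lt_div_of_neg_of_lt hneg h2⟩
  · exact Or.inl ⟨fun p hp => div_lt_div_of_pos_right (h1 p hp) hpos,
      div_lt_div_of_pos_right h2 hpos⟩

/-- The support theorem in one plane `E_α` and a chart `Φ` of the form `(t, x, y) ↦ (w, x, y)`. -/
lemma eq_zero_of_chart_line_integrals {Φ : Coord 3 → Coord 3} (hΦ1 : ∀ p, Φ p 1 = p 1)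
    (hΦ2 : ∀ p, Φ p 2 = p 2) {K : Set (Coord 3)} (hK : IsCompact K) (hΦ : Continuous Φ)
    {G : ℝ × ℝ → ℝ} (hG : Continuous G) {B : ℝ}
    (hB : ∀ x y, B ≤ |x| ∨ B ≤ |y| → G (x, y) = 0) {α : ℝ}
    (H : ∀ a b, (∀ u : Coord 2, planeMap α u ∈ K → Φ (planeMap α u) 0 ≠ a * u 1 + b) →
      ∫ x, G (x, a * x + b) = 0) {u₀ : Coord 2}
    (hu₀ : Φ (planeMap α u₀) ∉ closure (convexHull ℝ (Φ '' K))) :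
    G (u₀ 1, Φ (planeMap α u₀) 0) = 0 := by
  obtain ⟨M, hM⟩ := hK.isBounded.exists_norm_le
  -- The trace of K in E_α, in the coordinates (ρ, w) in which geodesics are lines.
  set T : Set (ℝ × ℝ) := (fun u : Coord 2 => (u 1, Φ (planeMap α u) 0)) '' {u | planeMap α u ∈ K}
  have hT : ∀ z ∈ T, |z.1| ≤ M + M := by
    rintro _ ⟨u, hu, rfl⟩
    have h1 := (norm_le_pi_norm _ 1).trans (hM _ hu)
    have h2 := (norm_le_pi_norm _ 2).trans (hM _ hu)
    rw [Real.norm_eq_abs, planeMap_one] at h1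
    rw [Real.norm_eq_abs, planeMap_two] at h2
    have e : u 1 = Real.cos α * (Real.cos α * u 1) + Real.sin α * (Real.sin α * u 1) := by
      linear_combination (-u 1) * Real.cos_sq_add_sin_sq α
    change |u 1| ≤ _
    rw [e]
    refine (abs_add_le _ _).trans (add_le_add ?_ ?_)
    · rw [abs_mul]
      exact (mul_le_of_le_one_left (abs_nonneg _) (Real.abs_cos_le_one α)).trans h1
    · rw [abs_mul]
      exact (mul_le_of_le_one_left (abs_nonneg _) (Real.abs_sin_le_one α)).trans h2
  have H' : ∀ a b, (∀ z ∈ T, z.2 ≠ a * z.1 + b) → ∫ x, G (x, a * x + b) = 0 :=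
    fun a b hab => H a b fun u hu => hab _ ⟨u, hu, rfl⟩
  obtain ⟨m₁, m₂, c, h⟩ := exists_nonvertical_separation (hK.image hΦ).isBounded hu₀
  -- The separating plane meets E_α in a line of slope -(m₁ cos α + m₂ sin α).
  have e : ∀ u, Φ (planeMap α u) 0 + m₁ * Φ (planeMap α u) 1 + m₂ * Φ (planeMap α u) 2 =
      Φ (planeMap α u) 0 + (m₁ * Real.cos α + m₂ * Real.sin α) * u 1 := by
    intro u
    rw [hΦ1, hΦ2, planeMap_one, planeMap_two]
    ring
  rcases h with ⟨h1, h2⟩ | ⟨h1, h2⟩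
  · rw [e] at h2
    refine planar_support_below hG hB hT H' ?_ h2
    rintro _ ⟨u, hu, rfl⟩
    simpa only [e] using h1 _ ⟨_, hu, rfl⟩
  · rw [e] at h2
    refine planar_support_above hG hB hT H' ?_ h2
    rintro _ ⟨u, hu, rfl⟩
    simpa only [e] using h1 _ ⟨_, hu, rfl⟩

end PlanarSupport

/-! ### The support theorems for warped metrics -/

section WarpSupport

variable {l : ℝ} {Q : Coord 3 → ℝ}

lemma deriv_planeMap (α : ℝ) {η : ℝ → Coord 2} (hη : Differentiable ℝ η) :
    deriv (fun s => planeMap α (η s)) = fun s => planeMap α (deriv η s) :=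
  funext fun s => ((planeMap α).hasFDerivAt.comp_hasDerivAt s (hη s).hasDerivAt).deriv

/-- Escaping geodesics in the plane `E_α`, in terms of the coordinates of that plane. -/
lemma isEscaping_planeMap (hQ : IsAdmissible Q) (α : ℝ) {η η' η'' : ℝ → Coord 2}
    (hη : ContDiff ℝ ∞ η) (h1 : ∀ s, HasDerivAt η (η' s) s) (h2 : ∀ s, HasDerivAt η' (η'' s) s)
    (hode : ∀ s, η'' s = -planeChristoffel l (η s) (η' s) (η' s))
    (hspeed : ∀ s, η' s 0 * η' s 0 + Real.exp (2 * l * η s 0) * (η' s 1 * η' s 1) = 1)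
    (hproper : Tendsto η (cocompact ℝ) (cocompact (Coord 2))) :
    IsEscaping (warpMetric l Q) (fun s => planeMap α (η s)) := by
  have e1 : deriv η = η' := funext fun s => (h1 s).deriv
  have e2 : deriv η' = η'' := funext fun s => (h2 s).deriv
  have d1 : deriv (fun s => planeMap α (η s)) = fun s => planeMap α (η' s) := by
    rw [deriv_planeMap α fun s => (h1 s).differentiableAt, e1]
  have d2 : deriv (fun s => planeMap α (η' s)) = fun s => planeMap α (η'' s) := by
    rw [deriv_planeMap α fun s => (h2 s).differentiableAt, e2]
  refine ⟨⟨(planeMap α).contDiff.comp hη, fun s => ?_⟩, fun s => ?_, ?_⟩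
  · rw [covDeriv, d1, d2]
    simp only
    rw [christoffelVec_planeMap hQ, ← map_add, hode, neg_add_cancel, map_zero]
  · rw [d1, innerAt_warpMetric_planeMap, hspeed]
  · exact (LinearMap.isClosedEmbedding_of_injective (f := (planeMap α : Coord 2 →ₗ[ℝ] Coord 3))
      (LinearMap.ker_eq_bot.2 (planeMap_injective α))).tendsto_cocompact.comp hproper

/-- A curve is proper as soon as one of its coordinates is. -/
lemma tendsto_cocompact_of_coord {n : ℕ} {η : ℝ → Coord n} (i : Fin n)
    (h : Tendsto (fun s => η s i) (cocompact ℝ) (cocompact ℝ)) :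
    Tendsto η (cocompact ℝ) (cocompact (Coord n)) :=
  (tendsto_comap_iff.2 h).mono_right (comap_cocompact_le (continuous_apply i))

lemma exists_planeMap_eq (x : Coord 3) : ∃ α u, planeMap α u = x := by
  have hx : x ∈ ⋃₀ halfPlanePairs := by rw [sUnion_halfPlanePairs]; trivial
  obtain ⟨-, ⟨α, -, rfl⟩, hxα⟩ := hx
  rw [halfPlanePair_eq_range] at hxα
  exact ⟨α, hxα⟩

lemma planeMap_sq_add_sq (α : ℝ) (u : Coord 2) :
    planeMap α u 1 ^ 2 + planeMap α u 2 ^ 2 = u 1 ^ 2 := by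
  rw [planeMap_one, planeMap_two]
  linear_combination u 1 ^ 2 * Real.cos_sq_add_sin_sq α

/-- A bound for the support of `F` in the coordinates of the planes `E_α`. -/
lemma exists_planeMap_support_bound {F : Coord 3 → ℝ} (hF : HasCompactSupport F) :
    ∃ B > 0, ∀ α u, F (planeMap α u) ≠ 0 → |u 0| < B ∧ |u 1| < B := by
  obtain ⟨M, hM0, hM⟩ := hF.isBounded.subset_closedBall_lt 0 0
  refine ⟨2 * M, by positivity, fun α u hu => ?_⟩
  have h := mem_closedBall_zero_iff.1 (hM (subset_tsupport F hu))
  have h0 := (norm_le_pi_norm _ 0).trans h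
  have h1 := (norm_le_pi_norm _ 1).trans h
  have h2 := (norm_le_pi_norm _ 2).trans h
  rw [Real.norm_eq_abs] at h0 h1 h2
  refine ⟨by rw [planeMap_zero] at h0; linarith, abs_lt_of_sq_lt_sq ?_ (by positivity)⟩
  rw [← planeMap_sq_add_sq α]
  have e1 := sq_le_sq' (abs_le.1 h1).1 (abs_le.1 h1).2
  have e2 := sq_le_sq' (abs_le.1 h2).1 (abs_le.1 h2).2
  nlinarith [pow_pos hM0 2]

lemma hasSupportTheorem_warpMetric_zero (hQ : IsAdmissible Q) :
    HasSupportTheorem (warpMetric 0 Q) := by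
  refine hasSupportTheorem_of_chart (hQ.isRiemannianMetric 0) (Φ := id) (Ψ := id) (U := univ)
    continuous_id continuousOn_id (fun _ => rfl) (fun _ _ => subset_univ _) ?_
  intro K F hF hFc hx x hxK
  obtain ⟨α, u₀, rfl⟩ := exists_planeMap_eq x
  obtain ⟨B, hB0, hB⟩ := exists_planeMap_support_bound hFc
  have := eq_zero_of_chart_line_integrals (Φ := id) (fun _ => rfl) (fun _ => rfl) K.isCompact
    continuous_id (G := fun z => F (planeMap α ![z.2, z.1])) (B := B)
    (hF.comp ((planeMap α).continuous.comp (continuous_pi fun i => by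
      fin_cases i <;> simp <;> fun_prop))) (fun x y hxy => ?_) (α := α) (fun a b hab => ?_) hxK
  · have e : ![planeMap α u₀ 0, u₀ 1] = u₀ := by
      ext i; fin_cases i <;> rfl
    rw [id, e] at this
    exact this
  · by_contra hne
    have h := hB _ _ hne
    rcases hxy with h' | h'
    · exact absurd h.2 (not_lt.2 h')
    · exact absurd h.1 (not_lt.2 h')
  -- The speed of ρ ↦ (aρ + b, ρ). Parametrizing by s/κ gives unit speed and multiplies the integral
  -- by κ ≠ 0.
  · set κ := √(1 + a ^ 2)
    have hκ : 0 < κ := Real.sqrt_pos.2 (by positivity)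
    have hκ2 : κ ^ 2 = 1 + a ^ 2 := Real.sq_sqrt (by positivity)
    set η : ℝ → Coord 2 := fun s => ![a * (s / κ) + b, s / κ]
    have hd : ∀ s, HasDerivAt η ![a / κ, 1 / κ] s := by
      intro s
      have h1 : HasDerivAt (fun s : ℝ => s / κ) (1 / κ) s := (hasDerivAt_id s).div_const κ
      refine hasDerivAt_pi.2 fun i => ?_
      fin_cases i
      · exact ((h1.const_mul a).add_const b).congr_deriv (by simp; ring)
      · exact h1
    have hesc : IsEscaping (warpMetric 0 Q) (fun s => planeMap α (η s)) := by
      refine isEscaping_planeMap hQ α (η' := fun _ => ![a / κ, 1 / κ]) (η'' := fun _ => 0)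
        (contDiff_pi.2 fun i => by fin_cases i <;> simp [η] <;> fun_prop) hd
        (fun s => hasDerivAt_const _ _) (fun s => ?_) (fun s => ?_)
        (tendsto_cocompact_of_coord 1 ?_)
      · ext i; fin_cases i <;> simp [planeChristoffel]
      · simp only [Matrix.cons_val_zero, Matrix.cons_val_one, mul_zero, zero_mul, Real.exp_zero]
        field_simp
        linear_combination -hκ2
      · have := (Homeomorph.mulRight₀ κ⁻¹ (inv_ne_zero hκ.ne')).isClosedEmbedding.tendsto_cocompact
        exact this.congr fun s => (div_eq_mul_inv s κ).symm
    have h0 := hx _ hesc fun s hs => hab (η s) hs rfl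
    have h1 := Measure.integral_comp_div (fun x => F (planeMap α ![a * x + b, x])) κ
    change ∫ s, F (planeMap α (η s)) = 0 at h0
    simp only [η] at h0
    rw [h0, eq_comm, smul_eq_zero] at h1
    exact h1.resolve_left (abs_pos.2 hκ.ne').ne'

/-- In these coordinates the geodesics of the hyperbolic planes `E_α` are straight lines. -/
def parabolicChart (p : Coord 3) : Coord 3 :=
  ![Real.exp (-2 * p 0) + p 1 ^ 2 + p 2 ^ 2, p 1, p 2]

/-- The inverse of `parabolicChart`. -/
def parabolicChartInv (p : Coord 3) : Coord 3 :=
  ![-(1 / 2) * Real.log (p 0 - (p 1 ^ 2 + p 2 ^ 2)), p 1, p 2]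

lemma continuous_parabolicChart : Continuous parabolicChart :=
  continuous_pi fun i => by fin_cases i <;> simp [parabolicChart] <;> fun_prop

lemma continuousOn_parabolicChartInv :
    ContinuousOn parabolicChartInv {p | p 1 ^ 2 + p 2 ^ 2 < p 0} := by
  refine continuousOn_pi.2 fun i => ?_
  fin_cases i
  · exact continuousOn_const.mul (ContinuousOn.log (by fun_prop) fun p hp =>
      (sub_pos.2 hp).ne')
  · exact (continuous_apply 1).continuousOn
  · exact (continuous_apply 2).continuousOn

lemma parabolicChartInv_parabolicChart (p : Coord 3) :
    parabolicChartInv (parabolicChart p) = p := by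
  have e : Real.exp (-2 * p 0) + p 1 ^ 2 + p 2 ^ 2 - (p 1 ^ 2 + p 2 ^ 2) =
    Real.exp (-2 * p 0) := by ring
  ext i
  fin_cases i
  · change -(1 / 2) * Real.log (Real.exp (-2 * p 0) + p 1 ^ 2 + p 2 ^ 2 - (p 1 ^ 2 + p 2 ^ 2)) = _
    rw [e, Real.log_exp]
    simp
  · rfl
  · rfl

/-- Since t is bounded on K, the image lies in the closed convex set w ≥ x² + y² + δ with δ > 0. The
closed hull thus stays away from the boundary paraboloid, where the inverse chart is singular. -/
lemma closure_convexHull_parabolicChart_subset {K : Set (Coord 3)} (hK : IsCompact K) :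
    closure (convexHull ℝ (parabolicChart '' K)) ⊆ {p | p 1 ^ 2 + p 2 ^ 2 < p 0} := by
  obtain ⟨M, hM⟩ := hK.isBounded.exists_norm_le
  set δ := Real.exp (-2 * M)
  have hconv : Convex ℝ {p : Coord 3 | p 1 ^ 2 + p 2 ^ 2 + δ ≤ p 0} := by
    intro p hp q hq a b ha hb hab
    simp only [mem_ofPred_eq, Pi.add_apply, Pi.smul_apply, smul_eq_mul] at hp hq ⊢
    have hb' : b = 1 - a := by linarith
    subst hb'
    nlinarith [mul_nonneg (mul_nonneg ha hb) (sq_nonneg (p 1 - q 1)),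
      mul_nonneg (mul_nonneg ha hb) (sq_nonneg (p 2 - q 2)), mul_le_mul_of_nonneg_left hp ha,
      mul_le_mul_of_nonneg_left hq hb]
  have hclosed : IsClosed {p : Coord 3 | p 1 ^ 2 + p 2 ^ 2 + δ ≤ p 0} :=
    isClosed_le (by fun_prop) (by fun_prop)
  refine (closure_minimal (convexHull_min ?_ hconv) hclosed).trans fun p hp => ?_
  · rintro _ ⟨p, hp, rfl⟩
    have h0 := (le_abs_self _).trans ((norm_le_pi_norm p 0).trans (hM p hp))
    have : δ ≤ Real.exp (-2 * p 0) := Real.exp_le_exp.2 (by linarith)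
    change p 1 ^ 2 + p 2 ^ 2 + δ ≤ Real.exp (-2 * p 0) + p 1 ^ 2 + p 2 ^ 2
    linarith
  · have := Real.exp_pos (-2 * M)
    simp only [mem_ofPred_eq] at hp ⊢
    linarith

lemma hasDerivAt_log_cosh_sub (c s : ℝ) :
    HasDerivAt (fun s => Real.log (Real.cosh s) - c) (Real.sinh s / Real.cosh s) s :=
  ((Real.hasDerivAt_cosh s).log (Real.cosh_pos s).ne').sub_const _

lemma hasDerivAt_sinh_div_cosh (s : ℝ) :
    HasDerivAt (fun s => Real.sinh s / Real.cosh s) (1 / Real.cosh s ^ 2) s := by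
  refine ((Real.hasDerivAt_sinh s).div (Real.hasDerivAt_cosh s)
    (Real.cosh_pos s).ne').congr_deriv ?_
  congr 1
  linear_combination Real.cosh_sq s

lemma hasDerivAt_div_cosh_sq (R s : ℝ) : HasDerivAt (fun s => R / Real.cosh s ^ 2)
    (-2 * (Real.sinh s / Real.cosh s) * (R / Real.cosh s ^ 2)) s := by
  have hC := (Real.cosh_pos s).ne'
  refine ((hasDerivAt_const s R).div ((Real.hasDerivAt_cosh s).pow 2)
    (pow_ne_zero 2 hC)).congr_deriv ?_
  simp only [Nat.cast_ofNat, Nat.add_one_sub_one, pow_one, Pi.pow_apply]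
  field_simp
  ring

lemma exp_log_cosh_sub {R : ℝ} (hR : 0 < R) (s : ℝ) :
    Real.exp (2 * 1 * (Real.log (Real.cosh s) - Real.log R)) = Real.cosh s ^ 2 / R ^ 2 := by
  rw [mul_one, ← Real.log_div (Real.cosh_pos s).ne' hR.ne', mul_comm, Real.exp_mul,
    Real.exp_log (div_pos (Real.cosh_pos s) hR), Real.rpow_two, div_pow]

/-- The geodesics of the hyperbolic plane `dt² + e^{2t} dρ²`: in the coordinates `(ρ, e^{-t})` of
the half plane model they are half circles. -/
lemma isEscaping_halfCircle (hQ : IsAdmissible Q) (α c : ℝ) {R : ℝ} (hR : 0 < R) :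
    IsEscaping (warpMetric 1 Q) (fun s => planeMap α
      ![Real.log (Real.cosh s) - Real.log R, c + R * (Real.sinh s / Real.cosh s)]) := by
  have hC : ∀ s, Real.cosh s ≠ 0 := fun s => (Real.cosh_pos s).ne'
  have hlog := hasDerivAt_log_cosh_sub (Real.log R)
  have htanh := hasDerivAt_sinh_div_cosh
  have hinv := hasDerivAt_div_cosh_sq R
  have hexp := exp_log_cosh_sub hR
  refine isEscaping_planeMap hQ α
    (η' := fun s => ![Real.sinh s / Real.cosh s, R / Real.cosh s ^ 2])
    (η'' := fun s => ![1 / Real.cosh s ^ 2, -2 * (Real.sinh s / Real.cosh s) *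
      (R / Real.cosh s ^ 2)]) ?_ (fun s => ?_) (fun s => ?_) (fun s => ?_) (fun s => ?_)
    (tendsto_cocompact_of_coord 0 ?_)
  · refine contDiff_pi.2 fun i => ?_
    fin_cases i
    · exact (Real.contDiff_cosh.log hC).sub contDiff_const
    · exact contDiff_const.add (contDiff_const.mul (Real.contDiff_sinh.div Real.contDiff_cosh hC))
  · refine hasDerivAt_pi.2 fun i => ?_
    fin_cases i
    · exact hlog s
    · exact (((htanh s).const_mul R).const_add c).congr_deriv (by simp; ring)
  · refine hasDerivAt_pi.2 fun i => ?_
    fin_cases i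
    · exact htanh s
    · exact hinv s
  · have := hC s
    ext i
    fin_cases i
    · simp only [planeChristoffel, Fin.zero_eta, Matrix.cons_val_zero, Matrix.cons_val_one, hexp,
        Pi.neg_apply]
      field_simp
    · simp only [planeChristoffel, Fin.mk_one, Matrix.cons_val_zero, Matrix.cons_val_one,
        Pi.neg_apply]
      ring
  · have := hC s
    simp only [Matrix.cons_val_zero, Matrix.cons_val_one, hexp]
    field_simp
    linear_combination -Real.cosh_sq s
  -- Properness comes from t alone: cosh s ≥ e^{|s|}/2, so t → ∞ at both ends.
  · have hge : ∀ s : ℝ, |s| - Real.log 2 - Real.log R ≤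
        Real.log (Real.cosh s) - Real.log R := by
      intro s
      have h1 : Real.exp |s| / 2 ≤ Real.cosh s := by
        rw [← Real.cosh_abs, Real.cosh_eq]
        have := Real.exp_pos (-|s|)
        linarith
      have h2 := Real.log_le_log (by positivity) h1
      rw [Real.log_div (Real.exp_pos _).ne' two_ne_zero, Real.log_exp] at h2
      linarith
    have hlim : Tendsto (fun s : ℝ => |s| - Real.log 2 - Real.log R) (cocompact ℝ) atTop :=
      tendsto_atTop_add_const_right _ _ (tendsto_atTop_add_const_right _ _
        (tendsto_norm_cocompact_atTop (E := ℝ)))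
    exact (tendsto_atTop_mono hge hlim).mono_right atTop_le_cocompact

/-- The half circle (ρ - c)² + e^{-2t} = R² becomes the line w = aρ + b with a = 2c and b = R² - c².
On it dρ = (e^{-2t}/R) ds, so ∫ F ds = R ∫ F e^{2t} dρ. The weight depends on the geodesic only
through the constant R, and the line theorem applies to F e^{2t}. -/
lemma hasSupportTheorem_warpMetric_one (hQ : IsAdmissible Q) :
    HasSupportTheorem (warpMetric 1 Q) := by
  refine hasSupportTheorem_of_chart (hQ.isRiemannianMetric 1) continuous_parabolicChart
    continuousOn_parabolicChartInv parabolicChartInv_parabolicChart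
    (fun K hK => closure_convexHull_parabolicChart_subset hK) ?_
  intro K F hF hFc hx x hxK
  obtain ⟨α, u₀, rfl⟩ := exists_planeMap_eq x
  obtain ⟨B, hB0, hB⟩ := exists_planeMap_support_bound hFc
  -- F vanishes for t ≥ B, that is, where e^{-2t} ≤ δ.
  set δ := Real.exp (-2 * B)
  have hδ : 0 < δ := Real.exp_pos _
  have hsmall : ∀ t ρ, Real.exp (-2 * t) ≤ δ → F (planeMap α ![t, ρ]) = 0 := by
    intro t ρ ht
    by_contra hne
    have h1 := (abs_lt.1 (hB _ _ hne).1).2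
    have h2 := Real.exp_le_exp.1 ht
    simp only [Matrix.cons_val_zero] at h1
    linarith
  -- This is F e^{2t} with e^{-2t} = w - ρ². Replacing w - ρ² by its maximum with δ keeps the
  -- logarithm and the quotient continuous on the whole plane; where the replacement acts, F is
  -- zero.
  set G : ℝ × ℝ → ℝ := fun z =>
    F (planeMap α ![-(1 / 2) * Real.log (max (z.2 - z.1 ^ 2) δ), z.1]) / max (z.2 - z.1 ^ 2) δ
  have hmax : ∀ z : ℝ × ℝ, 0 < max (z.2 - z.1 ^ 2) δ := fun z => lt_max_of_lt_right hδ
  have hG : Continuous G := by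
    refine Continuous.div (hF.comp ((planeMap α).continuous.comp (continuous_pi fun i => ?_)))
      (by fun_prop) fun z => (hmax z).ne'
    fin_cases i
    · exact continuous_const.mul (Continuous.log (by fun_prop) fun z => (hmax z).ne')
    · exact continuous_fst
  have hG0 : ∀ z : ℝ × ℝ, z.2 - z.1 ^ 2 ≤ δ → G z = 0 := by
    intro z hz
    simp only [G, max_eq_right hz]
    rw [hsmall, zero_div]
    refine le_of_eq ?_
    simp only [δ, Real.log_exp]
    congr 1
    ring
  have hG1 : ∀ ρ t : ℝ, G (ρ, Real.exp (-2 * t) + ρ ^ 2) * Real.exp (-2 * t) =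
      F (planeMap α ![t, ρ]) := by
    intro ρ t
    rcases le_total (Real.exp (-2 * t)) δ with h | h
    · rw [hG0 _ (by simpa using h), hsmall t ρ h, zero_mul]
    · have e : -(1 / 2) * (-2 * t) = t := by ring
      have hne := (Real.exp_pos (-2 * t)).ne'
      simp only [G, add_sub_cancel_right, max_eq_left h, Real.log_exp, e]
      rw [div_mul_cancel₀ _ hne]
  -- On the support |ρ| < B and w = e^{-2t} + ρ² < e^{2B} + B².
  have hGB : ∀ x y, B + (Real.exp (2 * B) + B ^ 2) ≤ |x| ∨ B + (Real.exp (2 * B) + B ^ 2) ≤ |y| →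
      G (x, y) = 0 := by
    intro x y hxy
    by_contra hne
    have h1 : δ < y - x ^ 2 := by
      by_contra hle
      exact hne (hG0 (x, y) (not_lt.1 hle))
    simp only [G, max_eq_left h1.le] at hne
    have h2 := hB _ _ (div_ne_zero_iff.1 hne).1
    simp only [Matrix.cons_val_zero, Matrix.cons_val_one] at h2
    have hpos : 0 < y - x ^ 2 := hδ.trans h1
    have h3 : y - x ^ 2 < Real.exp (2 * B) := by
      rw [← Real.log_lt_iff_lt_exp hpos]
      linarith [(abs_lt.1 h2.1).1]
    have h4 : x ^ 2 ≤ B ^ 2 := sq_le_sq' (abs_lt.1 h2.2).1.le (abs_lt.1 h2.2).2.le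
    have h5 := Real.exp_pos (2 * B)
    rcases hxy with h | h
    · nlinarith [h2.2]
    · rw [abs_of_pos (by nlinarith [sq_nonneg x])] at h
      linarith
  have key := eq_zero_of_chart_line_integrals (Φ := parabolicChart) (fun _ => rfl) (fun _ => rfl)
    K.isCompact continuous_parabolicChart hG hGB (α := α) (fun a b hab => ?_) hxK
  · have e1 : parabolicChart (planeMap α u₀) 0 = Real.exp (-2 * u₀ 0) + u₀ 1 ^ 2 := by
      rw [← planeMap_sq_add_sq α u₀, ← add_assoc]
      rfl
    have e2 : ![u₀ 0, u₀ 1] = u₀ := by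
      ext i; fin_cases i <;> rfl
    rw [e1] at key
    rw [← e2, ← hG1, key, zero_mul]
  · set c := a / 2
    have hline : ∀ x, a * x + b - x ^ 2 = (b + c ^ 2) - (x - c) ^ 2 := by
      intro x; simp only [c]; ring
    -- If b + c² ≤ 0, the line does not enter the region w > ρ² and corresponds to no geodesic; G
    -- vanishes on it.
    rcases le_or_gt (b + c ^ 2) 0 with hneg | hpos
    · have : ∀ x, G (x, a * x + b) = 0 := fun x => hG0 _ (by
        simp only [hline]
        nlinarith [sq_nonneg (x - c)])
      simp [this]
    · set R := √(b + c ^ 2)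
      have hR : 0 < R := Real.sqrt_pos.2 hpos
      have hR2 : R ^ 2 = b + c ^ 2 := Real.sq_sqrt hpos.le
      have hC : ∀ s, Real.cosh s ≠ 0 := fun s => (Real.cosh_pos s).ne'
      set ρ : ℝ → ℝ := fun s => c + R * (Real.sinh s / Real.cosh s)
      set τ : ℝ → ℝ := fun s => Real.log (Real.cosh s) - Real.log R
      have hexp : ∀ s, Real.exp (-2 * τ s) = R ^ 2 / Real.cosh s ^ 2 := by
        intro s
        have : -2 * τ s = Real.log (R / Real.cosh s) * 2 := by
          rw [Real.log_div hR.ne' (hC s)]; simp only [τ]; ring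
        rw [this, Real.exp_mul, Real.exp_log (div_pos hR (Real.cosh_pos s)), Real.rpow_two,
          div_pow]
      have hon : ∀ s, Real.exp (-2 * τ s) + ρ s ^ 2 = a * ρ s + b := by
        intro s
        have h1 := hline (ρ s)
        have h2 : (ρ s - c) ^ 2 = R ^ 2 - R ^ 2 / Real.cosh s ^ 2 := by
          have := hC s
          simp only [ρ]
          field_simp
          linear_combination -R ^ 2 * Real.cosh_sq s
        rw [hexp]
        linarith
      have hesc := isEscaping_halfCircle hQ α c hR
      have h0 := hx _ hesc fun s hs => hab ![τ s, ρ s] hs (by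
        have : parabolicChart (planeMap α ![τ s, ρ s]) 0 = Real.exp (-2 * τ s) + ρ s ^ 2 := by
          rw [show ρ s ^ 2 = (![τ s, ρ s] : Coord 2) 1 ^ 2 from rfl, ← planeMap_sq_add_sq α,
            ← add_assoc]
          rfl
        rw [this, hon]
        rfl)
      have hρd : ∀ s, HasDerivAt ρ (R / Real.cosh s ^ 2) s := by
        intro s
        exact (((hasDerivAt_sinh_div_cosh s).const_mul R).const_add c).congr_deriv (by ring)
      have hinj : Function.Injective ρ := by
        intro s s' h
        have h1 : Real.sinh s / Real.cosh s = Real.sinh s' / Real.cosh s' :=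
          mul_left_cancel₀ hR.ne' (add_left_cancel h)
        rw [← Real.tanh_eq_sinh_div_cosh, ← Real.tanh_eq_sinh_div_cosh] at h1
        exact Real.tanh_injective h1
      -- The geodesic covers |x - c| < R. The rest of the line lies outside the region w > ρ², so it
      -- does not contribute and the change of variables by ρ computes the whole integral.
      have hrange : ∀ x ∉ ρ '' univ, G (x, a * x + b) = 0 := by
        intro x hx
        refine hG0 _ ?_
        simp only [hline, ← hR2]
        by_contra hlt
        have h1 : (x - c) ^ 2 < R ^ 2 := by linarith
        have h2 := abs_lt.1 (abs_lt_of_sq_lt_sq h1 hR.le)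
        refine hx ⟨Real.artanh ((x - c) / R), trivial, ?_⟩
        simp only [ρ]
        rw [← Real.tanh_eq_sinh_div_cosh, Real.tanh_artanh]
        · field_simp
          ring
        · rw [mem_Ioo, lt_div_iff₀ hR, div_lt_iff₀ hR]
          constructor <;> linarith
      rw [← setIntegral_eq_integral_of_forall_compl_eq_zero hrange,
        integral_image_eq_integral_abs_deriv_smul MeasurableSet.univ
          (fun s _ => (hρd s).hasDerivWithinAt) hinj.injOn, setIntegral_univ]
      have hfin : ∀ s, |R / Real.cosh s ^ 2| • G (ρ s, a * ρ s + b) =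
          R⁻¹ * F (planeMap α ![τ s, ρ s]) := by
        intro s
        have := hC s
        rw [← hG1 (ρ s) (τ s), hon, hexp, abs_of_pos (by positivity), smul_eq_mul]
        field_simp
      simp only [hfin]
      rw [integral_const_mul]
      change ∫ s, F (planeMap α ![τ s, ρ s]) = 0 at h0
      rw [h0, mul_zero]

end WarpSupport

/-! ### The metrics of the examples as warped metrics -/

section Example

/-- The coefficients of the entire function `sinSqQuotient`. -/
def sinSqCoeff (n : ℕ) : ℝ := -(1 / 2) * ((-1) ^ n * 4 ^ (n + 2) / (2 * (n + 2)).factorial)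

/-- The entire function `H` with `sin² r = r² + r⁴ H(r²)`. -/
def sinSqQuotient (u : ℝ) : ℝ := FormalMultilinearSeries.ofScalarsSum (E := ℝ) sinSqCoeff u

/-- The ratio of consecutive coefficients tends to 0, so the power series has infinite radius of
convergence. -/
lemma contDiff_sinSqQuotient : ContDiff ℝ ∞ sinSqQuotient := by
  have hne : ∀ n, sinSqCoeff n ≠ 0 := fun n => by
    unfold sinSqCoeff
    positivity
  have hratio : ∀ n : ℕ, ‖sinSqCoeff n.succ‖ / ‖sinSqCoeff n‖ =
      4 / ((2 * n + 6) * (2 * n + 5)) := by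
    intro n
    have h : (2 * (n + 1 + 2)).factorial = (2 * n + 6) * ((2 * n + 5) * (2 * (n + 2)).factorial) := by
      rw [show 2 * (n + 1 + 2) = 2 * (n + 2) + 1 + 1 by ring, Nat.factorial_succ,
        Nat.factorial_succ]
      ring
    have hf : ((2 * (n + 2)).factorial : ℝ) ≠ 0 := by positivity
    simp only [sinSqCoeff, Nat.succ_eq_add_one, norm_mul, norm_div, norm_neg, norm_pow, norm_one,
      one_pow, h, Nat.cast_mul, Nat.cast_add, Nat.cast_ofNat, Real.norm_natCast]
    rw [Real.norm_of_nonneg (by positivity : (0 : ℝ) ≤ 2 * n + 6),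
      Real.norm_of_nonneg (by positivity : (0 : ℝ) ≤ 2 * n + 5)]
    simp only [Real.norm_ofNat]
    field_simp
    ring
  have hlim : Tendsto (fun n : ℕ => ‖sinSqCoeff n.succ‖ / ‖sinSqCoeff n‖) atTop (𝓝 0) := by
    simp only [hratio]
    refine Tendsto.div_atTop tendsto_const_nhds ?_
    refine tendsto_atTop_mono (f := fun n : ℕ => (n : ℝ)) (fun n => ?_) tendsto_natCast_atTop_atTop
    nlinarith [(Nat.cast_nonneg n : (0 : ℝ) ≤ n)]
  have hr := FormalMultilinearSeries.ofScalars_radius_eq_top_of_tendsto ℝ sinSqCoeff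
    (Eventually.of_forall hne) hlim
  have hb := (FormalMultilinearSeries.ofScalars ℝ sinSqCoeff).hasFPowerSeriesOnBall
    (by rw [hr]; exact ENNReal.zero_lt_top)
  rw [hr] at hb
  have han := hb.analyticOnNhd
  rw [Metric.eball_top_eq_univ] at han
  exact contDiff_iff_contDiffAt.2 fun x => (han x trivial).contDiffAt

/-- The cosine series in sin² r = (1 - cos 2r)/2, with its first two terms split off. -/
lemma sin_sq_eq (r : ℝ) : Real.sin r ^ 2 = r ^ 2 + r ^ 4 * sinSqQuotient (r ^ 2) := by
  have h1 := (hasSum_nat_add_iff' 2).2 (Real.hasSum_cos (2 * r))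
  have h2 : ∑' n, -2 * r ^ 4 * (sinSqCoeff n * (r ^ 2) ^ n) = Real.cos (2 * r) -
      ∑ i ∈ Finset.range 2, (-1) ^ i * (2 * r) ^ (2 * i) / (2 * i).factorial := by
    rw [← h1.tsum_eq]
    refine tsum_congr fun n => ?_
    have e : (2 * r) ^ (2 * (n + 2)) = 4 ^ (n + 2) * (r ^ 4 * (r ^ 2) ^ n) := by
      rw [mul_pow, pow_mul 2 2]
      norm_num
      ring
    rw [e, sinSqCoeff]
    ring
  rw [tsum_mul_left] at h2
  have h3 : sinSqQuotient (r ^ 2) = ∑' n, sinSqCoeff n * (r ^ 2) ^ n := by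
    simp [sinSqQuotient, FormalMultilinearSeries.ofScalarsSum_eq_tsum]
  rw [← h3] at h2
  simp only [Finset.sum_range_succ, Finset.sum_range_zero] at h2
  norm_num at h2
  have h4 := Real.cos_sq r
  have h5 := Real.sin_sq_add_cos_sq r
  linarith

/-- The function `(f² - r²) / r⁴`, continued smoothly to the axis `r = 0`. -/
def warpCoeff (f : ℝ → ℝ → ℝ) (p : Coord 3) : ℝ :=
  if rad p < 1 then sinSqQuotient (p 1 ^ 2 + p 2 ^ 2)
  else (f (rad p) (p 0) ^ 2 - rad p ^ 2) / rad p ^ 4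

lemma rad_nonneg (p : Coord 3) : 0 ≤ rad p := Real.sqrt_nonneg _

lemma continuous_rad : Continuous rad := by
  unfold rad
  fun_prop

variable {f : ℝ → ℝ → ℝ}

/-- The two branches agree for 0 < r < 1, because 1 < 3π/4 and f = sin r there. -/
lemma IsWarpingFunction.warpCoeff_eq (hf : IsWarpingFunction f) {p : Coord 3} (hp : 0 < rad p) :
    warpCoeff f p = (f (rad p) (p 0) ^ 2 - rad p ^ 2) / rad p ^ 4 := by
  unfold warpCoeff
  split_ifs with h
  · rw [hf.sphere (rad p) (p 0) hp.le (by linarith [Real.pi_gt_three]), sin_sq_eq, ← rad_sq]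
    field_simp
    ring
  · rfl

/-- Near the axis the coefficient is an entire function of x² + y²; off the axis both r and f(r, t)
are smooth. -/
lemma IsWarpingFunction.contDiff_warpCoeff (hf : IsWarpingFunction f) :
    ContDiff ℝ ∞ (warpCoeff f) := by
  rw [contDiff_iff_contDiffAt]
  intro p
  rcases (rad_nonneg p).eq_or_lt with h0 | h0
  · have h1 : warpCoeff f =ᶠ[𝓝 p] fun p => sinSqQuotient (p 1 ^ 2 + p 2 ^ 2) := by
      filter_upwards [continuous_rad.continuousAt.eventually_lt continuousAt_const
        (by rw [← h0]; exact one_pos : rad p < 1)] with q hq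
      simp only [warpCoeff, if_pos hq]
    refine ContDiffAt.congr_of_eventuallyEq ?_ h1
    exact (contDiff_sinSqQuotient.comp (by fun_prop)).contDiffAt
  · have h1 : warpCoeff f =ᶠ[𝓝 p] fun p => (f (rad p) (p 0) ^ 2 - rad p ^ 2) / rad p ^ 4 := by
      filter_upwards [continuousAt_const.eventually_lt continuous_rad.continuousAt h0] with q hq
      exact hf.warpCoeff_eq hq
    refine ContDiffAt.congr_of_eventuallyEq ?_ h1
    have hrad : ContDiffAt ℝ ∞ rad p := by
      refine ContDiffAt.sqrt (by fun_prop) ?_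
      rw [← rad_sq]
      positivity
    have hff : ContDiffAt ℝ ∞ (fun x : ℝ × ℝ => f x.1 x.2) (rad p, p 0) :=
      hf.smooth.contDiffAt (prod_mem_nhds (Ici_mem_nhds h0) univ_mem)
    have hfp : ContDiffAt ℝ ∞ (fun q => f (rad q) (q 0)) p :=
      ContDiffAt.comp (g := fun x : ℝ × ℝ => f x.1 x.2) (f := fun q : Coord 3 => (rad q, q 0)) p hff
        (hrad.prodMk (by fun_prop : ContDiffAt ℝ ∞ (fun q : Coord 3 => q 0) p))
    exact ((hfp.pow 2).sub (hrad.pow 2)).div (hrad.pow 4) (by positivity)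

lemma IsWarpingFunction.pos (hf : IsWarpingFunction f) {r : ℝ} (hr : 0 < r) (t : ℝ) :
    0 < f r t := by
  have hpi := Real.pi_pos
  rcases le_total r (3 * Real.pi / 4) with h1 | h1
  · rw [hf.sphere r t hr.le h1]
    exact Real.sin_pos_of_pos_of_lt_pi hr (by linarith)
  rcases le_total r Real.pi with h2 | h2
  · obtain ⟨φ, hφ⟩ := hf.transition
    rw [(hφ r h1 h2).2.2 t]
    exact (hφ r h1 h2).1
  rcases le_or_gt r (2 * Real.pi) with h3 | h3
  · rw [hf.flat r t h2 h3]
    linarith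
  rcases le_or_gt t 0 with h4 | h4
  · rw [hf.outer_nonpos r t h3.le h4]
    linarith
  · linarith [hf.outer_pos r t h3 h4]

lemma IsWarpingFunction.isAdmissible (hf : IsWarpingFunction f) :
    IsAdmissible (warpCoeff f) := by
  refine ⟨hf.contDiff_warpCoeff, fun p => ?_⟩
  rw [← rad_sq]
  rcases (rad_nonneg p).eq_or_lt with h0 | h0
  · simp [← h0]
  · have := hf.pos h0 (p 0)
    have e : 1 + warpCoeff f p * rad p ^ 2 = f (rad p) (p 0) ^ 2 / rad p ^ 2 := by
      rw [hf.warpCoeff_eq h0]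
      field_simp
      ring
    rw [e]
    positivity

lemma eq_zero_of_rad_eq_zero {p : Coord 3} (h : rad p = 0) : p 1 = 0 ∧ p 2 = 0 := by
  have := rad_sq p
  rw [h] at this
  constructor <;> nlinarith [sq_nonneg (p 1), sq_nonneg (p 2)]

/-- From dx² + dy² = dr² + r² dα² follows dr² + f² dα² = dx² + dy² + ((f² - r²)/r⁴)(r² dα)². -/
lemma IsWarpingFunction.horizontal_eq (hf : IsWarpingFunction f) {p : Coord 3} (hp : rad p ≠ 0) :
    Matrix.vecMulVec (formR p) (formR p)
      + f (rad p) (p 0) ^ 2 • Matrix.vecMulVec (formAngle p) (formAngle p) =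
    Matrix.diagonal ![0, 1, 1] + warpCoeff f p • Matrix.vecMulVec (angForm p) (angForm p) := by
  have h2 := rad_sq p
  rw [hf.warpCoeff_eq ((rad_nonneg p).lt_of_ne' hp)]
  ext i j
  fin_cases i <;> fin_cases j <;>
    simp [formR, formAngle, angForm] <;> field_simp <;>
    first | ring1 | linear_combination (-(rad p) ^ 2) * h2

lemma IsWarpingFunction.euclMetric_eq (hf : IsWarpingFunction f) :
    euclMetric f = warpMetric 0 (warpCoeff f) := by
  ext1 p
  unfold euclMetric warpMetric
  split_ifs with h
  · obtain ⟨h1, h2⟩ := eq_zero_of_rad_eq_zero h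
    ext i j
    fin_cases i <;> fin_cases j <;> simp [formT, angForm, h1, h2]
  · rw [add_assoc, hf.horizontal_eq h]
    simp

lemma IsWarpingFunction.hypMetric_eq (hf : IsWarpingFunction f) :
    hypMetric f = warpMetric 1 (warpCoeff f) := by
  ext1 p
  unfold hypMetric warpMetric
  split_ifs with h
  · obtain ⟨h1, h2⟩ := eq_zero_of_rad_eq_zero h
    ext i j
    fin_cases i <;> fin_cases j <;> simp [formT, angForm, h1, h2]
  · rw [hf.horizontal_eq h, mul_one]

end Example

/-! ### Cylindrical coordinates, homogeneity and conjugate points -/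

section Cylindrical

/-- Cylindrical coordinates `(t, r, α)` as a map of `ℝ³`. -/
def cylChart (u : Coord 3) : Coord 3 := cyl (u 0) (u 1) (u 2)

lemma contDiff_cylChart : ContDiff ℝ ∞ cylChart := by
  refine contDiff_pi.2 fun i => ?_
  fin_cases i <;> simp [cylChart, cyl] <;> fun_prop

lemma fderiv_cylChart (u v : Coord 3) : fderiv ℝ cylChart u v =
    ![v 0, Real.cos (u 2) * v 1 - u 1 * Real.sin (u 2) * v 2,
      Real.sin (u 2) * v 1 + u 1 * Real.cos (u 2) * v 2] := by
  have hc : ∀ i, HasFDerivAt (fun q : Coord 3 => q i) (ContinuousLinearMap.proj i) u := fun i =>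
    hasFDerivAt_apply (𝕜 := ℝ) (F' := fun _ : Fin 3 => ℝ) i u
  ext i
  rw [fderiv_coord_apply (contDiff_cylChart.differentiable (by simp) u)]
  fin_cases i
  · exact DFunLike.congr_fun (hc 0).fderiv v
  · refine (DFunLike.congr_fun ((hc 1).mul (hc 2).cos).fderiv v).trans ?_
    simp
    ring
  · refine (DFunLike.congr_fun ((hc 1).mul (hc 2).sin).fderiv v).trans ?_
    simp
    ring

lemma rad_cyl (t α : ℝ) {r : ℝ} (hr : 0 ≤ r) : rad (cyl t r α) = r := by
  have : (r * Real.cos α) ^ 2 + (r * Real.sin α) ^ 2 = r ^ 2 := by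
    linear_combination r ^ 2 * Real.cos_sq_add_sin_sq α
  simp [rad, cyl, this, Real.sqrt_sq hr]

variable {l : ℝ} {W : ℝ → ℝ} {u : Coord 3}

/-- The metric `dt² + e^{2lt} (dr² + W(r)² dα²)` in the coordinates `(t, r, α)`. -/
def cylMetric (l : ℝ) (W : ℝ → ℝ) : MetricTensor 3 := fun u =>
  Matrix.diagonal ![1, Real.exp (2 * l * u 0), Real.exp (2 * l * u 0) * W (u 1) ^ 2]

lemma innerAt_cylMetric (u v w : Coord 3) : innerAt (cylMetric l W) u v w =
    v 0 * w 0 + Real.exp (2 * l * u 0) * (v 1 * w 1 + W (u 1) ^ 2 * (v 2 * w 2)) := by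
  simp only [innerAt, cylMetric, Matrix.mulVec_diagonal, dotProduct, Fin.sum_univ_three,
    Matrix.cons_val]
  ring

lemma eventually_ne_zero (hW : ContDiff ℝ ∞ W) (h : W (u 1) ≠ 0) :
    ∀ᶠ q : Coord 3 in 𝓝 u, W (q 1) ≠ 0 :=
  (hW.continuous.comp (continuous_apply 1)).continuousAt.eventually_ne h

lemma regularAt_cylMetric (hW : ContDiff ℝ ∞ W) (h : W (u 1) ≠ 0) :
    RegularAt (cylMetric l W) u := by
  refine ⟨Eventually.of_forall fun p i j => ?_, ?_⟩
  · fin_cases i <;> fin_cases j <;> simp [cylMetric] <;> fun_prop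
  · filter_upwards [eventually_ne_zero hW h] with q hq
    refine Matrix.PosDef.diagonal fun i => ?_
    fin_cases i <;> simp <;> positivity

/-- The vector-valued Christoffel form of `cylMetric l W`. -/
def cylChristoffel (l : ℝ) (W : ℝ → ℝ) (u v w : Coord 3) : Coord 3 :=
  ![-l * Real.exp (2 * l * u 0) * (v 1 * w 1 + W (u 1) ^ 2 * (v 2 * w 2)),
    l * (v 0 * w 1 + v 1 * w 0) - W (u 1) * deriv W (u 1) * (v 2 * w 2),
    l * (v 0 * w 2 + v 2 * w 0) + deriv W (u 1) / W (u 1) * (v 1 * w 2 + v 2 * w 1)]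

lemma hasFDerivAt_comp_coord_one (hW : ContDiff ℝ ∞ W) (u : Coord 3) :
    HasFDerivAt (fun q : Coord 3 => W (q 1))
      (deriv W (u 1) • (ContinuousLinearMap.proj 1 : Coord 3 →L[ℝ] ℝ)) u :=
  HasDerivAt.comp_hasFDerivAt u (hW.differentiable (by simp) (u 1)).hasDerivAt
    (hasFDerivAt_apply (𝕜 := ℝ) (F' := fun _ : Fin 3 => ℝ) 1 u)

lemma christoffelVec_cylMetric (hW : ContDiff ℝ ∞ W) (h : W (u 1) ≠ 0) (v w : Coord 3) :
    christoffelVec (cylMetric l W) u v w = cylChristoffel l W u v w := by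
  have hg := regularAt_cylMetric (l := l) hW h
  have hd : ∀ v w z : Coord 3, fderiv ℝ (fun q => innerAt (cylMetric l W) q w z) u v =
      2 * l * v 0 * Real.exp (2 * l * u 0) * (w 1 * z 1 + W (u 1) ^ 2 * (w 2 * z 2))
      + Real.exp (2 * l * u 0) * (2 * W (u 1) * deriv W (u 1) * v 1 * (w 2 * z 2)) := by
    intro v w z
    have hd := ((hasFDerivAt_exp_coord_zero l u).mul ((((hasFDerivAt_comp_coord_one hW u).pow
      2).mul_const (w 2 * z 2)).const_add (w 1 * z 1))).const_add (w 0 * z 0)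
    simp only [innerAt_cylMetric]
    refine (DFunLike.congr_fun hd.fderiv v).trans ?_
    simp only [_root_.add_apply, _root_.smul_apply, ContinuousLinearMap.proj_apply, smul_eq_mul,
      nsmul_eq_mul]
    push_cast
    ring
  refine eq_of_innerAt_eq hg.posDef.self_of_nhds fun z => ?_
  rw [innerAt_christoffelVec hg]
  simp only [hd]
  simp only [innerAt_cylMetric, cylChristoffel, Matrix.cons_val]
  field_simp
  ring

lemma fderiv_cylChristoffel (hW : ContDiff ℝ ∞ W) (h : W (u 1) ≠ 0) (X v w : Coord 3) :
    fderiv ℝ (fun q => cylChristoffel l W q v w) u X =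
      ![-l * Real.exp (2 * l * u 0) * (2 * l * X 0 * (v 1 * w 1 + W (u 1) ^ 2 * (v 2 * w 2))
          + 2 * W (u 1) * deriv W (u 1) * X 1 * (v 2 * w 2)),
        -(deriv W (u 1) ^ 2 + W (u 1) * deriv (deriv W) (u 1)) * X 1 * (v 2 * w 2),
        (deriv (deriv W) (u 1) * W (u 1) - deriv W (u 1) ^ 2) / W (u 1) ^ 2 * X 1
          * (v 1 * w 2 + v 2 * w 1)] := by
  have h1 := hasFDerivAt_comp_coord_one hW u
  have h2 := hasFDerivAt_comp_coord_one (contDiff_infty_iff_deriv.1 hW).2 u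
  have e0 := ((hasFDerivAt_exp_coord_zero l u).const_mul (-l)).mul
    (((h1.pow 2).mul_const (v 2 * w 2)).const_add (v 1 * w 1))
  have e1 := ((h1.mul h2).mul_const (v 2 * w 2)).const_sub (l * (v 0 * w 1 + v 1 * w 0))
  have hd : HasDerivAt (fun r => deriv W r / W r) _ (u 1) :=
    ((contDiff_infty_iff_deriv.1 hW).2.differentiable (by simp) (u 1)).hasDerivAt.div
      (hW.differentiable (by simp) (u 1)).hasDerivAt h
  have e2 := ((hd.comp_hasFDerivAt u (hasFDerivAt_apply (𝕜 := ℝ) (F' := fun _ : Fin 3 => ℝ)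
    1 u)).mul_const (v 1 * w 2 + v 2 * w 1)).const_add (l * (v 0 * w 2 + v 2 * w 0))
  have hall : DifferentiableAt ℝ (fun q => cylChristoffel l W q v w) u := by
    refine differentiableAt_pi.2 fun i => ?_
    fin_cases i
    · exact e0.differentiableAt
    · exact e1.differentiableAt
    · exact e2.differentiableAt
  ext i
  rw [fderiv_coord_apply hall]
  fin_cases i
  · refine (DFunLike.congr_fun e0.fderiv X).trans ?_
    simp
    ring
  · refine (DFunLike.congr_fun e1.fderiv X).trans ?_
    simp
    ring
  · refine (DFunLike.congr_fun e2.fderiv X).trans ?_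
    simp
    field_simp

/-- The constant curvature -l² of the model, plus the contribution of the surface dr² + W² dα²,
whose Gauss curvature is -W''/W and which only sees the components in r and α. -/
lemma curvature_cylMetric (hW : ContDiff ℝ ∞ W) (h : W (u 1) ≠ 0) (X Y Z : Coord 3) :
    curvature (cylMetric l W) u X Y Z =
      -l ^ 2 • (innerAt (cylMetric l W) u Y Z • X - innerAt (cylMetric l W) u X Z • Y)
      - (deriv (deriv W) (u 1) / W (u 1)) •
        ((Y 1 * Z 1 + W (u 1) ^ 2 * (Y 2 * Z 2)) • ![0, X 1, X 2]
          - (X 1 * Z 1 + W (u 1) ^ 2 * (X 2 * Z 2)) • ![0, Y 1, Y 2]) := by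
  have hE : ∀ v w, (fun q => christoffelVec (cylMetric l W) q v w) =ᶠ[𝓝 u]
      fun q => cylChristoffel l W q v w := fun v w => by
    filter_upwards [eventually_ne_zero hW h] with q hq using christoffelVec_cylMetric hW hq v w
  rw [curvature_eq (regularAt_cylMetric hW h)]
  simp only [(hE _ _).fderiv_eq, fderiv_cylChristoffel hW h, christoffelVec_cylMetric hW h,
    innerAt_cylMetric]
  ext i
  fin_cases i <;> simp [cylChristoffel] <;> field_simp <;> ring

variable {f : ℝ → ℝ → ℝ}

/-- In cylindrical coordinates x dy - y dx = r² dα. The metric in these coordinates is positive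
definite only where W ≠ 0, so the statement is local. -/
lemma IsWarpingFunction.localIsometryAt_cylChart (hf : IsWarpingFunction f) (l : ℝ)
    (hW : ContDiff ℝ ∞ W) (h0 : 0 < u 1) (h : W (u 1) ≠ 0)
    (hE : ∀ᶠ q : Coord 3 in 𝓝 u, f (q 1) (q 0) = W (q 1)) :
    LocalIsometryAt (cylMetric l W) (warpMetric l (warpCoeff f)) cylChart u := by
  refine ⟨contDiff_cylChart, (hf.isAdmissible.isRiemannianMetric l).regularAt _,
    regularAt_cylMetric hW h, ?_⟩
  filter_upwards [hE, continuousAt_const.eventually_lt (continuous_apply 1).continuousAt h0]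
    with q hq hq0
  have hr : rad (cylChart q) = q 1 := rad_cyl _ _ hq0.le
  have hc : warpCoeff f (cylChart q) = (W (q 1) ^ 2 - q 1 ^ 2) / q 1 ^ 4 := by
    rw [hf.warpCoeff_eq (hr.symm ▸ hq0), hr, ← hq]
    rfl
  have hs := Real.cos_sq_add_sin_sq (q 2)
  have key : ∀ v w, innerAt (cylMetric l W) q v w = innerAt (warpMetric l (warpCoeff f))
      (cylChart q) (fderiv ℝ cylChart q v) (fderiv ℝ cylChart q w) := by
    intro v w
    rw [innerAt_cylMetric, innerAt_warpMetric, hc]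
    simp only [fderiv_cylChart, cylChart, cyl, Matrix.cons_val]
    have e : ∀ v : Coord 3, q 1 * Real.cos (q 2) * (Real.sin (q 2) * v 1
        + q 1 * Real.cos (q 2) * v 2) - q 1 * Real.sin (q 2) * (Real.cos (q 2) * v 1
        - q 1 * Real.sin (q 2) * v 2) = q 1 ^ 2 * v 2 := fun v => by
      linear_combination q 1 ^ 2 * v 2 * hs
    rw [mul_assoc (_ / _), e, e]
    field_simp
    linear_combination (-(Real.exp (2 * l * q 0)) * (v 1 * w 1 + q 1 ^ 2 * (v 2 * w 2))) * hs
  ext i j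
  rw [pullback, Matrix.of_apply, ← key, innerAt_single]

lemma IsWarpingFunction.localIsometryAt_sin (hf : IsWarpingFunction f) (l : ℝ)
    (h : u 1 = Real.pi / 2) :
    LocalIsometryAt (cylMetric l Real.sin) (warpMetric l (warpCoeff f)) cylChart u := by
  have hpi := Real.pi_pos
  refine hf.localIsometryAt_cylChart l Real.contDiff_sin (by rw [h]; positivity) (by simp [h]) ?_
  filter_upwards [(continuous_apply 1).continuousAt (Ioo_mem_nhds (a := 0)
    (b := 3 * Real.pi / 4) (by rw [h]; positivity) (by rw [h]; linarith))] with q hq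
  exact hf.sphere _ _ hq.1.le hq.2.le

lemma IsWarpingFunction.localIsometryAt_cone (hf : IsWarpingFunction f) (l : ℝ)
    (h : u 1 = 3 * Real.pi / 2) :
    LocalIsometryAt (cylMetric l fun r => 2 + r - Real.pi) (warpMetric l (warpCoeff f))
      cylChart u := by
  have hpi := Real.pi_pos
  refine hf.localIsometryAt_cylChart l (by fun_prop) (by rw [h]; positivity)
    (by rw [h]; linarith) ?_
  filter_upwards [(continuous_apply 1).continuousAt (Ioo_mem_nhds (a := Real.pi)
    (b := 2 * Real.pi) (by rw [h]; linarith) (by rw [h]; linarith))] with q hq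
  exact hf.flat _ _ hq.1.le hq.2.le

/-- All sectional curvatures of `g` at `p` are equal to `κ`. -/
def HasConstantCurvatureAt {n : ℕ} (g : MetricTensor n) (κ : ℝ) (p : Coord n) : Prop :=
  ∀ X Y, innerAt g p (curvature g p X Y Y) X =
    κ * (innerAt g p X X * innerAt g p Y Y - innerAt g p X Y ^ 2)

lemma LocalIsometryAt.hasConstantCurvatureAt_iff {n : ℕ} {g h : MetricTensor n}
    {ψ : Coord n → Coord n} {u : Coord n} (H : LocalIsometryAt h g ψ u) (κ : ℝ) :
    HasConstantCurvatureAt g κ (ψ u) ↔ HasConstantCurvatureAt h κ u := by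
  unfold HasConstantCurvatureAt
  rw [H.surjective.forall]
  refine forall_congr' fun X => ?_
  rw [H.surjective.forall]
  refine forall_congr' fun Y => ?_
  rw [H.innerAt_curvature, H.innerAt_fderiv, H.innerAt_fderiv, H.innerAt_fderiv]

/-- An isometry would carry a point with r = 3π/2, where W = 2 + r - π has W'' = 0 and all sectional
curvatures are -l², to one with r = π/2, where W = sin and the plane of ∂_r, ∂_α has a different
curvature. -/
lemma IsWarpingFunction.not_isHomogeneous (hf : IsWarpingFunction f) (l : ℝ) :
    ¬ IsHomogeneous (warpMetric l (warpCoeff f)) := by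
  intro hom
  have hR := hf.isAdmissible.isRiemannianMetric l
  obtain ⟨φ, ⟨h1, -, h3⟩, h4⟩ := hom (cylChart ![0, 3 * Real.pi / 2, 0])
    (cylChart ![0, Real.pi / 2, 0])
  have hφ : LocalIsometryAt (warpMetric l (warpCoeff f)) (warpMetric l (warpCoeff f)) φ
      (cylChart ![0, 3 * Real.pi / 2, 0]) :=
    ⟨h1, hR.regularAt _, hR.regularAt _, Eventually.of_forall fun q => by rw [h3]⟩
  have hs := hf.localIsometryAt_sin (u := ![0, Real.pi / 2, 0]) l rfl
  have hcone := hf.localIsometryAt_cone (u := ![0, 3 * Real.pi / 2, 0]) l rfl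
  have c1 : HasConstantCurvatureAt (cylMetric l fun r => 2 + r - Real.pi) (-l ^ 2)
      ![0, 3 * Real.pi / 2, 0] := by
    intro X Y
    have hd : deriv (fun r : ℝ => 2 + r - Real.pi) = fun _ => 1 := by
      ext r
      simp
    rw [curvature_cylMetric (by fun_prop) (by
      have := Real.pi_pos
      simp only [Matrix.cons_val]
      linarith), hd]
    simp only [deriv_const, zero_div, zero_smul, sub_zero, innerAt_cylMetric, Pi.smul_apply,
      Pi.sub_apply, smul_eq_mul]
    ring
  rw [← hcone.hasConstantCurvatureAt_iff, ← hφ.hasConstantCurvatureAt_iff, h4,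
    hs.hasConstantCurvatureAt_iff] at c1
  have c2 := c1 ![0, 1, 0] ![0, 0, 1]
  rw [curvature_cylMetric Real.contDiff_sin (by simp)] at c2
  simp [innerAt_cylMetric] at c2

end Cylindrical

/-! ### Conjugate points -/

section Conjugate

variable {l : ℝ} {f : ℝ → ℝ → ℝ}

/-- The curve `s ↦ (τ(s), π/2, β(s))` in the coordinates `(t, r, α)`. -/
def equatorCurve (τ β : ℝ → ℝ) (s : ℝ) : Coord 3 := ![τ s, Real.pi / 2, β s]

lemma contDiff_vec {a b c : ℝ → ℝ} (ha : ContDiff ℝ ∞ a) (hb : ContDiff ℝ ∞ b)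
    (hc : ContDiff ℝ ∞ c) : ContDiff ℝ ∞ fun s => (![a s, b s, c s] : Coord 3) := by
  refine contDiff_pi.2 fun i => ?_
  fin_cases i
  · exact ha
  · exact hb
  · exact hc

lemma deriv_vec {a b c : ℝ → ℝ} (ha : ContDiff ℝ ∞ a) (hb : ContDiff ℝ ∞ b)
    (hc : ContDiff ℝ ∞ c) (s : ℝ) :
    deriv (fun s => (![a s, b s, c s] : Coord 3)) s = ![deriv a s, deriv b s, deriv c s] := by
  refine (hasDerivAt_pi.2 fun i => ?_).deriv
  fin_cases i
  · exact (ha.differentiable (by simp) s).hasDerivAt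
  · exact (hb.differentiable (by simp) s).hasDerivAt
  · exact (hc.differentiable (by simp) s).hasDerivAt

/-- A geodesic of the surface `r = π/2` on which `α` increases by `π` connects conjugate points:
the field `sin(β - α) ∂_r` is a Jacobi field. -/
lemma IsWarpingFunction.areConjugate_of_equator (hf : IsWarpingFunction f) (l : ℝ) {τ β : ℝ → ℝ}
    {a b t α : ℝ} (hτ : ContDiff ℝ ∞ τ) (hβ : ContDiff ℝ ∞ β)
    (hτ2 : ∀ s, deriv (deriv τ) s = l * Real.exp (2 * l * τ s) * deriv β s ^ 2)
    (hβ2 : ∀ s, deriv (deriv β) s = -(2 * l * deriv τ s * deriv β s)) (hab : a < b)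
    (hτa : τ a = t) (hτb : τ b = t) (hβa : β a = α) (hβb : β b = α + Real.pi) :
    AreConjugate (warpMetric l (warpCoeff f)) (cyl t (Real.pi / 2) α)
      (cyl t (Real.pi / 2) (α + Real.pi)) := by
  have hτ' : ContDiff ℝ ∞ (deriv τ) := (contDiff_infty_iff_deriv.1 hτ).2
  have hβ' : ContDiff ℝ ∞ (deriv β) := (contDiff_infty_iff_deriv.1 hβ).2
  have hγ : ContDiff ℝ ∞ (equatorCurve τ β) := contDiff_vec hτ contDiff_const hβ
  have hdγ : deriv (equatorCurve τ β) = fun s => ![deriv τ s, 0, deriv β s] := by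
    ext1 s
    have := deriv_vec hτ (contDiff_const (c := Real.pi / 2)) hβ s
    rwa [deriv_const] at this
  have hdγs : ContDiff ℝ ∞ (deriv (equatorCurve τ β)) := by
    rw [hdγ]
    exact contDiff_vec hτ' contDiff_const hβ'
  have hH : ∀ s, LocalIsometryAt (cylMetric l Real.sin) (warpMetric l (warpCoeff f)) cylChart
      (equatorCurve τ β s) := fun s => hf.localIsometryAt_sin l rfl
  have hγd := hγ.differentiable (by simp)
  -- At r = π/2 one has W = 1 and W' = 0, so the Christoffel symbols are those of dt² + e^{2lt}(dr²
  -- + dα²).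
  have hchr : ∀ s v w, christoffelVec (cylMetric l Real.sin) (equatorCurve τ β s) v w =
      ![-l * Real.exp (2 * l * τ s) * (v 1 * w 1 + v 2 * w 2), l * (v 0 * w 1 + v 1 * w 0),
        l * (v 0 * w 2 + v 2 * w 0)] := fun s v w => by
    rw [christoffelVec_cylMetric Real.contDiff_sin (by simp [equatorCurve])]
    simp [cylChristoffel, equatorCurve]
  have hgeo : ∀ s, covDeriv (cylMetric l Real.sin) (equatorCurve τ β)
      (deriv (equatorCurve τ β)) s = 0 := fun s => by
    unfold covDeriv
    rw [hchr, hdγ, deriv_vec hτ' contDiff_const hβ', hτ2, hβ2]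
    ext i
    fin_cases i <;> simp <;> ring
  have hdψ : deriv (cylChart ∘ equatorCurve τ β) =
      fun s => fderiv ℝ cylChart (equatorCurve τ β s) (deriv (equatorCurve τ β) s) := by
    ext1 s
    exact fderiv_comp_deriv s (contDiff_cylChart.differentiable (by simp) _) (hγd s)
  have hcov : ∀ V : ℝ → Coord 3, ContDiff ℝ ∞ V →
      covDeriv (warpMetric l (warpCoeff f)) (cylChart ∘ equatorCurve τ β)
        (fun s => fderiv ℝ cylChart (equatorCurve τ β s) (V s)) = fun s =>
      fderiv ℝ cylChart (equatorCurve τ β s)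
        (covDeriv (cylMetric l Real.sin) (equatorCurve τ β) V s) := by
    intro V hV
    ext1 s
    exact (hH s).covDeriv hγd (hV.differentiable (by simp) s)
  have hj : ContDiff ℝ ∞ fun s => Real.sin (β s - α) := by fun_prop
  have hj1 : deriv (fun s => Real.sin (β s - α)) = fun s => Real.cos (β s - α) * deriv β s := by
    ext1 s
    exact (((hβ.differentiable (by simp) s).hasDerivAt.sub_const α).sin).deriv
  have hj2 : ∀ s, HasDerivAt (fun s => Real.cos (β s - α) * deriv β s + l * deriv τ s *
      Real.sin (β s - α)) (-Real.sin (β s - α) * deriv β s * deriv β s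
        + Real.cos (β s - α) * deriv (deriv β) s + (l * deriv (deriv τ) s * Real.sin (β s - α)
        + l * deriv τ s * (Real.cos (β s - α) * deriv β s))) s := fun s => by
    have h1 := (hβ.differentiable (by simp) s).hasDerivAt.sub_const α
    exact (h1.cos.mul (hβ'.differentiable (by simp) s).hasDerivAt).add
      (((hτ'.differentiable (by simp) s).hasDerivAt.const_mul l).mul h1.sin)
  -- The restriction to the equator of a rotation field of the round sphere about a horizontal axis.
  -- Such rotations are isometries of dt² + e^{2lt}(dr² + sin² r dα²), which explains why V is a
  -- Jacobi field.
  set V : ℝ → Coord 3 := fun s => ![0, Real.sin (β s - α), 0] with hV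
  have hVs : ContDiff ℝ ∞ V := contDiff_vec contDiff_const hj contDiff_const
  have hvan : ∀ s, β s = α ∨ β s = α + Real.pi → V s = 0 := by
    intro s h
    have hs : Real.sin (β s - α) = 0 := by rcases h with h | h <;> simp [h]
    ext i
    fin_cases i <;> simp [hV, hs]
  have hcV : covDeriv (cylMetric l Real.sin) (equatorCurve τ β) V = fun s =>
      ![0, Real.cos (β s - α) * deriv β s + l * deriv τ s * Real.sin (β s - α), 0] := by
    ext1 s
    unfold covDeriv
    rw [hchr, hV, hdγ, deriv_vec contDiff_const hj contDiff_const, hj1, deriv_const]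
    ext i
    fin_cases i <;> simp
    ring
  have hcVs : ContDiff ℝ ∞ (covDeriv (cylMetric l Real.sin) (equatorCurve τ β) V) := by
    rw [hcV]
    exact contDiff_vec contDiff_const (by fun_prop) contDiff_const
  have hJ : ∀ s, covDeriv (cylMetric l Real.sin) (equatorCurve τ β)
      (covDeriv (cylMetric l Real.sin) (equatorCurve τ β) V) s
      + curvature (cylMetric l Real.sin) (equatorCurve τ β s) (V s)
        (deriv (equatorCurve τ β) s) (deriv (equatorCurve τ β) s) = 0 := by
    intro s
    rw [hcV, curvature_cylMetric Real.contDiff_sin (by simp [equatorCurve])]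
    unfold covDeriv
    rw [hchr, hV, hdγ, deriv_vec contDiff_const (by fun_prop) contDiff_const, (hj2 s).deriv,
      deriv_const, hτ2, hβ2]
    simp only [innerAt_cylMetric]
    ext i
    fin_cases i <;> simp [equatorCurve]
    ring
  have hγψ : ∀ s, (cylChart ∘ equatorCurve τ β) s = cyl (τ s) (Real.pi / 2) (β s) := fun s => rfl
  refine ⟨cylChart ∘ equatorCurve τ β, a, b, ⟨contDiff_cylChart.comp hγ, fun s => ?_⟩, hab,
    by rw [hγψ, hτa, hβa], by rw [hγψ, hτb, hβb],
    fun s => fderiv ℝ cylChart (equatorCurve τ β s) (V s), ?_, fun s _ => ?_, ?_, ?_, ?_⟩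
  · rw [hdψ, hcov _ hdγs]
    simp only [hgeo, map_zero]
  · exact ((contDiff_cylChart.fderiv_right (m := ∞) (by simp)).comp hγ).clm_apply hVs
  · rw [hcov _ hVs, hcov _ hcVs, hdψ, Function.comp_apply, (hH s).curvature, ← map_add, hJ,
      map_zero]
  · exact (congrArg _ (hvan a (Or.inl hβa))).trans (map_zero _)
  · exact (congrArg _ (hvan b (Or.inr hβb))).trans (map_zero _)
  -- Where β = α + π/2 the field equals ∂_r, so it is not identically zero.
  · obtain ⟨s, hs, hs2⟩ := intermediate_value_Icc hab.le hβ.continuous.continuousOn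
      (show α + Real.pi / 2 ∈ Icc (β a) (β b) by
        rw [hβa, hβb]
        constructor <;> linarith [Real.pi_pos])
    refine ⟨s, hs, fun h => ?_⟩
    have h1 := congrFun ((hH s).injective (h.trans (map_zero _).symm)) 1
    simp [hV, hs2] at h1

/-- Half of the equator of the sphere at constant t. -/
lemma IsWarpingFunction.areConjugate_zero (hf : IsWarpingFunction f) (t α : ℝ) :
    AreConjugate (warpMetric 0 (warpCoeff f)) (cyl t (Real.pi / 2) α)
      (cyl t (Real.pi / 2) (α + Real.pi)) := by
  have hd : deriv (fun s => α + s) = fun _ => 1 := by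
    ext s
    simp
  refine hf.areConjugate_of_equator 0 (τ := fun _ => t) (β := fun s => α + s) (a := 0)
    (b := Real.pi) contDiff_const (by fun_prop) (fun s => ?_) (fun s => ?_) Real.pi_pos rfl rfl
    (add_zero α) rfl
  · simp
  · simp [hd]

lemma IsWarpingFunction.areConjugate_one (hf : IsWarpingFunction f) (t α : ℝ) :
    AreConjugate (warpMetric 1 (warpCoeff f)) (cyl t (Real.pi / 2) α)
      (cyl t (Real.pi / 2) (α + Real.pi)) := by
  have hpi := Real.pi_pos
  have hC : ∀ s, Real.cosh s ≠ 0 := fun s => (Real.cosh_pos s).ne'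
  -- The surface r = π/2 carries the hyperbolic metric dt² + e^{2t} dα². The geodesic is the half
  -- circle of radius R about α + π/2; the value of R makes its chord at height e^{-t} have
  -- half-width π/2.
  set R := √(Real.exp (-2 * t) + (Real.pi / 2) ^ 2) with hRdef
  have hR2 : R ^ 2 = Real.exp (-2 * t) + (Real.pi / 2) ^ 2 := Real.sq_sqrt (by positivity)
  have hR : 0 < R := Real.sqrt_pos.2 (by positivity)
  have hlt : Real.pi / 2 < R := by
    refine lt_of_pow_lt_pow_left₀ 2 hR.le ?_
    rw [hR2]
    linarith [Real.exp_pos (-2 * t)]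
  have hmem : Real.pi / 2 / R ∈ Ioo (-1 : ℝ) 1 :=
    ⟨by linarith [show 0 < Real.pi / 2 / R by positivity], (div_lt_one hR).2 hlt⟩
  -- The parameter at which R tanh b = π/2; the end points are at -b and b.
  set b := Real.artanh (Real.pi / 2 / R) with hb
  have htb : Real.sinh b / Real.cosh b = Real.pi / 2 / R := by
    rw [← Real.tanh_eq_sinh_div_cosh, Real.tanh_artanh hmem]
  have hb0 : 0 < b := Real.artanh_pos ⟨by positivity, hmem.2⟩
  have hcb : Real.log (Real.cosh b) - Real.log R = t := by
    have h1 : Real.cosh b ^ 2 / R ^ 2 = Real.exp (2 * t) := by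
      have h2 : Real.exp (2 * t) * Real.exp (-2 * t) = 1 := by
        rw [← Real.exp_add]
        simp
      have h3 : Real.sinh b * R = Real.pi / 2 * Real.cosh b := by
        have := hC b
        field_simp at htb
        linarith
      have h4 : R ^ 2 = Real.cosh b ^ 2 * Real.exp (-2 * t) := by
        linear_combination Real.cosh b ^ 2 * hR2 - R ^ 2 * Real.cosh_sq b
          - (Real.sinh b * R + Real.pi / 2 * Real.cosh b) * h3
      rw [div_eq_iff (by positivity), h4]
      linear_combination -Real.cosh b ^ 2 * h2
    rw [← exp_log_cosh_sub hR] at h1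
    linarith [Real.exp_injective h1]
  have hdτ : deriv (fun s => Real.log (Real.cosh s) - Real.log R) =
      fun s => Real.sinh s / Real.cosh s :=
    funext fun s => (hasDerivAt_log_cosh_sub _ s).deriv
  have hdβ : deriv (fun s => α + Real.pi / 2 + R * (Real.sinh s / Real.cosh s)) =
      fun s => R / Real.cosh s ^ 2 := funext fun s => by
    refine (((hasDerivAt_sinh_div_cosh s).const_mul R).const_add _).deriv.trans ?_
    ring
  refine hf.areConjugate_of_equator 1 (τ := fun s => Real.log (Real.cosh s) - Real.log R)
    (β := fun s => α + Real.pi / 2 + R * (Real.sinh s / Real.cosh s)) (a := -b) (b := b)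
    ((Real.contDiff_cosh.log hC).sub contDiff_const)
    (contDiff_const.add (contDiff_const.mul (Real.contDiff_sinh.div Real.contDiff_cosh hC)))
    (fun s => ?_) (fun s => ?_) (by linarith) ?_ hcb ?_ ?_
  · rw [hdτ, hdβ, exp_log_cosh_sub hR, (hasDerivAt_sinh_div_cosh s).deriv]
    have := hC s
    field_simp
  · rw [hdτ, hdβ, (hasDerivAt_div_cosh_sq R s).deriv]
    ring
  · simp only [Real.cosh_neg]
    exact hcb
  · simp only [Real.cosh_neg, Real.sinh_neg, neg_div, htb]
    field_simp
    ring
  · simp only [htb]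
    field_simp
    ring

end Conjugate

/-! ### Existence of warping functions -/

section Existence

/-- A warping function, interpolating between `sin r` and `2 + r - π` on `[3π/4, π]`. -/
def warpExample (r t : ℝ) : ℝ :=
  Real.sin r + Real.smoothTransition (4 * r / Real.pi - 3) * (2 + r - Real.pi - Real.sin r)
    + expNegInvGlue (r - 2 * Real.pi) * expNegInvGlue t

/-- The last summand is flat at r = 2π and at t = 0, vanishes for r ≤ 2π or t ≤ 0 and is positive
otherwise. The rest interpolates between sin r and 2 + r - π. -/
lemma isWarpingFunction_warpExample : IsWarpingFunction warpExample := by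
  have hpi := Real.pi_pos
  have hpi3 := Real.pi_gt_three
  have h0 : ∀ r t, r ≤ 2 * Real.pi → expNegInvGlue (r - 2 * Real.pi) * expNegInvGlue t = 0 :=
    fun r t h => by rw [expNegInvGlue.zero_of_nonpos (by linarith), zero_mul]
  have h1 : ∀ r, Real.pi ≤ r → Real.smoothTransition (4 * r / Real.pi - 3) = 1 := fun r h => by
    refine Real.smoothTransition.one_of_one_le ?_
    have : 4 ≤ 4 * r / Real.pi := (le_div_iff₀ hpi).2 (by linarith)
    linarith
  refine ⟨ContDiff.contDiffOn ?_, fun r t hr hr2 => ?_, ⟨fun r => warpExample r 0,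
    fun r hr hr2 => ?_⟩, fun r t hr hr2 => ?_, fun r t hr ht => ?_, fun r t hr ht => ?_⟩
  · have hE : ContDiff ℝ ∞ expNegInvGlue := expNegInvGlue.contDiff
    have hT : ContDiff ℝ ∞ Real.smoothTransition := Real.smoothTransition.contDiff
    unfold warpExample
    exact ((Real.contDiff_sin.comp contDiff_fst).add ((hT.comp (by fun_prop)).mul
      (by fun_prop))).add ((hE.comp (by fun_prop)).mul (hE.comp contDiff_snd))
  · have : 4 * r / Real.pi ≤ 3 := (div_le_iff₀ hpi).2 (by linarith)
    rw [warpExample, h0 r t (by linarith),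
      Real.smoothTransition.zero_of_nonpos (by linarith)]
    ring
  · have hs0 : 0 ≤ Real.sin r := Real.sin_nonneg_of_nonneg_of_le_pi (by linarith) hr2
    have hs1 := Real.sin_le_one r
    have ht0 := Real.smoothTransition.nonneg (4 * r / Real.pi - 3)
    have ht1 := Real.smoothTransition.le_one (4 * r / Real.pi - 3)
    have hlin : 0 < 2 + r - Real.pi := by linarith [Real.pi_lt_d2]
    simp only [warpExample, h0 r _ (by linarith)]
    refine ⟨?_, ?_, fun t => trivial⟩
    -- For r < π both interpolated functions are positive; at r = π the sine vanishes, but the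
    -- transition function is already 1.
    · rcases hr2.lt_or_eq with h | rfl
      · have := Real.sin_pos_of_pos_of_lt_pi (by linarith) h
        rcases ht1.lt_or_eq with h' | h'
        · nlinarith [mul_nonneg ht0 hlin.le, mul_pos (sub_pos.2 h') this]
        · rw [h']
          linarith
      · rw [h1 _ le_rfl]
        linarith
    · nlinarith [mul_nonneg ht0 (by linarith : 0 ≤ 2 - (2 + r - Real.pi)),
        mul_nonneg (sub_nonneg.2 ht1) (by linarith : 0 ≤ 2 - Real.sin r)]
  · rw [warpExample, h0 r t hr2, h1 r hr]
    ring
  · rw [warpExample, h1 r (by linarith), expNegInvGlue.zero_of_nonpos ht]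
    ring
  · have := mul_pos (expNegInvGlue.pos_of_pos (sub_pos.2 hr)) (expNegInvGlue.pos_of_pos ht)
    rw [warpExample, h1 r (by linarith)]
    linarith

end Existence

end PlaneCovers

end

theorem mainTheorem6 :
    (∃ f : ℝ → ℝ → ℝ, PlaneCovers.IsWarpingFunction f) ∧
    ∀ f : ℝ → ℝ → ℝ, PlaneCovers.IsWarpingFunction f →
      (PlaneCovers.IsRiemannianMetric (PlaneCovers.euclMetric f) ∧
        PlaneCovers.IsCompleteMetric (PlaneCovers.euclMetric f) ∧
        ¬ PlaneCovers.IsHomogeneous (PlaneCovers.euclMetric f) ∧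
        (∀ t α : ℝ, PlaneCovers.AreConjugate (PlaneCovers.euclMetric f)
          (PlaneCovers.cyl t (Real.pi / 2) α)
          (PlaneCovers.cyl t (Real.pi / 2) (α + Real.pi))) ∧
        PlaneCovers.IsPlaneCover (PlaneCovers.euclMetric f) PlaneCovers.halfPlanePairs ∧
        (∀ S ∈ PlaneCovers.halfPlanePairs,
          PlaneCovers.IsPlaneOfCurvature (PlaneCovers.euclMetric f) 0 S) ∧
        (∀ p : PlaneCovers.Coord 3, PlaneCovers.riemDist (PlaneCovers.euclMetric f) 0 p =
          ENNReal.ofReal √(p 0 ^ 2 + PlaneCovers.rad p ^ 2)) ∧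
        PlaneCovers.HullInBall (PlaneCovers.euclMetric f) ∧
        PlaneCovers.HasSupportTheorem (PlaneCovers.euclMetric f)) ∧
      (PlaneCovers.IsRiemannianMetric (PlaneCovers.hypMetric f) ∧
        PlaneCovers.IsCompleteMetric (PlaneCovers.hypMetric f) ∧
        ¬ PlaneCovers.IsHomogeneous (PlaneCovers.hypMetric f) ∧
        (∀ t α : ℝ, PlaneCovers.AreConjugate (PlaneCovers.hypMetric f)
          (PlaneCovers.cyl t (Real.pi / 2) α)
          (PlaneCovers.cyl t (Real.pi / 2) (α + Real.pi))) ∧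
        PlaneCovers.IsPlaneCover (PlaneCovers.hypMetric f) PlaneCovers.halfPlanePairs ∧
        (∀ S ∈ PlaneCovers.halfPlanePairs,
          PlaneCovers.IsPlaneOfCurvature (PlaneCovers.hypMetric f) (-1) S) ∧
        PlaneCovers.HullInBall (PlaneCovers.hypMetric f) ∧
        PlaneCovers.HasSupportTheorem (PlaneCovers.hypMetric f)) := by
  refine ⟨⟨_, PlaneCovers.isWarpingFunction_warpExample⟩, fun f hf => ?_⟩
  have hQ := hf.isAdmissible
  -- From here on both metrics are warped metrics with the same admissible coefficient, with l = 0
  -- and l = 1.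
  rw [hf.euclMetric_eq, hf.hypMetric_eq]
  refine ⟨⟨hQ.isRiemannianMetric 0, PlaneCovers.isCompleteMetric_warpMetric_zero hQ,
      hf.not_isHomogeneous 0, hf.areConjugate_zero,
      PlaneCovers.isPlaneCover_halfPlanePairs hQ 0, fun S hS => ?_,
      PlaneCovers.riemDist_zero_warpMetric_zero hQ, PlaneCovers.hullInBall_warpMetric_zero hQ,
      PlaneCovers.hasSupportTheorem_warpMetric_zero hQ⟩,
    hQ.isRiemannianMetric 1, PlaneCovers.isCompleteMetric_warpMetric_one hQ,
    hf.not_isHomogeneous 1, hf.areConjugate_one,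
    PlaneCovers.isPlaneCover_halfPlanePairs hQ 1, fun S hS => ?_,
    PlaneCovers.hullInBall_warpMetric_one hQ, PlaneCovers.hasSupportTheorem_warpMetric_one hQ⟩
  · simpa using PlaneCovers.isPlaneOfCurvature_of_mem hQ 0 hS
  · simpa using PlaneCovers.isPlaneOfCurvature_of_mem hQ 1 hS
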